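/- Let $N, B, s \ge 1$ be integers with $B \mid N$ and $Ns \ge 2$, and let $f, g \in \mathbb{Z}[x]$ be polynomials of degree at most $N-1$ with nonnegative coefficients such that all coefficients of $f$, $g$ and $h = f g$ are less than $2^s$. Let $p_0, \dots, p_{n-1}$ be distinct odd primes with $\prod_i p_i > 2^{(2B-1)s}$, of total bit length at most $K B s$, and each of bit length at most $K$ times the bit length of the integer $Bs$, where $K$ is a constant. Assume that the arrays of the $N$ coefficients of $f$ and of $g$ ($s$ bits each) can be initialized in at most $cN$ bit operations each, where $c$ is a constant. Consider the following algorithm. 1. (Kronecker substitution.) Form the bundled polynomials $F(x) = \sum_{m=0}^{N/B-1} \bigl(\sum_{j=0}^{B-1} f_{mB+j} 2^{js}\bigr) x^m$ and, likewise, $G(x)$. 2. Reduce each coefficient of $F$ and $G$ modulo $p_0, \dots, p_{n-1}$ with a remainder tree. 3. For each $i$, multiply the reduced polynomials in $\mathbb{F}_{p_i}[x]$ by the Schönhage–Strassen algorithm. 4. Reconstruct the coefficients of $H = FG$ by divide-and-conquer Chinese remaindering. 5. Write $H_m = \sum_{j=0}^{2B-2} H_m^{(j)} 2^{js}$ with $0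 \le H_m^{(j)} < 2^s$, and output $h_{mB+j} = H_m^{(j)} + H_{m-1}^{(B+j)}$ for $0 \le j < B$ and $0 \le m < 2N/B$ (terms that do not exist are $0$). Integers are multiplied by a Schönhage–Strassen type method (cut into pieces of logarithmic size, then multiplied as polynomials), and divided by means of Newton reciprocals. A bit operation is a Boolean operation on one or two bits, a test of one bit, or the writing of one bit. Then the algorithm outputs the coefficients of $h = f g$, and for every $\varepsilon > 0$ the number of bit operations, including the initialization of $f$ and $g$, is $$O\left(Ns\,(\log(Bs))^{2+\varepsilon} + Ns\left(\log\frac{N}{B}\right)^{1+\varepsilon}\right),$$ where the implied constant depends only on $\varepsilon$, $c$ and $K$. -/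

import Mathlib

open Polynomial

namespace BitAlg

/-! ## Counting bit operations

A computation returns a value together with the number of bit operations that it performed. The only
computation with a cost of its own is `bitOp`, which costs one; it is used for a Boolean operation on
one or two bits, for a test of a bit that controls a branch, and for writing (copying) a single bit.
Control structure that depends only on sizes (loop bounds, recursion, addressing of stored words) is
not a bit operation. -/

structure BitM (α : Type) where
  val : α
  cost : ℕ

instance : Monad BitM where
  pure a := ⟨a, 0⟩
  bind m k :=
    let r := k m.val
    ⟨r.val, m.cost + r.cost⟩

/-- One bit operation with result `a`. -/
def bitOp {α : Type} (a : α) : BitM α := ⟨a, 1⟩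

def xorB (a b : Bool) : BitM Bool := bitOp (a ^^ b)
def andB (a b : Bool) : BitM Bool := bitOp (a && b)
def orB (a b : Bool) : BitM Bool := bitOp (a || b)
def notB (a : Bool) : BitM Bool := bitOp (!a)
/-- Read a bit in order to branch on it. -/
def testB (a : Bool) : BitM Bool := bitOp a
/-- Write a copy of a bit. -/
def copyB (a : Bool) : BitM Bool := bitOp a

def mapB {α β : Type} (f : α → BitM β) : List α → BitM (List β)
  | [] => pure []
  | a :: l => do
    let b ← f a
    let r ← mapB f l
    pure (b :: r)

def zipB {α β γ : Type} (f : α → β → BitM γ) : List α → List β → BitM (List γ)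
  | a :: l, b :: r => do
    let c ← f a b
    let t ← zipB f l r
    pure (c :: t)
  | _, _ => pure []

/-! ## Words of bits -/

/-- A word of bits, least significant bit first. -/
abbrev Bits := List Bool

/-- The natural number written by a word. -/
def toNat : Bits → ℕ
  | [] => 0
  | b :: x => (if b then 1 else 0) + 2 * toNat x

def copyBits (x : Bits) : BitM Bits := mapB copyB x

/-- The word cut, or filled up with zeros, to exactly `w` bits. -/
def resize : ℕ → Bits → BitM Bits
  | 0, _ => pure []
  | w + 1, [] => do
    let b ← copyB false
    let r ← resize w []
    pure (b :: r)
  | w + 1, a :: x => do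
    let b ← copyB a
    let r ← resize w x
    pure (b :: r)

/-- Multiplication by `2 ^ j`. -/
def shiftUp (j : ℕ) (x : Bits) : BitM Bits := copyBits (List.replicate j false ++ x)

/-- Division by `2 ^ j`, rounded down. -/
def shiftDown (j : ℕ) (x : Bits) : BitM Bits := copyBits (x.drop j)

/-- Remove the leading zeros (at the most significant end). -/
def trim : Bits → BitM Bits
  | [] => pure []
  | b :: x => do
    let y ← trim x
    let b' ← testB b
    pure (if y.isEmpty && !b' then [] else b' :: y)

/-- The sum of three bits: the sum bit and the carry. -/
def fullAdd (a b c : Bool) : BitM (Bool × Bool) := do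
  let x ← xorB a b
  let s ← xorB x c
  let u ← andB a b
  let v ← andB x c
  let o ← orB u v
  pure (s, o)

/-- Ripple-carry addition of two words of the same length; returns the sum and the carry. -/
def ripple : Bool → Bits → Bits → BitM (Bits × Bool)
  | c, a :: x, b :: y => do
    let sc ← fullAdd a b c
    let r ← ripple sc.2 x y
    pure (sc.1 :: r.1, r.2)
  | c, _, _ => pure ([], c)

/-- The sum of two words of length `w`, as a word of length `w + 1`. -/
def addBits (x y : Bits) : BitM Bits := do
  let r ← ripple false x y
  pure (r.1 ++ [r.2])

/-- The difference modulo `2 ^ w` of two words of length `w`, and whether `y ≤ x`. -/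
def subBits (x y : Bits) : BitM (Bits × Bool) := do
  let y' ← mapB notB y
  ripple true x y'

/-- The first `count * b` bits of `x`, cut into `count` pieces of `b` bits each, every piece being
stored in a word of `w` bits. -/
def chop (b w : ℕ) : ℕ → Bits → BitM (List Bits)
  | 0, _ => pure []
  | count + 1, x => do
    let c ← resize w (x.take b)
    let r ← chop b w count (x.drop b)
    pure (c :: r)

/-! ## Arithmetic modulo an odd number -/

/-- `x + y` modulo `q` for words `x, y < q` of length `w`. -/
def addMod (w : ℕ) (q x y : Bits) : BitM Bits := do
  let s ← addBits x y
  let d ← subBits s (q ++ [false])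
  let ge ← testB d.2
  if ge then resize w d.1 else resize w s

/-- `x - y` modulo `q` for words `x, y < q` of length `w`. -/
def subMod (w : ℕ) (q x y : Bits) : BitM Bits := do
  let d ← subBits x y
  let ge ← testB d.2
  if ge then pure d.1 else do
    let s ← addBits d.1 q
    resize w s

/-- `x / 2` modulo an odd `q`, for a word `x < q` of length `w`. -/
def halfMod (w : ℕ) (q x : Bits) : BitM Bits := do
  let odd ← testB (x.headD false)
  if odd then do
    let s ← addBits x q
    shiftDown 1 s
  else do
    let s ← shiftDown 1 x
    resize w s

/-- Arithmetic of a coefficient ring (in which 2 is invertible) on words of `width` bits. -/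
structure BitRing where
  width : ℕ
  add : Bits → Bits → BitM Bits
  sub : Bits → Bits → BitM Bits
  half : Bits → BitM Bits
  mul : Bits → Bits → BitM Bits

def modRing (w : ℕ) (q : Bits) (mul : Bits → Bits → BitM Bits) : BitRing where
  width := w
  add := addMod w q
  sub := subMod w q
  half := halfMod w q
  mul := mul

/-! ## The Schönhage–Strassen multiplication of polynomials

A polynomial is the list of its coefficients, constant term first. For a ring `R` and a length
`n = 2 ^ k`, lists of length `n` represent `R[x] / (x ^ n + 1)`. -/

abbrev Poly := List Bits

def addV (R : BitRing) (a b : Poly) : BitM Poly := zipB R.add a b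
def subV (R : BitRing) (a b : Poly) : BitM Poly := zipB R.sub a b

def negV (R : BitRing) (a : Poly) : BitM Poly :=
  mapB (fun x => do
    let z ← resize R.width []
    R.sub z x) a

def zeroV (R : BitRing) (n : ℕ) : BitM Poly := mapB (fun _ => resize R.width []) (List.range n)

/-- Multiplication by `x ^ e` in `R[x] / (x ^ n + 1)`, where `n` is the length of `a`. -/
def mulXPow (R : BitRing) (e : ℕ) (a : Poly) : BitM Poly := do
  let n := a.length
  let e' := e % (2 * n)
  if e' < n then do
    let u ← mapB copyBits (a.take (n - e'))
    let v ← negV R (a.drop (n - e'))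
    pure (v ++ u)
  else do
    let u ← negV R (a.take (2 * n - e'))
    let v ← mapB copyBits (a.drop (2 * n - e'))
    pure (v ++ u)

/-- Schoolbook multiplication in `R[x] / (x ^ n + 1)`, where `n` is the length of `g`. -/
def schoolPoly (R : BitRing) : Poly → Poly → BitM Poly
  | [], g => zeroV R g.length
  | a :: f, g => do
    let r ← schoolPoly R f g
    let r' ← mulXPow R 1 r
    let p ← mapB (R.mul a) g
    addV R p r'

/-- The fast Fourier transform of a polynomial in `y` of length `2 ^ r` whose coefficients lie in
`R[x] / (x ^ n + 1)`: it is reduced modulo the linear factors of `y ^ (2 ^ r) - x ^ E`, by splitting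
`y ^ (2 h) - x ^ E` into `y ^ h - x ^ (E / 2)` and `y ^ h - x ^ (E / 2 + n)`. -/
def fft (R : BitRing) (n : ℕ) : ℕ → ℕ → List Poly → BitM (List Poly)
  | 0, _, a => pure a
  | r + 1, E, a => do
    let lo := a.take (2 ^ r)
    let hi ← mapB (mulXPow R (E / 2)) (a.drop (2 ^ r))
    let s ← zipB (addV R) lo hi
    let d ← zipB (subV R) lo hi
    let s' ← fft R n r (E / 2) s
    let d' ← fft R n r (E / 2 + n) d
    pure (s' ++ d')

/-- The inverse of `fft`. -/
def ifft (R : BitRing) (n : ℕ) : ℕ → ℕ → List Poly → BitM (List Poly)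
  | 0, _, a => pure a
  | r + 1, E, a => do
    let s ← ifft R n r (E / 2) (a.take (2 ^ r))
    let d ← ifft R n r (E / 2 + n) (a.drop (2 ^ r))
    let u ← zipB (addV R) s d
    let v ← zipB (subV R) s d
    let lo ← mapB (mapB R.half) u
    let hi ← mapB (mapB R.half) v
    let hi' ← mapB (mulXPow R (2 * n - E / 2)) hi
    pure (lo ++ hi')

/-- Split a polynomial into `count` blocks of `m` coefficients, each filled up with `m` zeros. -/
def blocks (R : BitRing) (m : ℕ) : ℕ → Poly → BitM (List Poly)
  | 0, _ => pure []
  | count + 1, f => do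
    let c ← mapB copyBits (f.take m)
    let z ← zeroV R m
    let r ← blocks R m count (f.drop m)
    pure ((c ++ z) :: r)

/-- Put `y = x ^ m` into a polynomial in `y` whose coefficients have length `2 m`; `prev` is the
part carried over from the preceding coefficient. -/
def unblock (R : BitRing) (m : ℕ) : Poly → List Poly → BitM Poly
  | _, [] => pure []
  | prev, c :: cs => do
    let lo ← addV R (c.take m) prev
    let r ← unblock R m (c.drop m) cs
    pure (lo ++ r)

/-- Schönhage–Strassen multiplication in `R[x] / (x ^ (2 ^ k) + 1)`: with `m = 2 ^ (k / 2)` and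
`t = 2 ^ k / m`, the factors are read as polynomials in `y = x ^ m` modulo `y ^ t + 1` with
coefficients in `R[x] / (x ^ (2 m) + 1)`, where `x` is a primitive `4 m`-th root of unity. The first
argument bounds the depth of the recursion. -/
def ssPoly (R : BitRing) : ℕ → ℕ → Poly → Poly → BitM Poly
  | 0, _, f, g => schoolPoly R f g
  | depth + 1, k, f, g =>
    if k ≤ 2 then schoolPoly R f g
    else do
      let m := 2 ^ (k / 2)
      let r := k - k / 2
      let F ← blocks R m (2 ^ r) f
      let G ← blocks R m (2 ^ r) g
      let F' ← fft R (2 * m) r (2 * m) F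
      let G' ← fft R (2 * m) r (2 * m) G
      let H' ← zipB (ssPoly R depth (k / 2 + 1)) F' G'
      let H ← ifft R (2 * m) r (2 * m) H'
      let last ← negV R ((H.getLastD []).drop m)
      unblock R m last H

/-- The product of two polynomials of length `n`, as a list of `2 n - 1` coefficients. -/
def polyMul (R : BitRing) (n : ℕ) (f g : Poly) : BitM Poly := do
  let k := Nat.clog 2 (2 * n)
  let zf ← zeroV R (2 ^ k - n)
  let zg ← zeroV R (2 ^ k - n)
  let h ← ssPoly R k k (f ++ zf) (g ++ zg)
  mapB copyBits (h.take (2 * n - 1))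

/-! ## Multiplication of integers -/

/-- Schoolbook multiplication: a word of length `w` for `x * y` modulo `2 ^ w`. -/
def schoolMul (w : ℕ) : Bits → Bits → BitM Bits
  | [], _ => resize w []
  | a :: x, y => do
    let r ← schoolMul w x y
    let r' ← shiftUp 1 r
    let r'' ← resize w r'
    let t ← testB a
    if t then do
      let y' ← resize w y
      let s ← addBits r'' y'
      resize w s
    else pure r''

/-- Multiplication modulo `2 ^ w - 1`, by means of a multiplication `mul` of `w`-bit words. -/
def mulMersenne (w : ℕ) (mul : Bits → Bits → BitM Bits) (x y : Bits) : BitM Bits := do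
  let z ← mul x y
  addMod w (List.replicate w true) (z.take w) (z.drop w)

/-- Evaluate a polynomial with `w`-bit coefficients at `2 ^ b` by propagating carries. -/
def carryOut (b w : ℕ) : Bits → Poly → BitM Bits
  | carry, [] => pure carry
  | carry, c :: cs => do
    let s ← addBits c carry
    let lo ← copyBits (s.take b)
    let hi ← resize w (s.drop b)
    let r ← carryOut b w hi cs
    pure (lo ++ r)

/-- The product, of length `2 n`, of two words of length `n`. The words are cut into pieces of about
`log n` bits, and the resulting polynomials are multiplied modulo `2 ^ w - 1`, where the coefficients
of their product have less than `w` bits. The first argument bounds the depth of the recursion. -/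
def intMulAux : ℕ → ℕ → Bits → Bits → BitM Bits
  | 0, n, x, y => schoolMul (2 * n) x y
  | depth + 1, n, x, y =>
    if n < 32 then schoolMul (2 * n) x y
    else do
      let b := Nat.size n
      let w := 3 * b
      let count := n / b + 1
      let X ← chop b w count x
      let Y ← chop b w count y
      let R := modRing w (List.replicate w true) (mulMersenne w (intMulAux depth w))
      let Z ← polyMul R count X Y
      let c ← resize w []
      let z ← carryOut b w c Z
      resize (2 * n) z

/-- The product of two words, of twice the length of the longer one. -/
def intMul (x y : Bits) : BitM Bits := do
  let n := max x.length y.length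
  let x' ← resize n x
  let y' ← resize n y
  intMulAux n n x' y'

/-! ## Division of integers

A divisor `d` is given without leading zeros. -/

/-- Long division of `x` by `d`; returns the quotient, of the length of `x`, and the remainder, of
the length of `d`. -/
def longDiv (d : Bits) : Bits → BitM (Bits × Bits)
  | [] => do
    let z ← resize d.length []
    pure ([], z)
  | b :: x => do
    let qr ← longDiv d x
    let r ← copyBits (b :: qr.2)
    let e ← subBits r (d ++ [false])
    let ge ← testB e.2
    let r' ← if ge then resize d.length e.1 else resize d.length r
    pure (ge :: qr.1, r')

/-- The reciprocal of `d`, which is `2 ^ (2 * k) / d` rounded down, for a word `d` of `k` bits; as a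
word of `k + 2` bits. It is computed by the Newton iteration. The first argument bounds the depth of
the recursion. -/
def recipAux : ℕ → Bits → BitM Bits
  | 0, d => do
    let num ← shiftUp (2 * d.length) [true]
    let qr ← longDiv d num
    resize (d.length + 2) qr.1
  | depth + 1, d =>
    let k := d.length
    if k ≤ 8 then do
      let num ← shiftUp (2 * k) [true]
      let qr ← longDiv d num
      resize (k + 2) qr.1
    else do
      let h := k / 2 + 3
      let dh ← shiftDown (k - h) d
      let vh ← recipAux depth dh
      let v₀ ← shiftUp (k - h) vh
      let sq ← intMul v₀ v₀
      let p ← intMul sq d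
      let u ← shiftDown (2 * k) p
      let u' ← resize (k + 3) u
      let dbl ← shiftUp 1 v₀
      let v ← subBits dbl u'
      let v' ← resize (k + 2) v.1
      let dv ← intMul d v'
      let num ← shiftUp (2 * k) [true]
      let num' ← resize dv.length num
      let fits ← subBits num' dv
      let ok ← testB fits.2
      if ok then pure v'
      else do
        let one ← resize (k + 2) [true]
        let v'' ← subBits v' one
        pure v''.1

def recip (d : Bits) : BitM Bits := recipAux d.length d

/-- The remainder of `r * 2 ^ k + c` modulo `d`, where `k` is the length of the words `d`, `c` and
`r < d`, and `v` is the reciprocal of `d`. -/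
def modStep (d v r c : Bits) : BitM Bits := do
  let k := d.length
  let a ← copyBits (c ++ r)
  let av ← intMul a v
  let q ← shiftDown (2 * k) av
  let q' ← resize k q
  let qd ← intMul q' d
  let e ← subBits a qd
  let e' ← resize (k + 1) e.1
  let e'' ← subBits e' (d ++ [false])
  let ge ← testB e''.2
  if ge then resize k e''.1 else resize k e'

def modPieces (d v : Bits) : List Bits → BitM Bits
  | [] => resize d.length []
  | c :: cs => do
    let r ← modPieces d v cs
    modStep d v r c

/-- The remainder of `a` modulo `d`, of the length of `d`. -/
def modBits (a d : Bits) : BitM Bits := do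
  let v ← recip d
  let cs ← chop d.length d.length (a.length / d.length + 1) a
  modPieces d v cs

/-! ## Arithmetic modulo a prime -/

def mulMod (p x y : Bits) : BitM Bits := do
  let z ← intMul x y
  modBits z p

/-- The field with `p` elements. -/
def primeField (p : Bits) : BitRing := modRing p.length p (mulMod p)

/-- `a ^ e` modulo `p`. -/
def powMod (p a : Bits) : Bits → BitM Bits
  | [] => resize p.length [true]
  | b :: e => do
    let h ← powMod p a e
    let h₂ ← mulMod p h h
    let t ← testB b
    if t then mulMod p h₂ a else pure h₂

/-- The inverse of `a` modulo the prime `p`, as `a ^ (p - 2)`. -/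
def invMod (p a : Bits) : BitM Bits := do
  let two ← resize p.length [false, true]
  let e ← subBits p two
  powMod p a e.1

/-! ## Remainder trees and Chinese remaindering -/

/-- A binary tree of products; `leaf p` holds a modulus, and `node P l r` the product `P` of the
values of `l` and `r`. -/
inductive ProdTree where
  | leaf (p : Bits) : ProdTree
  | node (P : Bits) (l r : ProdTree) : ProdTree

def ProdTree.value : ProdTree → Bits
  | leaf p => p
  | node P _ _ => P

def ProdTree.leaves : ProdTree → ℕ
  | leaf _ => 1
  | node _ l r => l.leaves + r.leaves

/-- The product tree of a nonempty list of moduli. The first argument bounds the depth. -/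
def prodTree : ℕ → List Bits → BitM ProdTree
  | 0, ps => pure (.leaf (ps.headD []))
  | depth + 1, ps =>
    if ps.length ≤ 1 then pure (.leaf (ps.headD []))
    else do
      let l ← prodTree depth (ps.take (ps.length / 2))
      let r ← prodTree depth (ps.drop (ps.length / 2))
      let P ← intMul l.value r.value
      let P' ← trim P
      pure (.node P' l r)

/-- The remainders of `x` modulo all the leaves. -/
def remTree : ProdTree → Bits → BitM (List Bits)
  | .leaf p, x => do
    let y ← modBits x p
    pure [y]
  | .node P l r, x => do
    let y ← modBits x P
    let a ← remTree l y
    let b ← remTree r y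
    pure (a ++ b)

/-- The sum of `c p * (P / p)` over all the leaves `p`, modulo the product `P` of all the leaves. -/
def combine : ProdTree → List Bits → BitM Bits
  | .leaf p, c => resize p.length (c.headD [])
  | .node P l r, c => do
    let a ← combine l (c.take l.leaves)
    let b ← combine r (c.drop l.leaves)
    let u ← intMul a r.value
    let v ← intMul b l.value
    let u' ← resize P.length u
    let v' ← resize P.length v
    addMod P.length P u' v'

/-- The inverses of `P / p` modulo `p`, for all the leaves `p`. -/
def crtInverses (T : ProdTree) (ps : List Bits) : BitM (List Bits) := do
  let ones ← mapB (fun p : Bits => resize p.length [true]) ps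
  let D ← combine T ones
  let rs ← remTree T D
  zipB invMod ps rs

/-- The number less than `P` that has the given residues. -/
def crt (T : ProdTree) (ps invs residues : List Bits) : BitM Bits := do
  let ri ← zipB (fun (pi : Bits × Bits) r => mulMod pi.1 pi.2 r) (ps.zip invs) residues
  combine T ri

/-! ## The five stages of the multiplication of polynomials -/

/-- Stage 1: bundle each group of `B` coefficients of `s` bits into one number of `B * s` bits (the
value of the group at `2 ^ s`); there are `count` groups. -/
def bundle (B : ℕ) : ℕ → Poly → BitM Poly
  | 0, _ => pure []
  | count + 1, f => do
    let c ← copyBits (f.take B).flatten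
    let r ← bundle B count (f.drop B)
    pure (c :: r)

/-- The first `n` columns of a matrix that is stored by rows. -/
def columns (n : ℕ) (rows : List (List Bits)) : BitM (List (List Bits)) :=
  mapB (fun i => mapB (fun row : List Bits => copyBits (row.getD i [])) rows) (List.range n)

/-- Stage 2: reduce each coefficient modulo all primes with the remainder tree; returns one list of
coefficients for each of the `n` primes. -/
def reduceAll (T : ProdTree) (n : ℕ) (F : Poly) : BitM (List Poly) := do
  let rows ← mapB (remTree T) F
  columns n rows

/-- Stage 3: multiply the reduced polynomials, of length `N₀`, modulo each prime. -/
def mulAll (N₀ : ℕ) : List Bits → List Poly → List Poly → BitM (List Poly)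
  | p :: ps, f :: fs, g :: gs => do
    let h ← polyMul (primeField p) N₀ f g
    let r ← mulAll N₀ ps fs gs
    pure (h :: r)
  | _, _, _ => pure []

/-- Stage 4: reconstruct the `2 * N₀ - 1` coefficients of the product of the bundled polynomials by
the Chinese remainder theorem. -/
def reconstruct (T : ProdTree) (ps : List Bits) (N₀ : ℕ) (Hs : List Poly) : BitM Poly := do
  let invs ← crtInverses T ps
  let rows ← columns (2 * N₀ - 1) Hs
  mapB (crt T ps invs) rows

/-- Stage 5: cut each coefficient into digits of `s` bits, and add the upper digits of each one to
the lower digits of the next. -/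
def extractAux (B s : ℕ) : Poly → Poly → BitM Poly
  | prev, [] => pure prev
  | prev, H :: Hs => do
    let digits ← chop s s (2 * B - 1) H
    let cur ← zipB (fun x y => do
      let t ← addBits x y
      resize s t) (digits.take B) prev
    let z ← resize s []
    let r ← extractAux B s (digits.drop B ++ [z]) Hs
    pure (cur ++ r)

def extract (B s : ℕ) (H : Poly) : BitM Poly := do
  let z ← mapB (fun _ => resize s []) (List.range B)
  extractAux B s z H

/-- The product of two polynomials with `N` coefficients of `s` bits, with the bundling parameter `B`
and the primes `ps`; a list of `2 * N` coefficients of `s` bits. -/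
def multiply (N B s : ℕ) (ps : List Bits) (f g : Poly) : BitM Poly := do
  let N₀ := N / B
  let F ← bundle B N₀ f
  let G ← bundle B N₀ g
  let T ← prodTree ps.length ps
  let Fs ← reduceAll T ps.length F
  let Gs ← reduceAll T ps.length G
  let Hs ← mulAll N₀ ps Fs Gs
  let H ← reconstruct T ps N₀ Hs
  extract B s H

/-- Initialize the coefficients of both factors and multiply. -/
def initAndMultiply (N B s : ℕ) (ps : List Bits) (initF initG : BitM Poly) : BitM Poly := do
  let f ← initF
  let g ← initG
  multiply N B s ps f g

/-! ## Notions for the statement -/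

/-- The integer polynomial with the given coefficients. -/
noncomputable def toPoly : Poly → ℤ[X]
  | [] => 0
  | c :: cs => C (toNat c : ℤ) + X * toPoly cs

/-- `a` is the array of the first `n` coefficients of `f`, each of them a nonnegative integer stored
in a word of `s` bits; all the other coefficients of `f` are zero. -/
def IsCoeffArray (n s : ℕ) (f : ℤ[X]) (a : Poly) : Prop :=
  a.length = n ∧ (∀ c ∈ a, c.length = s) ∧ toPoly a = f

/-- The primes are admissible for the parameters `B` and `s`: they are distinct and odd, their product
exceeds `2 ^ ((2 B - 1) s)`, their total number of bits is at most `K B s`, and each of them fits into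
a machine word whose size is at most `K` times the number of bits of `B s`. -/
structure AdmissiblePrimes (K B s : ℕ) (ps : List ℕ) : Prop where
  prime : ∀ p ∈ ps, p.Prime
  odd : ∀ p ∈ ps, Odd p
  nodup : ps.Nodup
  lt_prod : 2 ^ ((2 * B - 1) * s) < ps.prod
  total_size : (ps.map Nat.size).sum ≤ K * (B * s)
  word_size : ∀ p ∈ ps, Nat.size p ≤ K * Nat.size (B * s)

end BitAlg

/-! Correctness rests on nonnegativity. Write `f` and `g` as polynomials in `y` over `ℕ[x]` with `y
= x ^ B` and inner degree below `B`. The inner coefficients of their product are summands of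
coefficients of `h`, hence also below `2 ^ s`. So setting `x = 2 ^ s` loses nothing: each `H_m` has
at most `2 B - 1` digits in base `2 ^ s`, is smaller than the product of the primes, is recovered
from its residues, and its digits, added with overlap, give `h` (`coeff_coeff_le`, `crt_spec`,
`extractAux_spec`, assembled in `multiply_spec`).

Polynomial multiplication works over any commutative ring in which 2 is a unit (`Implements`),
because the roots of unity are powers of `x` modulo `x ^ (2 m) + 1`. It therefore serves both the
prime fields of stage 3 and the residues modulo `2 ^ w - 1` behind integer multiplication. The
transforms give the product modulo `y ^ t + 1` over the quotient ring, and degree bounds lift it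
(`X_pow_add_one_dvd_of_map`). One level sends the exponent `k` to `k / 2 + 1` and doubles the total
length; after about `log k` levels there are `O(2 ^ k * k)` ring multiplications and `O(2 ^ k * k *
log k)` linear operations (`ssPoly_spec`).

For integers of `n` bits and `b = size n` this yields `M(n) ≤ n (128 M(3 b) + O(b log b))`, whence
`M(n) = O(n (log n) ^ (1 + ε))` for every `ε > 0` (`exists_intMulCost_le`). `MulBound` converts this
into a uniform cost `λ` per bit up to a maximal length. Newton division (`newton_step`) is then
`O(λ)` per bit, and each level of a remainder tree or of a Chinese remainder tree costs `O(λ)` times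
the total length of the primes.

Put `x = B s` and `n = N / B`. The primes have `S` bits in all, with `x ≤ S ≤ K x`; the trees have
`O(log x)` levels and `λ = O((log x) ^ (1 + ε))`, so stages 2 and 4 cost `O(n S (log x) ^ (2 + ε))`.
In stage 3 the integers have only `O(log x)` bits, so their factor `λ'` is below any power of `log
x`, and the mixed term `log n * (log x) ^ ε` is dominated by the two terms of the claim
(`mul_rpow_le_rpow_add_rpow`, `exists_stage_bound`). -/

namespace BitAlg

/-! ## Specifications of computations -/

/-- The result of `m` satisfies `P`, and `m` performs at most `c` bit operations. -/
structure Spec {α : Type} (m : BitM α) (P : α → Prop) (c : ℕ) : Prop where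
  val : P m.val
  cost : m.cost ≤ c

theorem Spec.pure {α : Type} {a : α} {P : α → Prop} (h : P a) : Spec (Pure.pure a : BitM α) P 0 :=
  ⟨h, le_rfl⟩

theorem Spec.bitOp {α : Type} {a : α} {P : α → Prop} (h : P a) : Spec (bitOp a) P 1 :=
  ⟨h, le_rfl⟩

/-- Costs compose because `d` bounds the second computation for every value allowed by `P`: nothing
else about the first result is ever used. -/
theorem Spec.bind {α β : Type} {m : BitM α} {k : α → BitM β} {P : α → Prop} {Q : β → Prop}
    {c d : ℕ} (h : Spec m P c) (hk : ∀ a, P a → Spec (k a) Q d) : Spec (m >>= k) Q (c + d) :=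
  ⟨(hk _ h.val).val, Nat.add_le_add h.cost (hk _ h.val).cost⟩

theorem Spec.mono {α : Type} {m : BitM α} {P Q : α → Prop} {c d : ℕ} (h : Spec m P c)
    (hPQ : ∀ a, P a → Q a) (hcd : c ≤ d) : Spec m Q d :=
  ⟨hPQ _ h.val, h.cost.trans hcd⟩

theorem Spec.le {α : Type} {m : BitM α} {P : α → Prop} {c d : ℕ} (h : Spec m P c)
    (hcd : c ≤ d) : Spec m P d :=
  ⟨h.val, h.cost.trans hcd⟩

theorem Spec.imp {α : Type} {m : BitM α} {P Q : α → Prop} {c : ℕ} (h : Spec m P c)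
    (hPQ : ∀ a, P a → Q a) : Spec m Q c :=
  ⟨hPQ _ h.val, h.cost⟩

theorem Spec.ite {α : Type} {p : Prop} [Decidable p] {m m' : BitM α} {P : α → Prop} {c : ℕ}
    (h : p → Spec m P c) (h' : ¬ p → Spec m' P c) : Spec (if p then m else m') P c := by
  split
  · exact h ‹_›
  · exact h' ‹_›

theorem Spec.testB (a : Bool) : Spec (testB a) (fun b => b = a) 1 := ⟨rfl, le_rfl⟩
theorem Spec.copyB (a : Bool) : Spec (copyB a) (fun b => b = a) 1 := ⟨rfl, le_rfl⟩

theorem Spec.mapB {α β : Type} {f : α → BitM β} {P : α → β → Prop} {c : α → ℕ} :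
    ∀ {l : List α}, (∀ a ∈ l, Spec (f a) (P a) (c a)) →
      Spec (mapB f l) (fun r => List.Forall₂ P l r) (l.map c).sum
  | [], _ => Spec.pure .nil
  | a :: l, h => by
    refine Spec.le (Spec.bind (h a (by simp)) fun b hb =>
      Spec.bind (Spec.mapB (l := l) fun x hx => h x (by simp [hx])) fun r hr =>
        Spec.pure (.cons hb hr)) (by simp)

theorem Spec.mapB_const {α β : Type} {f : α → BitM β} {P : α → β → Prop} {c : ℕ}
    {l : List α} (h : ∀ a ∈ l, Spec (f a) (P a) c) :
      Spec (BitAlg.mapB f l) (fun r => List.Forall₂ P l r) (l.length * c) :=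
  (Spec.mapB h).le (by simp)

/-! ## Values of words -/

@[simp] theorem toNat_nil : toNat [] = 0 := rfl

@[simp] theorem toNat_cons (b : Bool) (x : Bits) :
    toNat (b :: x) = b.toNat + 2 * toNat x := by cases b <;> rfl

theorem toNat_append (x y : Bits) : toNat (x ++ y) = toNat x + 2 ^ x.length * toNat y := by
  induction x with
  | nil => simp
  | cons b x ih => simp [ih, pow_succ]; ring

theorem toNat_lt (x : Bits) : toNat x < 2 ^ x.length := by
  induction x with
  | nil => simp
  | cons b x ih => have := b.toNat_lt; simp [pow_succ]; omega

@[simp] theorem toNat_replicate_false (n : ℕ) : toNat (List.replicate n false) = 0 := by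
  induction n with
  | zero => rfl
  | succ n ih => simp [List.replicate_succ, ih]

theorem toNat_replicate_true (n : ℕ) : toNat (List.replicate n true) + 1 = 2 ^ n := by
  induction n with
  | zero => rfl
  | succ n ih => simp [List.replicate_succ, pow_succ]; omega

theorem toNat_take (b : ℕ) (x : Bits) : toNat (x.take b) = toNat x % 2 ^ b := by
  induction x generalizing b with
  | nil => simp
  | cons a x ih =>
    cases b with
    | zero => simp [Nat.mod_one]
    | succ b =>
      have := a.toNat_lt
      have h : (a.toNat + 2 * toNat x) / 2 = toNat x := by omega
      simp only [List.take_succ_cons, toNat_cons, ih, pow_succ', Nat.mod_mul, h]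
      omega

theorem toNat_drop (b : ℕ) (x : Bits) : toNat (x.drop b) = toNat x / 2 ^ b := by
  induction x generalizing b with
  | nil => simp
  | cons a x ih =>
    cases b with
    | zero => simp
    | succ b =>
      have := a.toNat_lt
      simp only [List.drop_succ_cons, toNat_cons, ih, pow_succ', ← Nat.div_div_eq_div_mul]
      congr 1
      omega

theorem toNat_bits (n : ℕ) : toNat n.bits = n := by
  induction n using Nat.binaryRec' with
  | zero => simp
  | bit b n h ih => rw [Nat.bits_append_bit _ _ h, toNat_cons, ih, Nat.bit_val]; omega

theorem length_bits (n : ℕ) : n.bits.length = n.size := (Nat.size_eq_bits_len n).symm ▸ rfl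

/-- The word has no leading zeros, and it is not empty. -/
def NoLead (d : Bits) : Prop := 2 ^ d.length ≤ 2 * toNat d

theorem NoLead.length_pos {d : Bits} (h : NoLead d) : 0 < d.length := by
  cases d with
  | nil => simp [NoLead] at h
  | cons => simp

theorem NoLead.pos {d : Bits} (h : NoLead d) : 0 < toNat d := by
  have : 0 < 2 ^ d.length := by positivity
  unfold NoLead at h; omega

theorem noLead_bits {n : ℕ} (hn : n ≠ 0) : NoLead n.bits := by
  unfold NoLead
  rw [toNat_bits, length_bits]
  have h : n.size - 1 < n.size := by have := Nat.size_pos.2 (Nat.pos_of_ne_zero hn); omega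
  rw [Nat.lt_size] at h
  have : 2 ^ n.size = 2 * 2 ^ (n.size - 1) := by
    rw [← pow_succ']; congr 1; have := Nat.size_pos.2 (Nat.pos_of_ne_zero hn); omega
  omega

/-! ## Elementary operations on words -/

theorem copyBits_spec (x : Bits) : Spec (copyBits x) (fun y => y = x) x.length := by
  refine (Spec.mapB_const (l := x) fun a _ => Spec.copyB a).mono (fun y hy => ?_) (by simp)
  have := List.forall₂_eq_eq_eq (α := Bool)
  have h2 : List.Forall₂ (fun a b : Bool => a = b) x y := hy.imp fun _ _ h => h.symm
  have h3 : List.Forall₂ (· = ·) x y := h2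
  rw [List.forall₂_eq_eq_eq] at h3
  exact h3.symm

theorem resize_spec (w : ℕ) (x : Bits) :
    Spec (resize w x) (fun y => y.length = w ∧ toNat y = toNat x % 2 ^ w) w := by
  induction w generalizing x with
  | zero => exact Spec.pure (by simp [Nat.mod_one])
  | succ w ih =>
    cases x with
    | nil =>
      refine Spec.le (Spec.bind (Spec.copyB _) fun b hb => Spec.bind (ih []) fun r hr =>
        Spec.pure ?_) (by omega)
      subst hb
      simp [hr]
    | cons a x =>
      refine Spec.le (Spec.bind (Spec.copyB _) fun b hb => Spec.bind (ih x) fun r hr =>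
        Spec.pure ?_) (by omega)
      subst hb
      have := b.toNat_lt
      have h : (b.toNat + 2 * toNat x) / 2 = toNat x := by omega
      simp only [List.length_cons, hr.1, toNat_cons, hr.2, pow_succ', Nat.mod_mul, true_and, h]
      omega

theorem resize_spec_of_lt {w : ℕ} {x : Bits} (h : toNat x < 2 ^ w) :
    Spec (resize w x) (fun y => y.length = w ∧ toNat y = toNat x) w :=
  (resize_spec w x).imp fun y hy => ⟨hy.1, by rw [hy.2, Nat.mod_eq_of_lt h]⟩

theorem shiftUp_spec (j : ℕ) (x : Bits) :
    Spec (shiftUp j x) (fun y => y.length = j + x.length ∧ toNat y = 2 ^ j * toNat x)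
      (j + x.length) :=
  (copyBits_spec _).mono (fun y hy => by subst hy; simp [toNat_append]) (by simp)

theorem shiftDown_spec (j : ℕ) (x : Bits) :
    Spec (shiftDown j x) (fun y => y.length = x.length - j ∧ toNat y = toNat x / 2 ^ j)
      (x.length - j) :=
  (copyBits_spec _).mono (fun y hy => by subst hy; simp [toNat_drop]) (by simp)

/-- The disjunction is needed because zero is trimmed to the empty word, which is not `NoLead`. -/
theorem trim_spec (x : Bits) :
    Spec (trim x) (fun y => toNat y = toNat x ∧ (y = [] ∨ NoLead y)) x.length := by
  induction x with
  | nil => exact Spec.pure (by simp)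
  | cons b x ih =>
    refine Spec.le (Spec.bind ih fun y hy => Spec.bind (Spec.testB b) fun b' hb =>
      Spec.pure ?_) (by simp)
    subst hb
    rcases hy with ⟨hy, rfl | h⟩
    · have hx : toNat x = 0 := hy.symm
      cases b' <;> simp [NoLead, hx]
    · have h0 : y.isEmpty = false := by
        cases y with
        | nil => exact absurd h.length_pos (by simp)
        | cons => rfl
      simp only [h0, Bool.false_and, Bool.false_eq_true, if_false]
      refine ⟨by simp [hy], Or.inr ?_⟩
      simp only [NoLead, List.length_cons, pow_succ, toNat_cons] at h ⊢
      omega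

theorem trim_spec_of_pos {x : Bits} (hx : 0 < toNat x) :
    Spec (trim x) (fun y => toNat y = toNat x ∧ NoLead y) x.length :=
  (trim_spec x).imp fun y hy => ⟨hy.1, hy.2.resolve_left (by rintro rfl; simp at hy; omega)⟩

theorem fullAdd_spec (a b c : Bool) :
    Spec (fullAdd a b c) (fun r => r.1.toNat + 2 * r.2.toNat = a.toNat + b.toNat + c.toNat) 5 := by
  constructor
  · cases a <;> cases b <;> cases c <;> rfl
  · exact le_rfl

theorem ripple_spec {w : ℕ} : ∀ {x y : Bits} (c : Bool), x.length = w → y.length = w →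
    Spec (ripple c x y)
      (fun r => r.1.length = w ∧ toNat r.1 + 2 ^ w * r.2.toNat = toNat x + toNat y + c.toNat)
      (5 * w) := by
  induction w with
  | zero =>
    intro x y c hx hy
    rw [List.length_eq_zero_iff] at hx hy
    subst hx hy
    exact Spec.pure (by simp)
  | succ w ih =>
    intro x y c hx hy
    match x, y, hx, hy with
    | a :: x, b :: y, hx, hy =>
      refine Spec.le (Spec.bind (fullAdd_spec a b c) fun sc h => Spec.bind
        (ih sc.2 (x := x) (y := y) (by simpa using hx) (by simpa using hy)) fun r hr =>
          Spec.pure ?_) (by omega)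
      refine ⟨by simp [hr.1], ?_⟩
      have := hr.2
      simp only [toNat_cons, pow_succ]
      linarith

theorem addBits_spec {w : ℕ} {x y : Bits} (hx : x.length = w) (hy : y.length = w) :
    Spec (addBits x y) (fun z => z.length = w + 1 ∧ toNat z = toNat x + toNat y) (5 * w) := by
  refine Spec.le (Spec.bind (ripple_spec false hx hy) fun r hr => Spec.pure ?_) (by omega)
  refine ⟨by simp [hr.1], ?_⟩
  have := hr.2
  simp only [toNat_append, toNat_cons, toNat_nil, hr.1] at *
  simpa using this

theorem mapB_notB_spec (x : Bits) :
    Spec (mapB notB x) (fun y => y.length = x.length ∧ toNat y + toNat x + 1 = 2 ^ x.length)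
      x.length := by
  induction x with
  | nil => exact Spec.pure (by simp)
  | cons a x ih =>
    refine Spec.le (Spec.bind (Spec.bitOp (P := fun b => b = !a) rfl) fun b hb =>
      Spec.bind ih fun r hr => Spec.pure ?_) (by simp; omega)
    subst hb
    refine ⟨by simp [hr.1], ?_⟩
    have := hr.2
    cases a <;> simp [pow_succ] <;> omega

/-- Adding the complement of `y` with carry-in 1 produces `x - y + 2 ^ w`, so the carry-out is set
exactly when there is no borrow. The wrapped difference is recorded too, because `subMod` corrects
it by adding the modulus. -/
theorem subBits_spec {w : ℕ} {x y : Bits} (hx : x.length = w) (hy : y.length = w) :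
    Spec (subBits x y)
      (fun z => z.1.length = w ∧ z.2 = decide (toNat y ≤ toNat x) ∧
        (toNat y ≤ toNat x → toNat z.1 = toNat x - toNat y) ∧
        (toNat x < toNat y → toNat z.1 + toNat y = toNat x + 2 ^ w)) (6 * w) := by
  refine Spec.le (c := y.length + 5 * w) (Spec.bind (mapB_notB_spec y) fun y' hy' =>
    (ripple_spec true hx (hy'.1.trans hy)).imp fun z hz => ?_) (by omega)
  have h1 := hz.2
  have h2 := hy'.2
  have hl := toNat_lt z.1
  have hly := toNat_lt y
  have hlx := toNat_lt x
  rcases z with ⟨z, b⟩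
  simp only [hx, hy, hz.1, Bool.toNat_true] at h1 h2 hl hly hlx ⊢
  refine ⟨trivial, ?_⟩
  cases b
  · simp only [Bool.toNat_false, mul_zero, add_zero] at h1
    refine ⟨?_, by omega, by omega⟩
    symm; rw [decide_eq_false_iff_not]; omega
  · simp only [Bool.toNat_true, mul_one] at h1
    refine ⟨?_, by omega, by omega⟩
    symm; rw [decide_eq_true_iff]; omega

/-! ## Polynomials given by lists -/

/-- The polynomial whose coefficients are the values of the entries of a list. -/
noncomputable def pv {α A : Type*} [Semiring A] (φ : α → A) : List α → A[X]
  | [] => 0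
  | c :: cs => C (φ c) + X * pv φ cs

section pv

variable {α A : Type*} [Semiring A] (φ : α → A)

@[simp] theorem pv_nil : pv φ [] = 0 := rfl

@[simp] theorem pv_cons (c : α) (l : List α) : pv φ (c :: l) = C (φ c) + X * pv φ l := rfl

theorem pv_append (l r : List α) : pv φ (l ++ r) = pv φ l + X ^ l.length * pv φ r := by
  induction l with
  | nil => simp
  | cons c l ih => simp [ih, pow_succ', mul_add, mul_assoc, add_assoc]

theorem pv_coeff (l : List α) (i : ℕ) :
    (pv φ l).coeff i = (l[i]?).elim 0 φ := by
  induction l generalizing i with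
  | nil => simp
  | cons c l ih => cases i <;> simp [ih, coeff_C]

theorem map_pv {B : Type*} [Semiring B] (σ : A →+* B) (l : List α) :
    (pv φ l).map σ = pv (fun a => σ (φ a)) l := by
  induction l with
  | nil => simp
  | cons c l ih => simp [ih]

end pv

theorem toPoly_eq_pv (l : Poly) : toPoly l = pv (fun c => (toNat c : ℤ)) l := by
  induction l with
  | nil => rfl
  | cons c l ih => simp [toPoly, ih]

/-- The pieces are digits in base `2 ^ b`. The reduction modulo `2 ^ (count * b)` accounts for words
longer than the pieces reach. -/
theorem chop_spec {b w : ℕ} (hb : b ≤ w) (count : ℕ) (x : Bits) :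
    Spec (chop b w count x)
      (fun r => r.length = count ∧ (∀ c ∈ r, c.length = w ∧ toNat c < 2 ^ b) ∧
        (pv toNat r).eval (2 ^ b) = toNat x % 2 ^ (count * b)) (count * w) := by
  induction count generalizing x with
  | zero => exact Spec.le (Spec.pure (a := []) (by simp [Nat.mod_one])) (by simp)
  | succ count ih =>
    have h : toNat (x.take b) < 2 ^ b := (toNat_take b x).trans_lt (Nat.mod_lt _ (by positivity))
    refine Spec.le (Spec.bind (resize_spec_of_lt (h.trans_le (Nat.pow_le_pow_right (by simp) hb)))
      fun c hc => Spec.bind (ih (x.drop b)) fun r hr => Spec.pure ?_) (by rw [Nat.succ_mul]; omega)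
    simp only [List.length_cons, hr.1, List.mem_cons, forall_eq_or_imp, true_and]
    refine ⟨⟨⟨hc.1, by omega⟩, hr.2.1⟩, ?_⟩
    simp only [pv_cons, eval_add, eval_C, eval_mul, eval_X, hr.2.2, hc.2, toNat_take, toNat_drop]
    rw [Nat.succ_mul, add_comm (count * b), pow_add, Nat.mod_mul]

/-! ## Linear operations on lists -/

/-- A list of length `n` whose entries satisfy `ok`. -/
def OkV {α : Type} (ok : α → Prop) (n : ℕ) (a : List α) : Prop := a.length = n ∧ ∀ x ∈ a, ok x

theorem OkV.nil {α : Type} {ok : α → Prop} : OkV ok 0 [] := ⟨rfl, by simp⟩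

theorem OkV.cons {α : Type} {ok : α → Prop} {n : ℕ} {x : α} {a : List α} (hx : ok x)
    (ha : OkV ok n a) : OkV ok (n + 1) (x :: a) :=
  ⟨by simp [ha.1], by simpa [hx] using ha.2⟩

theorem okV_succ {α : Type} {ok : α → Prop} {n : ℕ} {a : List α} (h : OkV ok (n + 1) a) :
    ∃ x b, a = x :: b ∧ ok x ∧ OkV ok n b := by
  obtain ⟨x, b, rfl⟩ := List.exists_cons_of_length_eq_add_one h.1
  exact ⟨x, b, rfl, h.2 x (by simp), by simpa using h.1, fun y hy => h.2 y (by simp [hy])⟩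

theorem OkV.eq_nil {α : Type} {ok : α → Prop} {a : List α} (h : OkV ok 0 a) : a = [] :=
  List.length_eq_zero_iff.1 h.1

theorem OkV.append {α : Type} {ok : α → Prop} {m n : ℕ} {a b : List α} (ha : OkV ok m a)
    (hb : OkV ok n b) : OkV ok (m + n) (a ++ b) :=
  ⟨by simp [ha.1, hb.1], fun x hx => (List.mem_append.1 hx).elim (ha.2 x) (hb.2 x)⟩

theorem OkV.take {α : Type} {ok : α → Prop} {m n : ℕ} {a : List α} (ha : OkV ok n a)
    (h : m ≤ n) : OkV ok m (a.take m) :=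
  ⟨by simp [ha.1, h], fun x hx => ha.2 x (List.mem_of_mem_take hx)⟩

theorem OkV.drop {α : Type} {ok : α → Prop} {n : ℕ} {a : List α} (ha : OkV ok n a)
    (m : ℕ) : OkV ok (n - m) (a.drop m) :=
  ⟨by simp [ha.1], fun x hx => ha.2 x (List.mem_of_mem_drop hx)⟩

/-- A single induction covers vectors of words and, with `nega φ n` as `φ`, vectors of polynomials.
-/
theorem zipB_linear {α : Type} {A : Type*} [CommSemiring A] {ok : α → Prop} {φ : α → A}
    {f : α → α → BitM α} {u v : A} {c : ℕ}
    (hf : ∀ x y, ok x → ok y → Spec (f x y) (fun z => ok z ∧ φ z = u * φ x + v * φ y) c) :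
    ∀ {n : ℕ} {a b : List α}, OkV ok n a → OkV ok n b →
      Spec (zipB f a b) (fun r => OkV ok n r ∧ pv φ r = C u * pv φ a + C v * pv φ b) (n * c)
  | 0, a, b, ha, hb => by
    rw [ha.eq_nil, hb.eq_nil, zipB.eq_def]
    exact Spec.le (Spec.pure ⟨OkV.nil, by simp⟩) (by simp)
  | n + 1, a, b, ha, hb => by
    obtain ⟨x, a, rfl, hx, ha⟩ := okV_succ ha
    obtain ⟨y, b, rfl, hy, hb⟩ := okV_succ hb
    refine Spec.le (Spec.bind (hf x y hx hy) fun z hz => Spec.bind (zipB_linear hf ha hb)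
      fun r hr => Spec.pure ⟨hr.1.cons hz.1, ?_⟩) (by rw [Nat.succ_mul]; omega)
    simp only [pv_cons, hz.2, hr.2, C_add, C_mul]
    ring

/-- The factor `u` on the left makes room for halving, where only `2 * φ z = φ x` is known. -/
theorem mapB_linear {α : Type} {A : Type*} [CommSemiring A] {ok : α → Prop} {φ : α → A}
    {f : α → BitM α} {u v : A} {c : ℕ}
    (hf : ∀ x, ok x → Spec (f x) (fun z => ok z ∧ u * φ z = v * φ x) c) :
    ∀ {n : ℕ} {a : List α}, OkV ok n a →
      Spec (mapB f a) (fun r => OkV ok n r ∧ C u * pv φ r = C v * pv φ a) (n * c)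
  | 0, a, ha => by
    rw [ha.eq_nil]
    exact Spec.le (Spec.pure ⟨OkV.nil, by simp⟩) (by simp)
  | n + 1, a, ha => by
    obtain ⟨x, a, rfl, hx, ha⟩ := okV_succ ha
    refine Spec.le (Spec.bind (hf x hx) fun z hz => Spec.bind (mapB_linear hf ha)
      fun r hr => Spec.pure ⟨hr.1.cons hz.1, ?_⟩) (by rw [Nat.succ_mul]; omega)
    simp only [pv_cons, mul_add, ← C_mul, hz.2]
    rw [mul_left_comm, hr.2]
    ring

theorem mapB_copyBits_spec {ok : Bits → Prop} {c : ℕ} (hc : ∀ x, ok x → x.length ≤ c) :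
    ∀ {n : ℕ} {a : Poly}, OkV ok n a → Spec (mapB copyBits a) (fun r => r = a) (n * c)
  | 0, a, ha => by
    rw [ha.eq_nil]
    exact Spec.le (Spec.pure rfl) (by simp)
  | n + 1, a, ha => by
    obtain ⟨x, a, rfl, hx, ha⟩ := okV_succ ha
    refine Spec.le (Spec.bind ((copyBits_spec x).le (hc x hx)) fun z hz =>
      Spec.bind (mapB_copyBits_spec hc ha) fun r hr => Spec.pure ?_) (by rw [Nat.succ_mul]; omega)
    rw [hz, hr]

/-! ## Bit rings -/

/-- `R` computes in the ring `A`: a word with `ok` represents its image under `φ`; `c` bounds the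
cost of the linear operations, and `μ` the cost of a multiplication. -/
structure Implements (R : BitRing) {A : Type} [CommRing A] (ok : Bits → Prop) (φ : Bits → A)
    (c μ : ℕ) : Prop where
  two : IsUnit (2 : A)
  length : ∀ x, ok x → x.length = R.width
  width_le : R.width ≤ c
  zero : ∀ x, x.length = R.width → toNat x = 0 → ok x ∧ φ x = 0
  add : ∀ x y, ok x → ok y → Spec (R.add x y) (fun z => ok z ∧ φ z = φ x + φ y) c
  sub : ∀ x y, ok x → ok y → Spec (R.sub x y) (fun z => ok z ∧ φ z = φ x - φ y) c
  half : ∀ x, ok x → Spec (R.half x) (fun z => ok z ∧ 2 * φ z = φ x) c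
  mul : ∀ x y, ok x → ok y → Spec (R.mul x y) (fun z => ok z ∧ φ z = φ x * φ y) μ

namespace Implements

variable {R : BitRing} {A : Type} [CommRing A] {ok : Bits → Prop} {φ : Bits → A} {c μ : ℕ}

theorem addV_spec (H : Implements R ok φ c μ) {n : ℕ} {a b : Poly} (ha : OkV ok n a)
    (hb : OkV ok n b) :
    Spec (addV R a b) (fun r => OkV ok n r ∧ pv φ r = pv φ a + pv φ b) (n * c) := by
  refine (zipB_linear (φ := φ) (u := 1) (v := 1) (fun x y hx hy => ?_) ha hb).imp fun r hr => ?_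
  · simpa using H.add x y hx hy
  · simpa using hr

theorem subV_spec (H : Implements R ok φ c μ) {n : ℕ} {a b : Poly} (ha : OkV ok n a)
    (hb : OkV ok n b) :
    Spec (subV R a b) (fun r => OkV ok n r ∧ pv φ r = pv φ a - pv φ b) (n * c) := by
  refine (zipB_linear (φ := φ) (u := 1) (v := -1) (fun x y hx hy => ?_) ha hb).imp fun r hr => ?_
  · simpa [sub_eq_add_neg] using H.sub x y hx hy
  · simpa [sub_eq_add_neg] using hr

theorem resize_zero_spec (H : Implements R ok φ c μ) :
    Spec (resize R.width []) (fun z => ok z ∧ φ z = 0) c :=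
  (resize_spec R.width []).mono (fun z hz => H.zero z hz.1 (by simpa using hz.2)) H.width_le

theorem negV_spec (H : Implements R ok φ c μ) {n : ℕ} {a : Poly} (ha : OkV ok n a) :
    Spec (negV R a) (fun r => OkV ok n r ∧ pv φ r = -pv φ a) (n * (2 * c)) := by
  refine (mapB_linear (φ := φ) (u := 1) (v := -1) (fun x hx => ?_) ha).imp fun r hr => ?_
  · refine Spec.le (Spec.bind H.resize_zero_spec fun z hz => (H.sub z x hz.1 hx).imp
      fun y hy => ⟨hy.1, ?_⟩) (by omega)
    simp [hy.2, hz.2]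
  · simpa using hr

theorem zeroV_spec (H : Implements R ok φ c μ) (n : ℕ) :
    Spec (zeroV R n) (fun r => OkV ok n r ∧ pv φ r = 0) (n * c) := by
  have h : ∀ l : List ℕ, Spec (mapB (fun _ => resize R.width []) l)
      (fun r => OkV ok l.length r ∧ pv φ r = 0) (l.length * c) := by
    intro l
    induction l with
    | nil => exact Spec.le (Spec.pure ⟨OkV.nil, rfl⟩) (by simp)
    | cons i l ih =>
      refine Spec.le (Spec.bind H.resize_zero_spec fun z hz => Spec.bind ih fun r hr =>
        Spec.pure ⟨hr.1.cons hz.1, ?_⟩) (by simp [Nat.succ_mul]; omega)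
      simp [hz.2, hr.2]
  simpa [zeroV] using h (List.range n)

theorem copyV_spec (H : Implements R ok φ c μ) {n : ℕ} {a : Poly} (ha : OkV ok n a) :
    Spec (mapB copyBits a) (fun r => r = a) (n * c) :=
  mapB_copyBits_spec (fun x hx => (H.length x hx).le.trans H.width_le) ha

theorem halfV_spec (H : Implements R ok φ c μ) {n : ℕ} {a : Poly} (ha : OkV ok n a) :
    Spec (mapB R.half a) (fun r => OkV ok n r ∧ 2 * pv φ r = pv φ a) (n * c) := by
  refine (mapB_linear (φ := φ) (u := 2) (v := 1) (fun x hx => ?_) ha).imp fun r hr => ?_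
  · simpa using H.half x hx
  · simpa [show (C (2 : A)) = 2 from map_ofNat C 2] using hr

theorem mulV_spec (H : Implements R ok φ c μ) {n : ℕ} {x : Bits} {a : Poly} (hx : ok x)
    (ha : OkV ok n a) :
    Spec (mapB (R.mul x) a) (fun r => OkV ok n r ∧ pv φ r = C (φ x) * pv φ a) (n * μ) := by
  refine (mapB_linear (φ := φ) (u := 1) (v := φ x) (fun y hy => ?_) ha).imp fun r hr => ?_
  · simpa using H.mul x y hx hy
  · simpa using hr

end Implements

/-! ## Arithmetic modulo `x ^ n + 1` -/

/-- The element of `A[x] / (x ^ n + 1)` that is given by a list. -/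
noncomputable def nega {A : Type} [CommRing A] (φ : Bits → A) (n : ℕ) (a : Poly) :
    AdjoinRoot (X ^ n + 1 : A[X]) := AdjoinRoot.mk _ (pv φ a)

theorem root_pow_eq_neg_one (A : Type) [CommRing A] (n : ℕ) :
    AdjoinRoot.root (X ^ n + 1 : A[X]) ^ n = -1 := by
  have h := AdjoinRoot.eval₂_root (X ^ n + 1 : A[X])
  simp only [eval₂_add, eval₂_pow, eval₂_X, eval₂_one] at h
  exact eq_neg_of_add_eq_zero_left h

section nega

variable {A : Type} [CommRing A] {φ : Bits → A}

theorem nega_append (n : ℕ) (a b : Poly) :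
    nega φ n (a ++ b) = nega φ n a + AdjoinRoot.root (X ^ n + 1 : A[X]) ^ a.length * nega φ n b := by
  simp [nega, pv_append]

end nega

namespace Implements

variable {R : BitRing} {A : Type} [CommRing A] {ok : Bits → Prop} {φ : Bits → A} {c μ : ℕ}

/-- Since `x ^ n = -1`, exponents matter modulo `2 n`. For `e' < n` the coefficients that wrap
around change sign; for `e' ≥ n` there is one more global sign, so exactly the others do. -/
theorem mulXPow_spec (H : Implements R ok φ c μ) {n : ℕ} (hn : 0 < n) (e : ℕ) {a : Poly}
    (ha : OkV ok n a) :
    Spec (mulXPow R e a) (fun r => OkV ok n r ∧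
      nega φ n r = AdjoinRoot.root (X ^ n + 1 : A[X]) ^ e * nega φ n a) (n * (2 * c)) := by
  have hroot := root_pow_eq_neg_one A n
  set ω := AdjoinRoot.root (X ^ n + 1 : A[X]) with hω
  have he : ω ^ e = ω ^ (e % (2 * n)) := by
    conv_lhs => rw [← Nat.mod_add_div e (2 * n)]
    rw [pow_add, pow_mul, mul_comm 2 n, pow_mul ω n 2, hroot]
    simp
  have hlt : e % (2 * n) < 2 * n := Nat.mod_lt _ (by omega)
  unfold mulXPow
  simp only [ha.1]
  rw [he]
  generalize e % (2 * n) = e' at hlt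
  have hsplit : ∀ i ≤ n, nega φ n a = nega φ n (a.take i) + ω ^ i * nega φ n (a.drop i) := by
    intro i hi
    conv_lhs => rw [← List.take_append_drop i a]
    rw [nega_append, (ha.take hi).1]
  have hneg : ∀ {x y : Poly}, pv φ x = -pv φ y → nega φ n x = -nega φ n y := by
    intro x y h
    simp [nega, h]
  refine Spec.ite (fun h => ?_) (fun h => ?_)
  · refine Spec.le (Spec.bind (H.copyV_spec (ha.take (m := n - e') (by omega))) fun u hu =>
      Spec.bind (H.negV_spec (ha.drop (n - e'))) fun v hv => Spec.pure ?_)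
        (d := n * (2 * c)) ?_
    · subst hu
      refine ⟨?_, ?_⟩
      · have := hv.1.append (ha.take (m := n - e') (by omega))
        rwa [show n - (n - e') + (n - e') = n by omega] at this
      · rw [nega_append, hv.1.1, hneg hv.2, hsplit (n - e') (by omega), mul_add, ← mul_assoc,
          ← pow_add, show e' + (n - e') = n by omega, show n - (n - e') = e' by omega, hroot]
        ring
    · have h1 : n - (n - e') = e' := by omega
      rw [h1]
      calc (n - e') * c + (e' * (2 * c) + 0) ≤ (n - e') * (2 * c) + e' * (2 * c) := by
            rw [add_zero]; gcongr; omega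
        _ = n * (2 * c) := by rw [← Nat.add_mul]; congr 1; omega
  · refine Spec.le (Spec.bind (H.negV_spec (ha.take (m := 2 * n - e') (by omega))) fun u hu =>
      Spec.bind (H.copyV_spec (ha.drop (2 * n - e'))) fun v hv => Spec.pure ?_)
        (d := n * (2 * c)) ?_
    · subst hv
      refine ⟨?_, ?_⟩
      · have := (ha.drop (2 * n - e')).append hu.1
        rwa [show n - (2 * n - e') + (2 * n - e') = n by omega] at this
      · rw [nega_append, (ha.drop (2 * n - e')).1, hneg hu.2, hsplit (2 * n - e') (by omega),
          mul_add, ← mul_assoc, ← pow_add, show e' + (2 * n - e') = n + n by omega,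
          show e' = n - (2 * n - e') + n by omega, pow_add, pow_add, hroot,
          show n - (2 * n - (n - (2 * n - e') + n)) = n - (2 * n - e') by omega,
          show 2 * n - (n - (2 * n - e') + n) = 2 * n - e' by omega]
        ring
    · calc (2 * n - e') * (2 * c) + ((n - (2 * n - e')) * c + 0)
          ≤ (2 * n - e') * (2 * c) + (n - (2 * n - e')) * (2 * c) := by
            rw [add_zero]; gcongr; omega
        _ = n * (2 * c) := by rw [← Nat.add_mul]; congr 1; omega

theorem schoolPoly_spec (H : Implements R ok φ c μ) {n : ℕ} (hn : 0 < n) {g : Poly}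
    (hg : OkV ok n g) : ∀ {l : ℕ} {f : Poly}, OkV ok l f →
      Spec (schoolPoly R f g) (fun r => OkV ok n r ∧ nega φ n r = nega φ n f * nega φ n g)
        (l * (n * (3 * c + μ)) + n * c)
  | 0, f, hf => by
    rw [hf.eq_nil]
    simp only [schoolPoly, hg.1]
    exact (H.zeroV_spec n).mono (fun r hr => ⟨hr.1, by simp [nega, hr.2]⟩) (by simp)
  | l + 1, f, hf => by
    obtain ⟨x, f, rfl, hx, hf⟩ := okV_succ hf
    refine Spec.le (Spec.bind (schoolPoly_spec H hn hg hf) fun r hr => Spec.bind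
      (H.mulXPow_spec hn 1 hr.1) fun r' hr' => Spec.bind (H.mulV_spec hx hg) fun p hp =>
        (H.addV_spec hp.1 hr'.1).imp fun z hz => ⟨hz.1, ?_⟩) (le_of_eq (by ring))
    have h := hr'.2
    rw [hr.2] at h
    simp only [nega, hz.2, map_add, pv_cons, map_mul, hp.2, AdjoinRoot.mk_X] at h ⊢
    rw [h]
    ring

end Implements

/-! ## The fast Fourier transform -/

/-- The exponents of the points at which `fft` evaluates, in order. -/
def fftPoints (n : ℕ) : ℕ → ℕ → List ℕ
  | 0, E => [E]
  | r + 1, E => fftPoints n r (E / 2) ++ fftPoints n r (E / 2 + n)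

theorem length_fftPoints (n r E : ℕ) : (fftPoints n r E).length = 2 ^ r := by
  induction r generalizing E with
  | zero => rfl
  | succ r ih => simp [fftPoints, ih, pow_succ]; ring

/-- Each split replaces `y ^ (2 h) = ω ^ E` by its two square roots `ω ^ (E / 2)` and `-ω ^ (E / 2)
= ω ^ (E / 2 + n)`. The divisibility hypotheses make every halving of an exponent exact. -/
theorem pow_of_mem_fftPoints {T : Type} [CommRing T] {ω : T} {n : ℕ} (hω : ω ^ n = -1) {r E e : ℕ}
    (hE : 2 ^ r ∣ E) (hn : 2 ^ r ∣ 2 * n) (he : e ∈ fftPoints n r E) :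
    (ω ^ e) ^ 2 ^ r = ω ^ E := by
  induction r generalizing E with
  | zero => simp_all [fftPoints]
  | succ r ih =>
    obtain ⟨E, rfl⟩ := hE
    obtain ⟨q, hq⟩ := hn
    have hn' : n = 2 ^ r * q := by rw [pow_succ'] at hq; linarith [hq]
    have hE2 : 2 ^ (r + 1) * E / 2 = 2 ^ r * E := by
      rw [pow_succ', mul_assoc, Nat.mul_div_cancel_left _ (by norm_num)]
    have hn2 : 2 ^ r ∣ 2 * n := by rw [hn']; exact Dvd.intro (2 * q) (by ring)
    rw [fftPoints, hE2, List.mem_append] at he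
    rw [pow_succ, pow_mul]
    rcases he with he | he
    · rw [ih (Dvd.intro _ rfl) hn2 he, ← pow_mul]
      congr 1; ring
    · rw [ih (by rw [hn', ← mul_add]; exact Dvd.intro _ rfl) hn2 he, pow_add, hω, mul_neg_one,
        neg_sq, ← pow_mul]
      congr 1; ring

namespace Implements

variable {R : BitRing} {A : Type} [CommRing A] {ok : Bits → Prop} {φ : Bits → A} {c μ : ℕ}

theorem addVV_spec (H : Implements R ok φ c μ) {n l : ℕ} {a b : List Poly}
    (ha : OkV (OkV ok n) l a) (hb : OkV (OkV ok n) l b) :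
    Spec (zipB (addV R) a b) (fun r => OkV (OkV ok n) l r ∧
      pv (nega φ n) r = pv (nega φ n) a + pv (nega φ n) b) (l * (n * c)) := by
  refine (zipB_linear (φ := nega φ n) (u := 1) (v := 1) (fun x y hx hy => ?_) ha hb).imp
    fun r hr => ?_
  · exact (H.addV_spec hx hy).imp fun z hz => ⟨hz.1, by simp [nega, hz.2]⟩
  · simpa using hr

theorem subVV_spec (H : Implements R ok φ c μ) {n l : ℕ} {a b : List Poly}
    (ha : OkV (OkV ok n) l a) (hb : OkV (OkV ok n) l b) :
    Spec (zipB (subV R) a b) (fun r => OkV (OkV ok n) l r ∧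
      pv (nega φ n) r = pv (nega φ n) a - pv (nega φ n) b) (l * (n * c)) := by
  refine (zipB_linear (φ := nega φ n) (u := 1) (v := -1) (fun x y hx hy => ?_) ha hb).imp
    fun r hr => ?_
  · exact (H.subV_spec hx hy).imp fun z hz => ⟨hz.1, by simp [nega, hz.2, sub_eq_add_neg]⟩
  · simpa [sub_eq_add_neg] using hr

theorem mulXPowV_spec (H : Implements R ok φ c μ) {n l : ℕ} (hn : 0 < n) (e : ℕ) {a : List Poly}
    (ha : OkV (OkV ok n) l a) :
    Spec (mapB (mulXPow R e) a) (fun r => OkV (OkV ok n) l r ∧ pv (nega φ n) r =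
      C (AdjoinRoot.root (X ^ n + 1 : A[X]) ^ e) * pv (nega φ n) a) (l * (n * (2 * c))) := by
  refine (mapB_linear (φ := nega φ n) (u := 1) (v := AdjoinRoot.root (X ^ n + 1 : A[X]) ^ e)
    (fun x hx => ?_) ha).imp fun r hr => ?_
  · simpa using H.mulXPow_spec hn e hx
  · simpa using hr

theorem halfVV_spec (H : Implements R ok φ c μ) {n l : ℕ} {a : List Poly}
    (ha : OkV (OkV ok n) l a) :
    Spec (mapB (mapB R.half) a) (fun r => OkV (OkV ok n) l r ∧
      2 * pv (nega φ n) r = pv (nega φ n) a) (l * (n * c)) := by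
  refine (mapB_linear (φ := nega φ n) (u := 2) (v := 1) (fun x hx => ?_) ha).imp fun r hr => ?_
  · refine (H.halfV_spec hx).imp fun z hz => ⟨hz.1, ?_⟩
    rw [nega, nega, ← hz.2, map_mul, map_ofNat, one_mul]
  · simpa [show (C (2 : AdjoinRoot (X ^ n + 1 : A[X]))) = 2 from map_ofNat C 2] using hr

/-- Write the polynomial as `lo + y ^ h * hi`. At the points of the two halves `y ^ h` equals `ω ^
(E / 2)` and `-ω ^ (E / 2)`, so its values are those of `lo + ω ^ (E / 2) * hi` and `lo - ω ^ (E /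
2) * hi`, which have half the length. -/
theorem fft_spec (H : Implements R ok φ c μ) {n : ℕ} (hn : 0 < n) :
    ∀ {r E : ℕ} {a : List Poly}, 2 ^ r ∣ E → 2 ^ r ∣ 2 * n → OkV (OkV ok n) (2 ^ r) a →
      Spec (fft R n r E a) (fun z => OkV (OkV ok n) (2 ^ r) z ∧
        z.map (nega φ n) = (fftPoints n r E).map fun e =>
          (pv (nega φ n) a).eval (AdjoinRoot.root (X ^ n + 1 : A[X]) ^ e))
        (r * 2 ^ r * (2 * n * c))
  | 0, E, a, _, _, ha => by
    refine Spec.le (Spec.pure ⟨ha, ?_⟩) (by simp)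
    obtain ⟨x, b, rfl, -, hb⟩ := okV_succ (n := 0) ha
    simp [hb.eq_nil, fftPoints]
  | r + 1, E, a, hE, hrn, ha => by
    have hω := root_pow_eq_neg_one A n
    obtain ⟨E, rfl⟩ := hE
    obtain ⟨q, hq⟩ := hrn
    have hn' : n = 2 ^ r * q := by rw [pow_succ'] at hq; linarith [hq]
    have hE2 : 2 ^ (r + 1) * E / 2 = 2 ^ r * E := by
      rw [pow_succ', mul_assoc, Nat.mul_div_cancel_left _ (by norm_num)]
    have hn2 : 2 ^ r ∣ 2 * n := by rw [hn']; exact Dvd.intro (2 * q) (by ring)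
    have hd1 : 2 ^ r ∣ 2 ^ r * E := Dvd.intro _ rfl
    have hd2 : 2 ^ r ∣ 2 ^ r * E + n := by rw [hn', ← mul_add]; exact Dvd.intro _ rfl
    have h2 : 2 ^ (r + 1) = 2 ^ r + 2 ^ r := by ring
    have hlo := ha.take (m := 2 ^ r) (by omega)
    have hhi := ha.drop (2 ^ r)
    rw [show 2 ^ (r + 1) - 2 ^ r = 2 ^ r by omega] at hhi
    have hP : pv (nega φ n) a = pv (nega φ n) (a.take (2 ^ r)) +
        X ^ 2 ^ r * pv (nega φ n) (a.drop (2 ^ r)) := by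
      conv_lhs => rw [← List.take_append_drop (2 ^ r) a]
      rw [pv_append, hlo.1]
    unfold fft
    simp only [hE2]
    refine Spec.le (Spec.bind (H.mulXPowV_spec hn _ hhi) fun hi hhi' =>
      Spec.bind (H.addVV_spec hlo hhi'.1) fun s hs => Spec.bind (H.subVV_spec hlo hhi'.1)
      fun d hd => Spec.bind (fft_spec H hn hd1 hn2 hs.1) fun s' hs' =>
        Spec.bind (fft_spec H hn hd2 hn2 hd.1) fun d' hd' => Spec.pure ⟨?_, ?_⟩)
          (le_of_eq (by ring))
    · rw [h2]; exact hs'.1.append hd'.1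
    · rw [List.map_append, hs'.2, hd'.2, fftPoints, hE2, List.map_append, hs.2, hd.2, hhi'.2, hP]
      congr 1 <;> refine List.map_congr_left fun e he => ?_
      · have := pow_of_mem_fftPoints hω hd1 hn2 he
        simp [this]
      · have := pow_of_mem_fftPoints hω hd2 hn2 he
        simp [this, pow_add, hω, sub_eq_add_neg]

/-- `P` is arbitrary, so its values determine it only modulo `Y ^ (2 ^ r) - ω ^ E`. Stated as a
divisibility, the induction step is the Chinese remainder theorem for `Y - α` and `Y + α`, explicit
because 2 and `α` are units. The bound `E < 2 * n` keeps `2 * n - E / 2` a genuine exponent for the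
inverse of `ω ^ (E / 2)`. -/
theorem ifft_spec (H : Implements R ok φ c μ) {n : ℕ} (hn : 0 < n)
    (P : (AdjoinRoot (X ^ n + 1 : A[X]))[X]) :
    ∀ {r E : ℕ} {a : List Poly}, 2 ^ r ∣ E → 2 ^ r ∣ 2 * n → E < 2 * n →
      OkV (OkV ok n) (2 ^ r) a →
      a.map (nega φ n) = ((fftPoints n r E).map fun e =>
          P.eval (AdjoinRoot.root (X ^ n + 1 : A[X]) ^ e)) →
      Spec (ifft R n r E a) (fun z => OkV (OkV ok n) (2 ^ r) z ∧
        X ^ 2 ^ r - C (AdjoinRoot.root (X ^ n + 1 : A[X]) ^ E) ∣ P - pv (nega φ n) z)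
        (r * 2 ^ r * (3 * n * c))
  | 0, E, a, _, _, _, ha, hev => by
    refine Spec.le (Spec.pure ⟨ha, ?_⟩) (by simp)
    obtain ⟨x, b, rfl, -, hb⟩ := okV_succ (n := 0) ha
    rw [hb.eq_nil] at hev ⊢
    simp only [fftPoints, List.map_cons, List.map_nil, List.cons.injEq, and_true] at hev
    simpa [hev] using X_sub_C_dvd_sub_C_eval (a := AdjoinRoot.root (X ^ n + 1 : A[X]) ^ E) (p := P)
  | r + 1, E, a, hE, hrn, hEn, ha, hev => by
    have hω := root_pow_eq_neg_one A n
    obtain ⟨E, rfl⟩ := hE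
    obtain ⟨q, hq⟩ := hrn
    have hn' : n = 2 ^ r * q := by rw [pow_succ'] at hq; linarith [hq]
    have hE2 : 2 ^ (r + 1) * E / 2 = 2 ^ r * E := by
      rw [pow_succ', mul_assoc, Nat.mul_div_cancel_left _ (by norm_num)]
    have hn2 : 2 ^ r ∣ 2 * n := by rw [hn']; exact Dvd.intro (2 * q) (by ring)
    have hd1 : 2 ^ r ∣ 2 ^ r * E := Dvd.intro _ rfl
    have hd2 : 2 ^ r ∣ 2 ^ r * E + n := by rw [hn', ← mul_add]; exact Dvd.intro _ rfl
    have hlt : 2 ^ r * E < n := by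
      have : 2 ^ (r + 1) * E = 2 * (2 ^ r * E) := by ring
      omega
    have h2 : 2 ^ (r + 1) = 2 ^ r + 2 ^ r := by ring
    have hlo := ha.take (m := 2 ^ r) (by omega)
    have hhi := ha.drop (2 ^ r)
    rw [show 2 ^ (r + 1) - 2 ^ r = 2 ^ r by omega] at hhi
    rw [fftPoints, hE2, List.map_append] at hev
    have hev1 := congrArg (List.take (2 ^ r)) hev
    have hev2 := congrArg (List.drop (2 ^ r)) hev
    rw [← List.map_take, List.take_left' (by simp [length_fftPoints])] at hev1
    rw [← List.map_drop, List.drop_left' (by simp [length_fftPoints])] at hev2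
    unfold ifft
    simp only [hE2]
    refine Spec.le (Spec.bind (ifft_spec H hn P hd1 hn2 (by omega) hlo hev1) fun s hs =>
      Spec.bind (ifft_spec H hn P hd2 hn2 (by omega) hhi hev2) fun d hd =>
      Spec.bind (H.addVV_spec hs.1 hd.1) fun u hu => Spec.bind (H.subVV_spec hs.1 hd.1) fun v hv =>
      Spec.bind (H.halfVV_spec hu.1) fun lo hlo => Spec.bind (H.halfVV_spec hv.1) fun hi hhi =>
      Spec.bind (H.mulXPowV_spec hn _ hhi.1) fun hi' hhi' => Spec.pure ⟨?_, ?_⟩)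
          (le_of_eq (by ring))
    · rw [h2]; exact hlo.1.append hhi'.1
    · rw [pv_append, hlo.1.1, hhi'.2]
      have hu2 := hu.2
      have hv2 := hv.2
      rw [← hlo.2] at hu2
      rw [← hhi.2] at hv2
      obtain ⟨p, hp⟩ := hs.2
      obtain ⟨p', hp'⟩ := hd.2
      have hαβ : C (AdjoinRoot.root (X ^ n + 1 : A[X]) ^ (2 ^ r * E)) *
          C (AdjoinRoot.root (X ^ n + 1 : A[X]) ^ (2 * n - 2 ^ r * E)) = 1 := by
        rw [← C_mul, ← pow_add, show 2 ^ r * E + (2 * n - 2 ^ r * E) = n * 2 by omega, pow_mul, hω]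
        simp
      have hE' : C (AdjoinRoot.root (X ^ n + 1 : A[X]) ^ (2 ^ (r + 1) * E)) =
          C (AdjoinRoot.root (X ^ n + 1 : A[X]) ^ (2 ^ r * E)) ^ 2 := by
        rw [← C_pow, ← pow_mul]; congr 2; ring
      rw [pow_add, hω, mul_neg_one, C_neg, sub_neg_eq_add] at hp'
      rw [hE', show (X : (AdjoinRoot (X ^ n + 1 : A[X]))[X]) ^ 2 ^ (r + 1) = (X ^ 2 ^ r) ^ 2 by
        rw [← pow_mul]; congr 1]
      -- The quotient ring need not be a domain, so the factor 2 is removed by means of an explicit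
      -- inverse.
      obtain ⟨t, ht⟩ := H.two.exists_right_inv
      have ht' : (2 : (AdjoinRoot (X ^ n + 1 : A[X]))[X]) *
          C (AdjoinRoot.of (X ^ n + 1 : A[X]) t) = 1 := by
        have := congrArg (fun z => C (AdjoinRoot.of (X ^ n + 1 : A[X]) z)) ht
        simpa [map_mul, map_ofNat] using this
      generalize C (AdjoinRoot.root (X ^ n + 1 : A[X]) ^ (2 ^ r * E)) = α at *
      generalize C (AdjoinRoot.root (X ^ n + 1 : A[X]) ^ (2 * n - 2 ^ r * E)) = β at *
      generalize C (AdjoinRoot.of (X ^ n + 1 : A[X]) t) = τ at *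
      generalize (X : (AdjoinRoot (X ^ n + 1 : A[X]))[X]) ^ 2 ^ r = Y at *
      generalize pv (nega φ n) lo = l at *
      generalize pv (nega φ n) hi = m at *
      generalize pv (nega φ n) s = s' at *
      generalize pv (nega φ n) d = d' at *
      refine ⟨τ * β * (p - p'), ?_⟩
      -- Substitute `s' = P - (Y - α) p` and `d' = P - (Y + α) p'` into `2 l = s' + d'` and `2 m =
      -- s' - d'`, and use `α β = 1`.
      have key : 2 * (P - (l + Y * (β * m))) = (Y ^ 2 - α ^ 2) * (β * (p - p')) := by
        have e1 : s' = P - (Y - α) * p := by rw [← hp]; ring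
        have e2 : d' = P - (Y + α) * p' := by rw [← hp']; ring
        rw [e1, e2] at hu2 hv2
        linear_combination -hu2 - Y * β * hv2 + (-(Y - α) * p - (Y + α) * p') * hαβ
      calc P - (l + Y * (β * m)) = τ * (2 * (P - (l + Y * (β * m)))) := by
            linear_combination -(P - (l + Y * (β * m))) * ht'
        _ = _ := by rw [key]; ring

end Implements

/-! ## Lifting a product from `A[x] / (x ^ n + 1)` -/

theorem coeff_mul_eq_zero {A : Type*} [Semiring A] {m : ℕ} {p q : A[X]}
    (hp : ∀ i, m ≤ i → p.coeff i = 0) (hq : ∀ i, m ≤ i → q.coeff i = 0) {i : ℕ}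
    (hi : 2 * m ≤ i + 1) : (p * q).coeff i = 0 := by
  rw [coeff_mul]
  refine Finset.sum_eq_zero fun x hx => ?_
  rw [Finset.HasAntidiagonal.mem_antidiagonal] at hx
  rcases le_or_gt m x.1 with h | h
  · rw [hp _ h, zero_mul]
  · rw [hq _ (by omega), mul_zero]

/-- `X ^ n + 1` is monic, so over any commutative ring it divides no nonzero polynomial of smaller
degree. -/
theorem eq_zero_of_X_pow_add_one_dvd {A : Type*} [CommRing A] {n : ℕ} (hn : 0 < n) {p : A[X]}
    (hp : ∀ i, n ≤ i → p.coeff i = 0) (h : X ^ n + 1 ∣ p) : p = 0 := by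
  nontriviality A
  by_contra h0
  have hm : (X ^ n + 1 : A[X]).Monic := by simpa using monic_X_pow_add_C (1 : A) hn.ne'
  refine hm.not_dvd_of_degree_lt h0 ?_ h
  have : (X ^ n + 1 : A[X]).degree = n := by simpa using degree_X_pow_add_C hn (1 : A)
  rw [this, degree_lt_iff_coeff_zero]
  exact fun i hi => hp i (by exact_mod_cast hi)

/-- A product modulo `y ^ t + 1` of polynomials in `y` over `A[x]`, whose coefficients have low
degree, is determined by its image over `A[x] / (x ^ (2 m) + 1)`. -/
theorem X_pow_add_one_dvd_of_map {A : Type} [CommRing A] {m t : ℕ} (hm : 0 < m) (ht : 0 < t)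
    {F G H : A[X][X]} (hF : ∀ i j, m ≤ j → (F.coeff i).coeff j = 0)
    (hG : ∀ i j, m ≤ j → (G.coeff i).coeff j = 0)
    (hH : ∀ i j, 2 * m ≤ j → (H.coeff i).coeff j = 0)
    (hF' : ∀ i, t ≤ i → F.coeff i = 0) (hG' : ∀ i, t ≤ i → G.coeff i = 0)
    (hH' : ∀ i, t ≤ i → H.coeff i = 0)
    (h : X ^ t + 1 ∣ (F * G - H).map (AdjoinRoot.mk (X ^ (2 * m) + 1 : A[X]))) :
    X ^ t + 1 ∣ F * G - H := by
  have hQ : ∀ i j, 2 * m ≤ j → ((F * G).coeff i).coeff j = 0 := by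
    intro i j hj
    rw [coeff_mul, finsetSum_coeff]
    exact Finset.sum_eq_zero fun x _ => coeff_mul_eq_zero (hF _) (hG _) (by omega)
  have hQ' : ∀ i, 2 * t ≤ i → (F * G).coeff i = 0 := fun i hi => coeff_mul_eq_zero hF' hG' (by omega)
  generalize F * G = Q at *
  -- With `y ^ t = -1` the product `lo + y ^ t * hi` becomes `lo - hi`. It remains to prove `lo - hi
  -- = H`.
  set hi : A[X][X] := ∑ i ∈ Finset.range t, C (Q.coeff (t + i)) * X ^ i with hhi
  set lo : A[X][X] := ∑ i ∈ Finset.range t, C (Q.coeff i) * X ^ i with hlo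
  have hhic : ∀ i, hi.coeff i = if i < t then Q.coeff (t + i) else 0 := by
    intro i; simp [hhi, coeff_C_mul, coeff_X_pow]
  have hloc : ∀ i, lo.coeff i = if i < t then Q.coeff i else 0 := by
    intro i; simp [hlo, coeff_C_mul, coeff_X_pow]
  have hsplit : Q = lo + X ^ t * hi := by
    ext1 i
    rw [coeff_add, hloc, coeff_X_pow_mul', hhic]
    rcases lt_or_ge i t with h1 | h1
    · simp [h1, not_le.2 h1]
    · rcases lt_or_ge i (2 * t) with h2 | h2
      · simp [not_lt.2 h1, h1, show i - t < t by omega]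
      · simp [not_lt.2 h1, hQ' i h2, show ¬ i - t < t by omega]
  have hD : Q - H = (lo - hi - H) + (X ^ t + 1) * hi := by rw [hsplit]; ring
  rw [hD, Polynomial.map_add, Polynomial.map_mul, Polynomial.map_add, Polynomial.map_pow, map_X,
    Polynomial.map_one] at h
  -- First comparison of degrees, in `y` over the quotient ring: the image of `lo - hi - H` has
  -- degree below `t`.
  have h0 := eq_zero_of_X_pow_add_one_dvd ht (fun i hi' => ?_)
    ((dvd_add_left (Dvd.intro _ rfl)).1 h)
  swap
  · rw [coeff_map, coeff_sub, coeff_sub, hloc, hhic, hH' i hi', if_neg (by omega),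
      if_neg (by omega)]
    simp
  -- Second comparison, in `x`: every coefficient has degree below `2 m` and vanishes modulo `x ^ (2
  -- m) + 1`.
  have h1 : lo - hi - H = 0 := by
    ext1 i
    have h2 := congrArg (fun p => coeff p i) h0
    simp only [coeff_map, coeff_zero, AdjoinRoot.mk_eq_zero] at h2
    refine eq_zero_of_X_pow_add_one_dvd (by omega) (fun j hj => ?_) h2
    rw [coeff_sub, coeff_sub, coeff_sub, coeff_sub, hH i j hj, hloc, hhic]
    split <;> simp [hQ _ j hj]
  rw [hD, h1, zero_add]
  exact Dvd.intro _ rfl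

/-! ### The Schönhage–Strassen recursion and its cost -/

namespace Implements

variable {R : BitRing} {A : Type} [CommRing A] {ok : Bits → Prop} {φ : Bits → A} {c μ : ℕ}

theorem blocks_spec (H : Implements R ok φ c μ) {m : ℕ} :
    ∀ {count : ℕ} {f : Poly}, OkV ok (count * m) f →
      Spec (blocks R m count f) (fun F => OkV (OkV ok (2 * m)) count F ∧
        (∀ p ∈ F, ∀ j, m ≤ j → (pv φ p).coeff j = 0) ∧
        (pv (pv φ) F).eval (X ^ m) = pv φ f) (count * (2 * m * c))
  | 0, f, hf => by
    have := OkV.eq_nil (by simpa using hf)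
    subst this
    exact Spec.le (Spec.pure ⟨OkV.nil, by simp, by simp⟩) (by simp)
  | count + 1, f, hf => by
    rw [Nat.succ_mul] at hf
    have h1 := hf.take (m := m) (by omega)
    have h2 := hf.drop m
    rw [show count * m + m - m = count * m by omega] at h2
    refine Spec.le (Spec.bind (H.copyV_spec h1) fun a ha => Spec.bind (H.zeroV_spec m) fun z hz =>
      Spec.bind (blocks_spec H h2) fun r hr => Spec.pure ?_) (le_of_eq (by ring))
    subst ha
    have hpv : pv φ (f.take m ++ z) = pv φ (f.take m) := by rw [pv_append, hz.2]; simp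
    refine ⟨hr.1.cons (by rw [two_mul]; exact h1.append hz.1), ?_, ?_⟩
    · simp only [List.mem_cons, forall_eq_or_imp]
      refine ⟨fun j hj => ?_, hr.2.1⟩
      rw [hpv, pv_coeff, List.getElem?_eq_none (by rw [h1.1]; exact hj)]
      rfl
    · rw [pv_cons, eval_add, eval_C, eval_mul, eval_X, hr.2.2, hpv]
      conv_rhs => rw [← List.take_append_drop m f]
      rw [pv_append, h1.1]

/-- The upper half of the last of a list of polynomials. -/
def lastHigh (m : ℕ) : Poly → List Poly → Poly
  | prev, [] => prev
  | _, p :: ps => lastHigh m (p.drop m) ps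

theorem lastHigh_eq {m : ℕ} {prev : Poly} {ps : List Poly} (h : ps ≠ []) :
    lastHigh m prev ps = (ps.getLastD []).drop m := by
  induction ps generalizing prev with
  | nil => exact absurd rfl h
  | cons p ps ih =>
    cases ps with
    | nil => rfl
    | cons q qs => rw [lastHigh, ih (by simp)]; simp

/-- The recombination leaves over only the upper half of the last coefficient, which sits at `x ^
(count * m)`. In `ssPoly` the initial carry is its negative, because `x ^ (2 ^ k) = -1` there. -/
theorem unblock_spec (H : Implements R ok φ c μ) {m : ℕ} :
    ∀ {count : ℕ} {prev : Poly} {F : List Poly}, OkV ok m prev → OkV (OkV ok (2 * m)) count F →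
      Spec (unblock R m prev F) (fun r => OkV ok (count * m) r ∧
        pv φ r + X ^ (count * m) * pv φ (lastHigh m prev F) =
          pv φ prev + (pv (pv φ) F).eval (X ^ m)) (count * (m * c))
  | 0, prev, F, hp, hF => by
    rw [hF.eq_nil]
    exact Spec.le (Spec.pure ⟨by simpa using OkV.nil, by simp [lastHigh]⟩) (by simp)
  | count + 1, prev, F, hp, hF => by
    obtain ⟨a, F, rfl, ha, hF⟩ := okV_succ hF
    have h1 := ha.take (m := m) (by omega)
    have h2 := ha.drop m
    rw [show 2 * m - m = m by omega] at h2
    refine Spec.le (Spec.bind (H.addV_spec h1 hp) fun lo hlo => Spec.bind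
      (unblock_spec H h2 hF) fun r hr => Spec.pure ⟨?_, ?_⟩) (le_of_eq (by ring))
    · rw [Nat.succ_mul, add_comm]; exact hlo.1.append hr.1
    · have h3 := hr.2
      have h4 : pv φ a = pv φ (a.take m) + X ^ m * pv φ (a.drop m) := by
        conv_lhs => rw [← List.take_append_drop m a]
        rw [pv_append, h1.1]
      rw [pv_append, hlo.1.1, hlo.2, pv_cons, eval_add, eval_C, eval_mul, eval_X, lastHigh, h4,
        Nat.succ_mul, pow_add]
      linear_combination X ^ m * h3

/-- A bound for the cost of `ssPoly`. -/
def ssCost (c μ k : ℕ) : ℕ :=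
  2 ^ k * (2 ^ Nat.size (k - 2) * (4 * μ + c * (21 * Nat.size (k - 2) + 16)))

theorem size_half {j : ℕ} (hj : 0 < j) : Nat.size j = Nat.size (j / 2) + 1 := by
  conv_lhs => rw [← Nat.bit_bodd_div2 j]
  rw [Nat.size_bit (by rw [Nat.bit_bodd_div2]; omega), Nat.div2_val]

/-- The list `e` carries the evaluation points, so that products of values are values of the product
at the same points. -/
theorem zipB_nega {f : Poly → Poly → BitM Poly} {n d : ℕ}
    (hf : ∀ x y, OkV ok n x → OkV ok n y →
      Spec (f x y) (fun z => OkV ok n z ∧ nega φ n z = nega φ n x * nega φ n y) d)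
    {ι : Type} {u v : ι → AdjoinRoot (X ^ n + 1 : A[X])} :
    ∀ {l : ℕ} {e : List ι} {a b : List Poly}, OkV (OkV ok n) l a → OkV (OkV ok n) l b →
      a.map (nega φ n) = e.map u → b.map (nega φ n) = e.map v →
      Spec (zipB f a b) (fun z => OkV (OkV ok n) l z ∧
        z.map (nega φ n) = e.map fun i => u i * v i) (l * d)
  | 0, e, a, b, ha, hb, hau, hbv => by
    rw [ha.eq_nil] at hau
    have : e = [] := by simpa using hau.symm
    rw [ha.eq_nil, hb.eq_nil, this, zipB.eq_def]
    exact Spec.le (Spec.pure ⟨OkV.nil, by simp⟩) (by simp)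
  | l + 1, e, a, b, ha, hb, hau, hbv => by
    obtain ⟨x, a, rfl, hx, ha⟩ := okV_succ ha
    obtain ⟨y, b, rfl, hy, hb⟩ := okV_succ hb
    cases e with
    | nil => simp at hau
    | cons i e =>
      simp only [List.map_cons, List.cons.injEq] at hau hbv
      refine Spec.le (Spec.bind (hf x y hx hy) fun z hz => Spec.bind
        (zipB_nega hf ha hb hau.2 hbv.2) fun r hr => Spec.pure ⟨hr.1.cons hz.1, ?_⟩)
          (le_of_eq (by ring))
      simp [hz.2, hr.2, hau.1, hbv.1]

/-- The quantity `k - 2` is halved exactly, as `k / 2 + 1 - 2 = (k - 2) / 2`, so `size (k - 2)`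
counts the levels. Filling up the blocks with zeros doubles the total length at each level, which
explains the factor `2 ^ size (k - 2)`, of order `k`. The transforms of one level cost `O(r * 2 ^ k
* c)`; at all levels this is of the same order after the doubling, whence the term `21 * size (k -
2)`. -/
theorem ssPoly_spec (H : Implements R ok φ c μ) :
    ∀ {depth k : ℕ} {f g : Poly}, k ≤ depth → OkV ok (2 ^ k) f → OkV ok (2 ^ k) g →
      Spec (ssPoly R depth k f g) (fun h => OkV ok (2 ^ k) h ∧
        nega φ (2 ^ k) h = nega φ (2 ^ k) f * nega φ (2 ^ k) g) (ssCost c μ k) := by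
  have hbase : ∀ {k : ℕ} {f g : Poly}, k ≤ 2 → OkV ok (2 ^ k) f → OkV ok (2 ^ k) g →
      Spec (schoolPoly R f g) (fun h => OkV ok (2 ^ k) h ∧
        nega φ (2 ^ k) h = nega φ (2 ^ k) f * nega φ (2 ^ k) g) (ssCost c μ k) := by
    intro k f g hk hf hg
    refine (H.schoolPoly_spec (by positivity) hg hf).le ?_
    have h4 : 2 ^ k ≤ 4 := Nat.pow_le_pow_right (n := 2) (by norm_num) hk
    rw [ssCost, show k - 2 = 0 by omega]
    simp only [Nat.size_zero, pow_zero, one_mul, mul_zero, zero_add]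
    calc 2 ^ k * (2 ^ k * (3 * c + μ)) + 2 ^ k * c = 2 ^ k * (2 ^ k * (3 * c + μ) + c) := by ring
      _ ≤ 2 ^ k * (4 * (3 * c + μ) + c) := by gcongr
      _ ≤ 2 ^ k * (4 * μ + c * 16) := Nat.mul_le_mul_left _ (by omega)
  intro depth
  induction depth with
  | zero =>
    intro k f g hk hf hg
    exact hbase (by omega) hf hg
  | succ depth ih =>
    intro k f g hk hf hg
    unfold ssPoly
    refine Spec.ite (fun h => hbase h hf hg) (fun h => ?_)
    set m := 2 ^ (k / 2) with hm
    set r := k - k / 2 with hr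
    have hm0 : 0 < m := by positivity
    have hn : 2 * m = 2 ^ (k / 2 + 1) := by rw [hm]; ring
    have htm : 2 ^ r * m = 2 ^ k := by rw [hm, ← pow_add]; congr 1; omega
    have hd : 2 ^ r ∣ 2 * m := by rw [hn]; exact pow_dvd_pow 2 (by omega)
    have hd' : 2 ^ r ∣ 2 * (2 * m) := hd.mul_left 2
    rw [← htm] at hf hg
    have ih' : ∀ x y, OkV ok (2 * m) x → OkV ok (2 * m) y →
        Spec (ssPoly R depth (k / 2 + 1) x y) (fun z => OkV ok (2 * m) z ∧
          nega φ (2 * m) z = nega φ (2 * m) x * nega φ (2 * m) y) (ssCost c μ (k / 2 + 1)) := by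
      intro x y hx hy
      rw [hn] at hx hy ⊢
      exact ih (by omega) hx hy
    have hcost : 2 ^ r * (2 * m * c) + (2 ^ r * (2 * m * c) + (r * 2 ^ r * (2 * (2 * m) * c) +
        (r * 2 ^ r * (2 * (2 * m) * c) + (2 ^ r * ssCost c μ (k / 2 + 1) +
        (r * 2 ^ r * (3 * (2 * m) * c) + (m * (2 * c) + 2 ^ r * (m * c))))))) ≤ ssCost c μ k := by
      have hj : k / 2 + 1 - 2 = (k - 2) / 2 := by omega
      have hS := size_half (j := k - 2) (by omega)
      have hlt : k - 2 < 2 ^ Nat.size (k - 2) := Nat.lt_size_self _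
      rw [ssCost, ssCost, hj, hS]
      rw [hS] at hlt
      set S := Nat.size ((k - 2) / 2)
      -- Per coefficient, `14 r` comes from two transforms (`4 r` each) and the inverse (`6 r`), and
      -- 7 from splitting and recombining. Here `r ≤ 2 ^ S + 1` because `k - 2 < 2 ^ (S + 1)`.
      have hr1 : 14 * r + 7 ≤ 21 * 2 ^ (S + 1) := by omega
      have hmc : m * c ≤ 2 ^ k * c := by
        rw [← htm]; gcongr; exact Nat.le_mul_of_pos_left _ (by positivity)
      have h2k : 2 ^ r * 2 ^ (k / 2 + 1) = 2 * 2 ^ k := by rw [← hn, ← htm]; ring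
      calc _ = 2 ^ r * m * c * (14 * r + 5) + 2 * (m * c) + 2 ^ r * 2 ^ (k / 2 + 1) *
              (2 ^ S * (4 * μ + c * (21 * S + 16))) := by ring
        _ ≤ 2 ^ k * c * (14 * r + 5) + 2 * (2 ^ k * c) + 2 * 2 ^ k *
              (2 ^ S * (4 * μ + c * (21 * S + 16))) := by rw [h2k, htm]; gcongr
        _ = 2 ^ k * c * (14 * r + 7) + 2 * 2 ^ k *
              (2 ^ S * (4 * μ + c * (21 * S + 16))) := by ring
        _ ≤ 2 ^ k * c * (21 * 2 ^ (S + 1)) + 2 * 2 ^ k *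
              (2 ^ S * (4 * μ + c * (21 * S + 16))) := by gcongr
        _ = _ := by ring
    refine Spec.le (Spec.bind (H.blocks_spec hf) fun F hF => Spec.bind (H.blocks_spec hg) fun G hG =>
      Spec.bind (H.fft_spec (by omega) hd hd' hF.1) fun F' hF' =>
      Spec.bind (H.fft_spec (by omega) hd hd' hG.1) fun G' hG' =>
      Spec.bind (zipB_nega ih' hF'.1 hG'.1 hF'.2 hG'.2) fun H' hH' =>
      Spec.bind (H.ifft_spec (by omega) (pv (nega φ (2 * m)) F * pv (nega φ (2 * m)) G)
        hd hd' (by omega) hH'.1 (by simpa using hH'.2)) fun Z hZ =>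
      Spec.bind (P := fun l => OkV ok m l ∧ pv φ l = -pv φ ((Z.getLastD []).drop m))
        (c := m * (2 * c)) ?_ fun last hlast => (H.unblock_spec hlast.1 hZ.1).imp
        fun z hz => ?_) hcost
    · have hlen := hZ.1.1
      have hne : Z ≠ [] := by
        rintro rfl
        have := Nat.two_pow_pos r
        rw [List.length_nil] at hlen; omega
      have hmem : Z.getLastD [] ∈ Z := by
        rw [List.getLastD_eq_getLast?, List.getLast?_eq_some_getLast hne]
        exact List.getLast_mem hne
      have := (hZ.1.2 _ hmem).drop m
      rw [show 2 * m - m = m by omega] at this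
      exact H.negV_spec this
    · have hlen := hZ.1.1
      have hne : Z ≠ [] := by
        rintro rfl
        have := Nat.two_pow_pos r
        rw [List.length_nil] at hlen; omega
      have hz1 := hz.1
      have hz2 := hz.2
      rw [lastHigh_eq hne, hlast.2] at hz2
      rw [htm] at hz1 hz2
      refine ⟨hz1, ?_⟩
      have hlow : ∀ {Q : List Poly} {n : ℕ}, (∀ p ∈ Q, ∀ j, n ≤ j → (pv φ p).coeff j = 0) →
          ∀ i j, n ≤ j → ((pv (pv φ) Q).coeff i).coeff j = 0 := by
        intro Q n hQ i j hj
        rw [pv_coeff]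
        cases hi : Q[i]? with
        | none => simp
        | some p => exact hQ p (List.mem_of_getElem? hi) j hj
      have hlen' : ∀ {Q : List Poly}, Q.length = 2 ^ r → ∀ i, 2 ^ r ≤ i →
          (pv (pv φ) Q).coeff i = 0 := by
        intro Q hQ i hi
        rw [pv_coeff, List.getElem?_eq_none (by omega)]; rfl
      have hmap : ∀ Q : List Poly, (pv (pv φ) Q).map (AdjoinRoot.mk (X ^ (2 * m) + 1 : A[X])) =
          pv (nega φ (2 * m)) Q := fun Q => map_pv _ _ Q
      -- The inverse transform gives the product modulo `y ^ t + 1` over the quotient ring. The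
      -- degrees in `x` are below `m` for the factors and below `2 m` for the result, so the
      -- congruence lifts to `A[x]`.
      have hdvd : (X ^ 2 ^ r + 1 : A[X][X]) ∣ pv (pv φ) F * pv (pv φ) G - pv (pv φ) Z := by
        refine X_pow_add_one_dvd_of_map hm0 (by positivity) (hlow hF.2.1) (hlow hG.2.1)
          (hlow fun p hp j hj => ?_) (hlen' hF.1.1) (hlen' hG.1.1) (hlen' hlen) ?_
        · rw [pv_coeff, List.getElem?_eq_none (by rw [(hZ.1.2 p hp).1]; exact hj)]; rfl
        · rw [Polynomial.map_sub, Polynomial.map_mul, hmap, hmap, hmap]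
          have := hZ.2
          rwa [root_pow_eq_neg_one, C_neg, C_1, sub_neg_eq_add] at this
      obtain ⟨q, hq⟩ := hdvd
      have hq' := congrArg (eval (X ^ m : A[X])) hq
      simp only [eval_sub, eval_mul, eval_add, eval_pow, eval_X, eval_one, hF.2.2, hG.2.2] at hq'
      rw [← pow_mul, mul_comm m, htm] at hq'
      rw [nega, nega, nega, ← map_mul, AdjoinRoot.mk_eq_mk]
      -- At `y = x ^ m` the modulus `y ^ t + 1` becomes `x ^ (2 ^ k) + 1`; the second summand
      -- accounts for the wrapped upper half of the last coefficient.
      refine ⟨-(eval (X ^ m) q) - pv φ ((Z.getLastD []).drop m), ?_⟩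
      linear_combination hz2 - hq'

/-- The product of polynomials of length `n`. -/
theorem polyMul_spec (H : Implements R ok φ c μ) {n : ℕ} (hn : 0 < n) {f g : Poly}
    (hf : OkV ok n f) (hg : OkV ok n g) :
    Spec (polyMul R n f g) (fun h => OkV ok (2 * n - 1) h ∧ pv φ h = pv φ f * pv φ g)
      (8 * n * Nat.clog 2 (2 * n) * (4 * μ + c * (21 * Nat.size (Nat.clog 2 (2 * n)) + 18))) := by
  set k := Nat.clog 2 (2 * n) with hk
  have hle : 2 * n ≤ 2 ^ k := Nat.le_pow_clog (by norm_num) _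
  have hk1 : 1 ≤ k := Nat.clog_pos (by norm_num) (by omega)
  have hlt : 2 ^ k < 4 * n := by
    have := Nat.pow_pred_clog_lt_self (b := 2) (by norm_num) (x := 2 * n) (by omega)
    rw [← hk, Nat.pred_eq_sub_one] at this
    have h2 : 2 ^ k = 2 * 2 ^ (k - 1) := by rw [← pow_succ']; congr 1; omega
    omega
  have hpad : ∀ {a z : Poly}, OkV ok n a → OkV ok (2 ^ k - n) z ∧ pv φ z = 0 →
      OkV ok (2 ^ k) (a ++ z) ∧ pv φ (a ++ z) = pv φ a := by
    intro a z ha hz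
    refine ⟨?_, by rw [pv_append, hz.2]; simp⟩
    have := ha.append hz.1
    rwa [show n + (2 ^ k - n) = 2 ^ k by omega] at this
  unfold polyMul
  simp only [← hk]
  refine Spec.le (Spec.bind (H.zeroV_spec (2 ^ k - n)) fun zf hzf =>
    Spec.bind (H.zeroV_spec (2 ^ k - n)) fun zg hzg =>
    Spec.bind (H.ssPoly_spec le_rfl (hpad hf hzf).1 (hpad hg hzg).1) fun h hh =>
    (H.copyV_spec (hh.1.take (m := 2 * n - 1) (by omega))).imp fun z hz => ?_) ?_
  · subst hz
    refine ⟨hh.1.take (by omega), ?_⟩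
    have h1 := hh.2
    rw [nega, nega, nega, (hpad hf hzf).2, (hpad hg hzg).2, ← map_mul, AdjoinRoot.mk_eq_mk] at h1
    have hprod : ∀ i, 2 * n - 1 ≤ i → (pv φ f * pv φ g).coeff i = 0 := by
      intro i hi
      rw [coeff_mul]
      refine Finset.sum_eq_zero fun x hx => ?_
      rw [Finset.HasAntidiagonal.mem_antidiagonal] at hx
      rcases le_total n x.1 with h | h
      · rw [pv_coeff, List.getElem?_eq_none (by rw [hf.1]; exact h)]; simp
      · rcases Nat.lt_or_ge x.1 n with h' | h'
        · rw [pv_coeff φ g, List.getElem?_eq_none (by rw [hg.1]; omega)]; simp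
        · rw [pv_coeff, List.getElem?_eq_none (by rw [hf.1]; exact h')]; simp
    -- As `2 * n ≤ 2 ^ k`, product and output both have degree below `2 ^ k`, so the congruence is
    -- an equality.
    have h2 := eq_zero_of_X_pow_add_one_dvd (by positivity) (fun i hi => ?_) h1
    · rw [sub_eq_zero] at h2
      ext i
      rw [← h2]
      rcases Nat.lt_or_ge i (2 * n - 1) with hi | hi
      · rw [pv_coeff, pv_coeff, List.getElem?_take_of_lt hi]
      · rw [h2, hprod i hi, pv_coeff, List.getElem?_eq_none (by simp; omega)]; rfl
    · rw [coeff_sub, hprod i (by omega), pv_coeff, List.getElem?_eq_none (by rw [hh.1.1]; exact hi)]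
      simp
  · have hS : 2 ^ Nat.size (k - 2) ≤ 2 * k := by
      rcases Nat.lt_or_ge 2 k with h | h
      · have h3 : Nat.size (k - 2) - 1 < Nat.size (k - 2) := by
          have := Nat.size_pos.2 (show 0 < k - 2 by omega); omega
        rw [Nat.lt_size] at h3
        have h4 : 2 ^ Nat.size (k - 2) = 2 * 2 ^ (Nat.size (k - 2) - 1) := by
          rw [← pow_succ']; congr 1; have := Nat.size_pos.2 (show 0 < k - 2 by omega); omega
        omega
      · rw [show k - 2 = 0 by omega]; simp; omega
    have hS1 : 1 ≤ 2 ^ Nat.size (k - 2) := Nat.one_le_two_pow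
    have hS2 : Nat.size (k - 2) ≤ Nat.size k := Nat.size_le_size (by omega)
    rw [ssCost]
    generalize Nat.size (k - 2) = S at *
    have e1 : (2 ^ k - n) * c + ((2 ^ k - n) * c + (2 * n - 1) * c) ≤
        2 ^ k * (2 ^ S * (c * 2)) := by
      calc _ = ((2 ^ k - n) + (2 ^ k - n) + (2 * n - 1)) * c := by ring
        _ ≤ (2 * 2 ^ k) * c := Nat.mul_le_mul_right _ (by omega)
        _ = 2 ^ k * (1 * (c * 2)) := by ring
        _ ≤ _ := by gcongr
    calc _ = ((2 ^ k - n) * c + ((2 ^ k - n) * c + (2 * n - 1) * c)) +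
          2 ^ k * (2 ^ S * (4 * μ + c * (21 * S + 16))) := by ring
      _ ≤ 2 ^ k * (2 ^ S * (c * 2)) + 2 ^ k * (2 ^ S * (4 * μ + c * (21 * S + 16))) := by gcongr
      _ = 2 ^ k * (2 ^ S * (4 * μ + c * (21 * S + 18))) := by ring
      _ ≤ (4 * n) * ((2 * k) * (4 * μ + c * (21 * Nat.size k + 18))) := by gcongr
      _ = _ := by ring

end Implements

/-! ## Arithmetic modulo an odd number -/

/-- The word `x` of length `w` represents a residue modulo `q`. -/
def IsRes (w q : ℕ) (x : Bits) : Prop := x.length = w ∧ toNat x < q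

/-- Only the sum is bounded, not each summand: `mulMersenne` adds a lower half that may equal the
modulus. -/
theorem addMod_spec {w : ℕ} {q x y : Bits} (hq : q.length = w) (hx : x.length = w)
    (hy : y.length = w) (h : toNat x + toNat y < 2 * toNat q) :
    Spec (addMod w q x y) (fun z => IsRes w (toNat q) z ∧
      toNat z = (toNat x + toNat y) % toNat q) (12 * w + 7) := by
  have hqw := toNat_lt q
  rw [hq] at hqw
  have hq' : toNat (q ++ [false]) = toNat q := by simp [toNat_append]
  refine Spec.le (Spec.bind (addBits_spec hx hy) fun s hs => Spec.bind
    (subBits_spec hs.1 (y := q ++ [false]) (by simp [hq])) fun d hd => Spec.bind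
    (Spec.testB d.2) fun ge hge => Spec.ite (c := w) (fun hc => ?_) (fun hc => ?_)) (by omega)
  · rw [hge, hd.2.1, decide_eq_true_iff, hq', hs.2] at hc
    have h1 := hd.2.2.1 (by rw [hq', hs.2]; exact hc)
    rw [hq', hs.2] at h1
    refine (resize_spec_of_lt (by omega)).imp fun z hz => ?_
    refine ⟨⟨hz.1, by omega⟩, ?_⟩
    rw [hz.2, h1, Nat.mod_eq_sub_mod hc, Nat.mod_eq_of_lt (by omega)]
  · rw [hge, hd.2.1, decide_eq_true_iff, hq', hs.2] at hc
    refine (resize_spec_of_lt (by omega)).imp fun z hz => ?_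
    refine ⟨⟨hz.1, by omega⟩, ?_⟩
    rw [hz.2, hs.2, Nat.mod_eq_of_lt (by omega)]

theorem subMod_spec {w : ℕ} {q x y : Bits} (hq : q.length = w) (hx : IsRes w (toNat q) x)
    (hy : IsRes w (toNat q) y) :
    Spec (subMod w q x y) (fun z => IsRes w (toNat q) z ∧
      (toNat z + toNat y = toNat x ∨ toNat z + toNat y = toNat x + toNat q)) (12 * w + 7) := by
  have hqw := toNat_lt q
  rw [hq] at hqw
  have hx2 := hx.2
  have hy2 := hy.2
  refine Spec.le (Spec.bind (subBits_spec hx.1 hy.1) fun d hd => Spec.bind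
    (Spec.testB d.2) fun ge hge => Spec.ite (c := 6 * w) (fun hc => ?_) (fun hc => ?_)) (by omega)
  · rw [hge, hd.2.1, decide_eq_true_iff] at hc
    have h1 := hd.2.2.1 hc
    exact (Spec.pure ⟨⟨hd.1, by omega⟩, Or.inl (by omega)⟩).le (by omega)
  · rw [hge, hd.2.1, decide_eq_true_iff] at hc
    have h1 := hd.2.2.2 (by omega)
    refine Spec.le (Spec.bind (addBits_spec hd.1 hq) fun s hs => (resize_spec w s).imp
      fun z hz => ?_) (by omega)
    have h2 : toNat s = toNat x + toNat q - toNat y + 2 ^ w := by omega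
    rw [h2, Nat.add_mod_right, Nat.mod_eq_of_lt (by omega)] at hz
    exact ⟨⟨hz.1, by omega⟩, Or.inr (by omega)⟩

theorem headD_toNat (x : Bits) : (x.headD false).toNat = toNat x % 2 := by
  cases x with
  | nil => rfl
  | cons b x => have := b.toNat_lt; simp; omega

theorem halfMod_spec {w : ℕ} {q x : Bits} (hq : q.length = w) (hodd : toNat q % 2 = 1)
    (hx : IsRes w (toNat q) x) :
    Spec (halfMod w q x) (fun z => IsRes w (toNat q) z ∧
      (2 * toNat z = toNat x ∨ 2 * toNat z = toNat x + toNat q)) (12 * w + 7) := by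
  have hqw := toNat_lt q
  rw [hq] at hqw
  have hx2 := hx.2
  have hh := headD_toNat x
  refine Spec.le (Spec.bind (Spec.testB _) fun b hb => Spec.ite (c := 6 * w) (fun hc => ?_)
    (fun hc => ?_)) (by omega)
  · rw [← hb, hc, Bool.toNat_true] at hh
    refine Spec.le (Spec.bind (addBits_spec hx.1 hq) fun s hs =>
      ((shiftDown_spec 1 s).le (d := w) (by omega)).imp fun z hz => ?_) (by omega)
    exact ⟨⟨by omega, by omega⟩, Or.inr (by omega)⟩
  · rw [Bool.not_eq_true] at hc
    rw [← hb, hc, Bool.toNat_false] at hh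
    refine Spec.le (Spec.bind ((shiftDown_spec 1 x).le (d := w) (by have := hx.1; omega))
      fun s hs => (resize_spec_of_lt (w := w) (by omega)).imp fun z hz => ?_) (by omega)
    exact ⟨⟨hz.1, by omega⟩, Or.inl (by omega)⟩

theorem isUnit_two_zmod {q : ℕ} (hodd : q % 2 = 1) : IsUnit (2 : ZMod q) := by
  have : ((2 : ℕ) : ZMod q) = 2 := by norm_num
  rw [← this, ZMod.isUnit_iff_coprime]
  exact (Nat.coprime_two_left).2 (Nat.odd_iff.2 hodd)

theorem modRing_implements {w : ℕ} {q : Bits} {mul : Bits → Bits → BitM Bits} {μ : ℕ}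
    (hq : q.length = w) (hodd : toNat q % 2 = 1)
    (hmul : ∀ x y, IsRes w (toNat q) x → IsRes w (toNat q) y →
      Spec (mul x y) (fun z => IsRes w (toNat q) z ∧
        toNat z = toNat x * toNat y % toNat q) μ) :
    Implements (modRing w q mul) (IsRes w (toNat q)) (fun x => (toNat x : ZMod (toNat q)))
      (12 * w + 7) μ where
  two := isUnit_two_zmod hodd
  length x hx := hx.1
  width_le := by simp only [modRing]; omega
  zero x hx h0 := ⟨⟨hx, by omega⟩, by simp [h0]⟩
  add x y hx hy := (addMod_spec hq hx.1 hy.1 (by have := hx.2; have := hy.2; omega)).imp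
    fun z hz => ⟨hz.1, by simp [hz.2]⟩
  sub x y hx hy := (subMod_spec hq hx hy).imp fun z hz => ⟨hz.1, by
    rw [eq_sub_iff_add_eq]
    rcases hz.2 with h | h
    · exact_mod_cast congrArg (Nat.cast (R := ZMod (toNat q))) h
    · simpa using congrArg (Nat.cast (R := ZMod (toNat q))) h⟩
  half x hx := (halfMod_spec hq hodd hx).imp fun z hz => ⟨hz.1, by
    rcases hz.2 with h | h
    · exact_mod_cast congrArg (Nat.cast (R := ZMod (toNat q))) h
    · simpa using congrArg (Nat.cast (R := ZMod (toNat q))) h⟩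
  mul x y hx hy := (hmul x y hx hy).imp fun z hz => ⟨hz.1, by simp [hz.2]⟩

/-! ## Multiplication of integers -/

theorem schoolMul_spec (w : ℕ) (x y : Bits) :
    Spec (schoolMul w x y) (fun z => z.length = w ∧ toNat z = toNat x * toNat y % 2 ^ w)
      (x.length * (10 * w + 2) + w) := by
  induction x with
  | nil => exact (resize_spec w []).mono (fun z hz => by simpa using hz) (by simp)
  | cons a x ih =>
    refine Spec.le (Spec.bind ih fun r hr => Spec.bind (c := w + 1)
      ((shiftUp_spec 1 r).le (by omega)) fun r' hr' => Spec.bind (resize_spec w r') fun s hs =>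
      Spec.bind (Spec.testB a) fun t ht => Spec.ite (c := 8 * w) (fun hc => ?_) (fun hc => ?_))
        (by rw [List.length_cons, add_mul x.length, one_mul]; omega)
    · refine Spec.le (Spec.bind (resize_spec w y) fun y' hy' => Spec.bind
        (addBits_spec hs.1 hy'.1) fun u hu => (resize_spec w u).imp fun z hz => ⟨hz.1, ?_⟩)
          (by omega)
      rw [hz.2, hu.2, hs.2, hr'.2, hr.2, hy'.2]
      subst ht
      rw [hc, toNat_cons, Bool.toNat_true,
        show (1 + 2 * toNat x) * toNat y = 2 ^ 1 * (toNat x * toNat y) + toNat y by ring]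
      exact ((Nat.mod_modEq _ _).trans ((Nat.mod_modEq _ _).mul_left _)).add (Nat.mod_modEq _ _)
    · refine Spec.le (Spec.pure ⟨hs.1, ?_⟩) (by omega)
      rw [Bool.not_eq_true] at hc
      subst ht
      rw [hs.2, hr'.2, hr.2]
      simp [hc, Nat.mul_mod, mul_assoc]

/-- Since `2 ^ w` is 1 modulo `q = 2 ^ w - 1`, the two halves of the product may be added. The upper
half is below `q` because `x * y < q * 2 ^ w`; the lower one is at most `q`. -/
theorem mulMersenne_spec {w : ℕ} {mul : Bits → Bits → BitM Bits} {x y : Bits} {u : ℕ}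
    (hmul : Spec (mul x y) (fun z => z.length = 2 * w ∧ toNat z = toNat x * toNat y) u)
    (hx : toNat x < toNat (List.replicate w true)) (hy : toNat y < toNat (List.replicate w true)) :
    Spec (mulMersenne w mul x y) (fun z => IsRes w (toNat (List.replicate w true)) z ∧
      toNat z = toNat x * toNat y % toNat (List.replicate w true)) (u + (12 * w + 7)) := by
  have hq := toNat_replicate_true w
  set q := List.replicate w true with hq'
  refine Spec.bind hmul fun z hz => ?_
  have hlo : toNat (z.take w) < 2 ^ w := by rw [toNat_take]; exact Nat.mod_lt _ (by positivity)
  have hsplit : toNat x * toNat y = toNat (z.take w) + 2 ^ w * toNat (z.drop w) := by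
    rw [← hz.2, toNat_take, toNat_drop, Nat.mod_add_div]
  have hhi : toNat (z.drop w) < toNat q := by
    have h1 : toNat x * toNat y < toNat q * 2 ^ w := by
      calc _ ≤ toNat x * 2 ^ w := by gcongr; omega
        _ < _ := by gcongr
    by_contra hge
    have : 2 ^ w * toNat q ≤ 2 ^ w * toNat (z.drop w) := Nat.mul_le_mul_left _ (by omega)
    linarith
  refine (addMod_spec (q := q) (by simp [hq']) (by simp [hz.1]; omega) (by simp [hz.1]; omega)
    (by omega)).imp fun r hr => ⟨hr.1, ?_⟩
  rw [hr.2, hsplit, ← hq]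
  rw [show toNat (z.take w) + (toNat q + 1) * toNat (z.drop w) =
    toNat (z.take w) + toNat (z.drop w) + toNat q * toNat (z.drop w) by ring,
    Nat.add_mul_mod_self_left]

/-- A carry always fits into `w` bits: the sum is below `2 ^ (w + 1)`, and it is shifted down by `b
≥ 1`. -/
theorem carryOut_spec {b w : ℕ} (hb : 0 < b) (hbw : b ≤ w) {l : Poly} :
    ∀ {carry : Bits}, carry.length = w → (∀ c ∈ l, c.length = w) →
      Spec (carryOut b w carry l) (fun z => toNat z = toNat carry + (pv toNat l).eval (2 ^ b))
        (l.length * (7 * w)) := by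
  induction l with
  | nil => exact fun _ _ => Spec.le (Spec.pure (by simp)) (by simp)
  | cons x l ih =>
    intro carry hc hl
    have hx := hl x (by simp)
    refine Spec.le (Spec.bind (addBits_spec hx hc) fun s hs => ?_)
      (c := 5 * w + (b + (w + l.length * (7 * w))))
      (by rw [List.length_cons, add_mul l.length, one_mul]; omega)
    have hlt : toNat (s.drop b) < 2 ^ w := by
      rw [toNat_drop, Nat.div_lt_iff_lt_mul (by positivity)]
      calc toNat s < 2 ^ (w + 1) := by rw [← hs.1]; exact toNat_lt s
        _ ≤ 2 ^ w * 2 ^ b := by rw [← pow_add]; exact Nat.pow_le_pow_right (by simp) (by omega)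
    refine Spec.bind ((copyBits_spec (s.take b)).le (by simp)) fun lo hlo =>
      Spec.bind (resize_spec_of_lt hlt) fun hi hhi => Spec.le (c := l.length * (7 * w) + 0)
      (Spec.bind (ih hhi.1 fun c hc => hl c (by simp [hc])) fun r hr => Spec.pure ?_) (by omega)
    subst hlo
    have hsl : (s.take b).length = b := by simp [hs.1]; omega
    rw [toNat_append, hsl, hr, hhi.2, toNat_take, toNat_drop, pv_cons, eval_add, eval_C, eval_mul,
      eval_X, mul_add, ← add_assoc, Nat.mod_add_div, hs.2]
    ring

theorem coeff_mul_le {n M : ℕ} {p q : ℕ[X]} (hp : ∀ i, p.coeff i ≤ M) (hq : ∀ i, q.coeff i ≤ M)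
    (hn : ∀ i, n ≤ i → p.coeff i = 0) (k : ℕ) : (p * q).coeff k ≤ n * (M * M) := by
  rw [coeff_mul, Finset.Nat.sum_antidiagonal_eq_sum_range_succ (fun i j => p.coeff i * q.coeff j)]
  calc ∑ i ∈ Finset.range (k + 1), p.coeff i * q.coeff (k - i)
      ≤ ∑ i ∈ Finset.range (k + 1), if i < n then M * M else 0 := by
        refine Finset.sum_le_sum fun i _ => ?_
        split
        · exact Nat.mul_le_mul (hp i) (hq _)
        · rw [hn i (by omega), zero_mul]
    _ = ((Finset.range (k + 1)).filter (· < n)).card * (M * M) := by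
        rw [← Finset.sum_filter, Finset.sum_const, smul_eq_mul]
    _ ≤ (Finset.range n).card * (M * M) := by
        gcongr
        intro i hi
        simp at hi ⊢
        exact hi.2
    _ = n * (M * M) := by simp

theorem natPoly_eq_of_map_zmod {q : ℕ} {P Q : ℕ[X]} (hP : ∀ i, P.coeff i < q)
    (hQ : ∀ i, Q.coeff i < q)
    (h : P.map (Nat.castRingHom (ZMod q)) = Q.map (Nat.castRingHom (ZMod q))) : P = Q := by
  ext i
  have h1 := congrArg (fun p => coeff p i) h
  simp only [coeff_map, Nat.coe_castRingHom, ZMod.natCast_eq_natCast_iff'] at h1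
  rwa [Nat.mod_eq_of_lt (hP i), Nat.mod_eq_of_lt (hQ i)] at h1

theorem pv_toNat_coeff_le {M : ℕ} {l : Poly} (h : ∀ c ∈ l, toNat c ≤ M) (i : ℕ) :
    (pv toNat l).coeff i ≤ M := by
  rw [pv_coeff]
  cases hi : l[i]? with
  | none => simp
  | some c => exact h c (List.mem_of_getElem? hi)

/-- The cost of one level of `intMulAux`, when a multiplication of pieces costs `u`. -/
def intMulStep (n u : ℕ) : ℕ :=
  let b := Nat.size n
  let w := 3 * b
  let count := n / b + 1
  2 * (count * w) + 8 * count * Nat.clog 2 (2 * count) * (4 * (u + (12 * w + 7)) +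
    (12 * w + 7) * (21 * Nat.size (Nat.clog 2 (2 * count)) + 18)) + w + 2 * count * (7 * w) + 2 * n

/-- The pieces, of `3 * size n` bits, are shorter than `n`; hence the recursion of `intMulCost`
terminates and `n` is enough depth for `intMulAux`. -/
theorem lt_two_pow_size_sub {n : ℕ} (hn : 32 ≤ n) : 6 ≤ Nat.size n ∧ 3 * Nat.size n < n := by
  have h6 : 6 ≤ Nat.size n := by
    have : 5 < Nat.size n := Nat.lt_size.2 (by norm_num; exact hn)
    omega
  refine ⟨h6, ?_⟩
  have h1 : 2 ^ (Nat.size n - 1) ≤ n := Nat.lt_size.1 (by omega)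
  obtain ⟨j, hj⟩ : ∃ j, Nat.size n = j + 6 := ⟨Nat.size n - 6, by omega⟩
  rw [hj] at h1 ⊢
  have h2 : ∀ j : ℕ, 3 * (j + 6) < 2 ^ (j + 5) := by
    intro j
    induction j with
    | zero => norm_num
    | succ j ih => rw [show j + 1 + 5 = (j + 5) + 1 by ring, pow_succ]; omega
  exact (h2 j).trans_le h1

/-- A bound for the cost of `intMulAux`. -/
def intMulCost (n : ℕ) : ℕ :=
  if h : n < 32 then n * (20 * n + 2) + 2 * n
  else intMulStep n (intMulCost (3 * Nat.size n))
termination_by n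
decreasing_by exact (lt_two_pow_size_sub (not_lt.1 h)).2

/-- There are `count` pieces below `2 ^ b` and `count + 1 ≤ 2 ^ b`, so the coefficients of the
product are below `2 ^ (3 b) - 1`. They are therefore determined by their residues, and evaluation
at `2 ^ b` gives the product. The modulus is odd, as `polyMul` requires. -/
theorem intMulAux_spec : ∀ {depth n : ℕ} {x y : Bits}, n ≤ depth → x.length = n → y.length = n →
    Spec (intMulAux depth n x y) (fun z => z.length = 2 * n ∧ toNat z = toNat x * toNat y)
      (intMulCost n) := by
  have hlt : ∀ {n : ℕ} {x y : Bits}, x.length = n → y.length = n →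
      toNat x * toNat y < 2 ^ (2 * n) := by
    intro n x y hx hy
    have h1 := toNat_lt x
    have h2 := toNat_lt y
    rw [hx] at h1
    rw [hy] at h2
    rw [two_mul, pow_add]
    exact Nat.mul_lt_mul'' h1 h2
  have hbase : ∀ {n : ℕ} {x y : Bits}, n < 32 → x.length = n → y.length = n →
      Spec (schoolMul (2 * n) x y) (fun z => z.length = 2 * n ∧ toNat z = toNat x * toNat y)
        (intMulCost n) := by
    intro n x y hn hx hy
    refine (schoolMul_spec (2 * n) x y).mono (fun z hz => ⟨hz.1, ?_⟩) ?_
    · rw [hz.2, Nat.mod_eq_of_lt (hlt hx hy)]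
    · rw [intMulCost, dif_pos hn, hx]
      exact le_of_eq (by ring)
  intro depth
  induction depth with
  | zero => exact fun hn hx hy => hbase (by omega) hx hy
  | succ depth ih =>
    intro n x y hn hx hy
    unfold intMulAux
    refine Spec.ite (fun h => hbase h hx hy) (fun h => ?_)
    obtain ⟨h6, h3⟩ := lt_two_pow_size_sub (not_lt.1 h)
    rw [intMulCost, dif_neg h, intMulStep]
    have hnb : n < 2 ^ Nat.size n := Nat.lt_size_self n
    set b := Nat.size n with hb
    simp only
    set w := 3 * b with hw
    set count := n / b + 1 with hcount
    have hcb : n ≤ count * b := by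
      have := Nat.lt_mul_div_succ n (show 0 < b by omega)
      rw [mul_comm] at this; exact this.le
    have hcn : count + 1 ≤ 2 ^ b := by
      have : n / b ≤ n / 6 := Nat.div_le_div_left h6 (by norm_num)
      omega
    have hq := toNat_replicate_true w
    have hodd : toNat (List.replicate w true) % 2 = 1 := by
      have : 2 ^ w = 2 * 2 ^ (w - 1) := by rw [← pow_succ']; congr 1; omega
      omega
    have hM : count * ((2 ^ b - 1) * (2 ^ b - 1)) < toNat (List.replicate w true) := by
      have h1 : 2 ^ w = 2 ^ b * (2 ^ b * 2 ^ b) := by rw [hw, ← pow_add, ← pow_add]; congr 1; ring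
      obtain ⟨v, hv⟩ : ∃ v, 2 ^ b = v + 1 := ⟨2 ^ b - 1, by omega⟩
      rw [h1, hv] at hq
      rw [hv] at hcn ⊢
      rw [Nat.add_sub_cancel]
      nlinarith [Nat.mul_le_mul_right (v * v) hcn]
    have h2b : 2 ^ b ≤ toNat (List.replicate w true) := by
      have h1 : 2 ^ (b + 1) ≤ 2 ^ w := Nat.pow_le_pow_right (by norm_num) (by omega)
      rw [pow_succ] at h1
      omega
    have himp := modRing_implements (w := w) (q := List.replicate w true)
      (mul := mulMersenne w (intMulAux depth w)) (by simp) hodd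
      (fun x y hx hy => mulMersenne_spec (ih (by omega) hx.1 hy.1) hx.2 hy.2)
    have hcoef : ∀ {Y : Poly}, (∀ c ∈ Y, c.length = w ∧ toNat c < 2 ^ b) →
        ∀ c ∈ Y, toNat c ≤ 2 ^ b - 1 := fun hY c hc => by have := (hY c hc).2; omega
    refine Spec.le (Spec.bind (chop_spec (w := w) (by omega) count x) fun F hF =>
      Spec.bind (chop_spec (w := w) (by omega) count y) fun G hG =>
      Spec.bind (himp.polyMul_spec (n := count) (Nat.succ_pos _) ⟨hF.1, fun c hc => ⟨(hF.2.1 c hc).1,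
        (hF.2.1 c hc).2.trans_le h2b⟩⟩ ⟨hG.1, fun c hc => ⟨(hG.2.1 c hc).1,
        (hG.2.1 c hc).2.trans_le h2b⟩⟩) fun Z hZ =>
      Spec.bind (resize_spec w []) fun c hc =>
      Spec.bind ((carryOut_spec (by omega) (by omega) hc.1 fun c hc => (hZ.1.2 c hc).1).le
        (d := 2 * count * (7 * w)) ?_) fun z hz =>
      (resize_spec (2 * n) z).imp fun t ht => ⟨ht.1, ?_⟩) (le_of_eq (by ring))
    · rw [hZ.1.1]; gcongr; omega
    · have hmap : pv toNat Z = pv toNat F * pv toNat G := by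
        refine natPoly_eq_of_map_zmod (q := toNat (List.replicate w true)) (fun i => ?_)
          (fun i => ?_) ?_
        · refine (pv_toNat_coeff_le (M := toNat (List.replicate w true) - 1)
            (fun c hc => ?_) i).trans_lt (by omega)
          have := (hZ.1.2 c hc).2
          omega
        · refine (coeff_mul_le (pv_toNat_coeff_le (hcoef hF.2.1)) (pv_toNat_coeff_le (hcoef hG.2.1))
            (fun i hi => ?_) i).trans_lt hM
          rw [pv_coeff, List.getElem?_eq_none (by rw [hF.1]; exact hi)]; rfl
        · rw [Polynomial.map_mul, map_pv, map_pv, map_pv]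
          exact hZ.2
      have hxv := toNat_lt x
      have hyv := toNat_lt y
      have hpow : 2 ^ n ≤ 2 ^ (count * b) := Nat.pow_le_pow_right (by norm_num) hcb
      rw [hx] at hxv
      rw [hy] at hyv
      rw [ht.2, hz, hc.2, hmap, eval_mul, hF.2.2, hG.2.2, Nat.mod_eq_of_lt (hxv.trans_le hpow),
        Nat.mod_eq_of_lt (hyv.trans_le hpow)]
      simp only [toNat_nil, Nat.zero_mod, zero_add]
      exact Nat.mod_eq_of_lt (hlt hx hy)

theorem intMul_spec (x y : Bits) :
    Spec (intMul x y) (fun z => z.length = 2 * max x.length y.length ∧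
      toNat z = toNat x * toNat y)
      (2 * max x.length y.length + intMulCost (max x.length y.length)) := by
  have hx := (toNat_lt x).trans_le (Nat.pow_le_pow_right (n := 2) (by simp)
    (le_max_left x.length y.length))
  have hy := (toNat_lt y).trans_le (Nat.pow_le_pow_right (n := 2) (by simp)
    (le_max_right x.length y.length))
  refine Spec.le (Spec.bind (resize_spec_of_lt hx) fun x' hx' => Spec.bind (resize_spec_of_lt hy)
    fun y' hy' => (intMulAux_spec le_rfl hx'.1 hy'.1).imp fun z hz => ⟨hz.1, ?_⟩) (by omega)
  rw [hz.2, hx'.2, hy'.2]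

/-! ## The growth of the cost of integer multiplication -/

/-- With `q` pieces of `b` bits, `q * b ≤ 2 * n` and the exponent of the transform length is at most
`2 * b`. The `8 * q * (2 * b) * 4` multiplications of pieces thus number at most `128 * n`: the
logarithm of the transform cancels the division of `n` by `b`. -/
theorem intMulStep_le {n u : ℕ} (hn : 32 ≤ n) :
    intMulStep n u ≤ n * (128 * u + Nat.size n * (52387 * Nat.size (3 * Nat.size n))) := by
  obtain ⟨h6, h3⟩ := lt_two_pow_size_sub hn
  have hnb : n < 2 ^ Nat.size n := Nat.lt_size_self n
  rw [intMulStep]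
  set b := Nat.size n with hb
  set q := n / b + 1 with hq
  have hqb : q * b ≤ 2 * n := by
    have := Nat.div_mul_le_self n b
    rw [hq, Nat.succ_mul]; omega
  have hqn : q + 1 ≤ 2 ^ b := by
    have : n / b ≤ n / 6 := Nat.div_le_div_left h6 (by norm_num)
    omega
  have hk : Nat.clog 2 (2 * q) ≤ 2 * b := by
    refine (Nat.clog_le_of_le_pow (y := b + 1) ?_).trans (by omega)
    rw [pow_succ]; omega
  have hs : Nat.size (Nat.clog 2 (2 * q)) ≤ Nat.size (3 * b) := Nat.size_le_size (by omega)
  have hs1 : 1 ≤ Nat.size (3 * b) := Nat.size_pos.2 (by omega)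
  generalize Nat.clog 2 (2 * q) = k at *
  generalize Nat.size (3 * b) = s at *
  have h7 : 12 * (3 * b) + 7 ≤ 38 * b := by omega
  have hbs : 1 ≤ b * s := Nat.mul_pos (by omega) hs1
  have h3b : 3 * b ≤ n * (b * s) := h3.le.trans (Nat.le_mul_of_pos_right _ hbs)
  calc _ ≤ 2 * (q * (3 * b)) + 8 * q * (2 * b) * (4 * (u + 38 * b) +
        38 * b * (21 * s + 18)) + 3 * b + 2 * q * (7 * (3 * b)) + 2 * n := by
        gcongr
    _ = (q * b) * 48 + (q * b) * (64 * u + 13376 * (b * 1) + 12768 * (b * s)) + 3 * b + 2 * n := by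
        ring
    _ ≤ (2 * n) * 48 + (2 * n) * (64 * u + 13376 * (b * s) + 12768 * (b * s)) + 3 * b + 2 * n := by
        gcongr
    _ = n * (128 * u) + n * (98 * 1 + b * s * 52288) + 3 * b := by ring
    _ ≤ n * (128 * u) + n * (98 * (b * s) + b * s * 52288) + n * (b * s) := by
        gcongr
    _ = _ := by ring

theorem exists_size_le_rpow {δ : ℝ} (hδ : 0 < δ) :
    ∃ C : ℝ, 1 ≤ C ∧ ∀ m : ℕ, 0 < m → (Nat.size m : ℝ) ≤ C * (m : ℝ) ^ δ := by
  refine ⟨1 + 2 / δ, by have : 0 < 2 / δ := by positivity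
                        linarith, fun m hm => ?_⟩
  have hm1 : (1 : ℝ) ≤ m := by exact_mod_cast hm
  have h1 : 2 ^ (Nat.size m - 1) ≤ m := Nat.lt_size.1 (by have := Nat.size_pos.2 hm; omega)
  have h2 : ((Nat.size m - 1 : ℕ) : ℝ) * Real.log 2 ≤ Real.log m := by
    rw [← Real.log_pow]
    exact Real.log_le_log (by positivity) (by exact_mod_cast h1)
  have h3 : Real.log m ≤ (m : ℝ) ^ δ / δ := Real.log_le_rpow_div (by positivity) hδ
  have h4 : (1 : ℝ) / 2 ≤ Real.log 2 := by linarith [Real.log_two_gt_d9]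
  have h5 : (Nat.size m : ℝ) = ((Nat.size m - 1 : ℕ) : ℝ) + 1 := by
    have := Nat.size_pos.2 hm
    rw [Nat.cast_sub this]; simp
  have h6 : (1 : ℝ) ≤ (m : ℝ) ^ δ := Real.one_le_rpow hm1 hδ.le
  have h7 : ((Nat.size m - 1 : ℕ) : ℝ) * (1 / 2) ≤ (m : ℝ) ^ δ / δ :=
    (mul_le_mul_of_nonneg_left h4 (by positivity)).trans (h2.trans h3)
  rw [h5, add_mul, div_mul_eq_mul_div, mul_div_assoc]
  linarith

/-- Taking `δ = ε / (2 (1 + ε))` in `exists_size_le_rpow` bounds the left side by a constant times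
`b ^ (ε / 2)`. The other factor `b ^ (ε / 2)` eventually exceeds that constant. -/
theorem exists_size_rpow_le {ε : ℝ} (hε : 0 < ε) (C₁ : ℝ) (hC₁ : 0 < C₁) :
    ∃ b₀ : ℕ, ∀ b : ℕ, b₀ ≤ b → 0 < b →
      C₁ * (Nat.size (3 * b) : ℝ) ^ (1 + ε) ≤ (b : ℝ) ^ ε := by
  have hδ : 0 < ε / (2 * (1 + ε)) := by positivity
  obtain ⟨C, hC, h⟩ := exists_size_le_rpow hδ
  set C₂ := C₁ * (C ^ (1 + ε) * 3 ^ (ε / 2)) with hC₂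
  have hC₂0 : 0 < C₂ := by positivity
  refine ⟨⌈C₂ ^ (2 / ε)⌉₊, fun b hb hb0 => ?_⟩
  have hb' : C₂ ^ (2 / ε) ≤ b := (Nat.le_ceil _).trans (by exact_mod_cast hb)
  have hb1 : C₂ ≤ (b : ℝ) ^ (ε / 2) := by
    calc C₂ = (C₂ ^ (2 / ε)) ^ (ε / 2) := by
          rw [← Real.rpow_mul hC₂0.le]; field_simp; simp
      _ ≤ _ := Real.rpow_le_rpow (by positivity) hb' (by positivity)
  have h1 := h (3 * b) (by omega)
  calc C₁ * (Nat.size (3 * b) : ℝ) ^ (1 + ε)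
      ≤ C₁ * (C * ((3 * b : ℕ) : ℝ) ^ (ε / (2 * (1 + ε)))) ^ (1 + ε) := by gcongr
    _ = C₁ * (C ^ (1 + ε) * (3 ^ (ε / 2) * (b : ℝ) ^ (ε / 2))) := by
        rw [Real.mul_rpow (by positivity) (by positivity), ← Real.rpow_mul (by positivity),
          show ε / (2 * (1 + ε)) * (1 + ε) = ε / 2 by field_simp, Nat.cast_mul,
          Real.mul_rpow (by positivity) (by positivity)]
        norm_num
    _ = C₂ * (b : ℝ) ^ (ε / 2) := by rw [hC₂]; ring
    _ ≤ (b : ℝ) ^ (ε / 2) * (b : ℝ) ^ (ε / 2) := by gcongr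
    _ = (b : ℝ) ^ ε := by
        rw [← Real.rpow_add (by exact_mod_cast hb0)]; congr 1; ring

/-- Strong induction on the recurrence `M(n) ≤ n (128 M(3 b) + 52387 b size (3 b))` with `b = size
n`. The hypothesis at `3 b` leaves `D n b` times a power of `size (3 b)`, and for large `b` this
power is absorbed by `b ^ ε` without enlarging `D`. -/
theorem exists_intMulCost_le {ε : ℝ} (hε : 0 < ε) :
    ∃ D : ℝ, 1 ≤ D ∧ ∀ n : ℕ, 0 < n →
      (intMulCost n : ℝ) ≤ D * (n * (Nat.size n : ℝ) ^ (1 + ε)) := by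
  -- Here `52771 = 3 * 128 + 52387`, the two contributions to one step of the recurrence.
  obtain ⟨b₀, hb₀⟩ := exists_size_rpow_le hε 52771 (by norm_num)
  set M := 2 ^ (max b₀ 6) with hM
  -- `D` exceeds all costs below the threshold `M`, which settles the finitely many small `n`.
  set D : ℝ := 1 + ∑ i ∈ Finset.range M, (intMulCost i : ℝ) with hD
  have hD1 : 1 ≤ D := le_add_of_nonneg_right (Finset.sum_nonneg fun i _ => Nat.cast_nonneg _)
  refine ⟨D, hD1, fun n => ?_⟩
  induction n using Nat.strong_induction_on with
  | _ n ih =>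
    intro hn
    have hn1 : (1 : ℝ) ≤ n := by exact_mod_cast hn
    have hs1 : (1 : ℝ) ≤ Nat.size n := by exact_mod_cast Nat.size_pos.2 hn
    rcases Nat.lt_or_ge n M with h | h
    · have h1 : (intMulCost n : ℝ) ≤ D := by
        have := Finset.single_le_sum (f := fun i => (intMulCost i : ℝ))
          (fun i _ => Nat.cast_nonneg _) (Finset.mem_range.2 h)
        linarith
      have h2 : 1 ≤ (n : ℝ) * (Nat.size n : ℝ) ^ (1 + ε) :=
        one_le_mul_of_one_le_of_one_le hn1 (Real.one_le_rpow hs1 (by linarith))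
      calc _ ≤ D := h1
        _ ≤ _ := le_mul_of_one_le_right (by linarith) h2
    · have h64 : 2 ^ 6 ≤ M := Nat.pow_le_pow_right (by norm_num) (le_max_right _ _)
      have h32 : 32 ≤ n := by norm_num at h64; omega
      obtain ⟨h6, h3⟩ := lt_two_pow_size_sub h32
      have hbb : b₀ ≤ Nat.size n := by
        have := Nat.lt_size.2 h
        have := le_max_left b₀ 6
        omega
      have hb := hb₀ (Nat.size n) hbb (by omega)
      have hrec := ih (3 * Nat.size n) h3 (by omega)
      have hstep : (intMulCost n : ℝ) ≤ n * (128 * (intMulCost (3 * Nat.size n)) +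
          Nat.size n * (52387 * Nat.size (3 * Nat.size n))) := by
        rw [intMulCost, dif_neg (by omega)]
        exact_mod_cast intMulStep_le h32
      have ht1 : (1 : ℝ) ≤ Nat.size (3 * Nat.size n) := by
        exact_mod_cast Nat.size_pos.2 (by omega)
      have ht2 : (Nat.size (3 * Nat.size n) : ℝ) ≤ (Nat.size (3 * Nat.size n) : ℝ) ^ (1 + ε) := by
        conv_lhs => rw [← Real.rpow_one (Nat.size (3 * Nat.size n) : ℝ)]
        exact Real.rpow_le_rpow_of_exponent_le ht1 (by linarith)
      push_cast at hrec
      set s : ℝ := (Nat.size n : ℝ)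
      set t : ℝ := (Nat.size (3 * Nat.size n) : ℝ)
      have hs : s ^ (1 + ε) = s * s ^ ε := by rw [Real.rpow_add (by linarith), Real.rpow_one]
      rw [hs]
      set T : ℝ := t ^ (1 + ε)
      calc (intMulCost n : ℝ) ≤ n * (128 * (D * (3 * s * T)) + s * (52387 * t)) := by
            refine hstep.trans ?_
            gcongr
        _ ≤ n * (128 * (D * (3 * s * T)) + s * (D * (52387 * T))) := by
            have : 52387 * t ≤ D * (52387 * T) :=
              calc 52387 * t ≤ 52387 * T := by gcongr
                _ ≤ D * (52387 * T) := le_mul_of_one_le_left (by positivity) hD1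
            exact mul_le_mul_of_nonneg_left (add_le_add_right
              (mul_le_mul_of_nonneg_left this (by positivity)) _) (by positivity)
        _ = D * (n * (s * (52771 * T))) := by ring
        _ ≤ D * (n * (s * s ^ ε)) := by gcongr

/-- `lam * n` bounds the cost of a multiplication of words of length `n ≤ L`. -/
def MulBound (lam L : ℕ) : Prop := 7 ≤ lam ∧ ∀ n ≤ L, 2 * n + intMulCost n ≤ lam * n

/-- The factor `lam` is the same for all lengths up to `L`. Costs become linear in the length, so
they can be summed over the nodes of a tree. -/
theorem exists_mulBound {ε : ℝ} (hε : 0 < ε) :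
    ∃ D : ℝ, 1 ≤ D ∧ ∀ L : ℕ, 0 < L →
      ∃ lam : ℕ, MulBound lam L ∧ (lam : ℝ) ≤ D * (Nat.size L : ℝ) ^ (1 + ε) := by
  obtain ⟨D, hD, h⟩ := exists_intMulCost_le hε
  refine ⟨D + 9, by linarith, fun L hL => ?_⟩
  have hs1 : (1 : ℝ) ≤ Nat.size L := by exact_mod_cast Nat.size_pos.2 hL
  have hp : (1 : ℝ) ≤ (Nat.size L : ℝ) ^ (1 + ε) := Real.one_le_rpow hs1 (by linarith)
  refine ⟨⌈(D + 8) * (Nat.size L : ℝ) ^ (1 + ε)⌉₊, ⟨?_, fun n hn => ?_⟩, ?_⟩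
  · have : (7 : ℝ) ≤ (D + 8) * (Nat.size L : ℝ) ^ (1 + ε) := by nlinarith
    exact_mod_cast this.trans (Nat.le_ceil _)
  · rcases Nat.eq_zero_or_pos n with rfl | hn0
    · simp [intMulCost]
    · have hn1 : (1 : ℝ) ≤ n := by exact_mod_cast hn0
      have hmono : (Nat.size n : ℝ) ^ (1 + ε) ≤ (Nat.size L : ℝ) ^ (1 + ε) := by
        gcongr
        exact Nat.size_le_size hn
      have : ((2 * n + intMulCost n : ℕ) : ℝ) ≤ (D + 8) * (Nat.size L : ℝ) ^ (1 + ε) * n := by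
        push_cast
        have h2 : D * (n * (Nat.size n : ℝ) ^ (1 + ε)) ≤ D * (n * (Nat.size L : ℝ) ^ (1 + ε)) := by
          gcongr
        have h3 := h n hn0
        nlinarith
      have h4 : (D + 8) * (Nat.size L : ℝ) ^ (1 + ε) * n ≤
          (⌈(D + 8) * (Nat.size L : ℝ) ^ (1 + ε)⌉₊ : ℝ) * n := by
        gcongr
        exact Nat.le_ceil _
      exact_mod_cast this.trans h4
  · have := Nat.ceil_lt_add_one (show 0 ≤ (D + 8) * (Nat.size L : ℝ) ^ (1 + ε) by positivity)
    nlinarith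

theorem MulBound.intMul_spec {lam L : ℕ} (h : MulBound lam L) {x y : Bits} {n : ℕ}
    (hn : max x.length y.length = n) (hL : n ≤ L) :
    Spec (intMul x y) (fun z => z.length = 2 * n ∧ toNat z = toNat x * toNat y) (lam * n) := by
  subst hn
  exact (BitAlg.intMul_spec x y).le (h.2 _ hL)

/-! ## Division of integers -/

theorem longDiv_spec {d : Bits} (hd : 0 < toNat d) (x : Bits) :
    Spec (longDiv d x) (fun qr => toNat qr.1 = toNat x / toNat d ∧ qr.2.length = d.length ∧
      toNat qr.2 = toNat x % toNat d) (x.length * (8 * d.length + 8) + d.length) := by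
  have hdl := toNat_lt d
  have hd' : toNat (d ++ [false]) = toNat d := by simp [toNat_append]
  induction x with
  | nil =>
    exact Spec.le (Spec.bind (resize_spec d.length []) fun z hz => Spec.pure
      ⟨by simp, hz.1, by simpa using hz.2⟩) (by simp)
  | cons b x ih =>
    have hb := b.toNat_lt
    have hdm := Nat.div_add_mod (toNat x) (toNat d)
    have hml := Nat.mod_lt (toNat x) hd
    rw [longDiv]
    refine Spec.le (Spec.bind ih fun qr hqr => Spec.bind (c := d.length + 1)
      ((copyBits_spec (b :: qr.2)).le (by simp [hqr.2.1])) fun r hr =>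
      Spec.bind (subBits_spec (w := d.length + 1) (x := r) (y := d ++ [false])
        (by simp [hr, hqr.2.1]) (by simp)) fun e he => Spec.bind (Spec.testB e.2) fun ge hge => ?_)
        (c := x.length * (8 * d.length + 8) + d.length + (d.length + 1 + (6 * (d.length + 1) +
          (1 + d.length))))
        (by rw [List.length_cons, add_mul x.length, one_mul]; omega)
    have hrv : toNat r = b.toNat + 2 * (toNat x % toNat d) := by simp [hr, hqr.2.2]
    rw [hd'] at he
    have hdiv : ∀ q r' : ℕ, b.toNat + 2 * toNat x = toNat d * q + r' → r' < toNat d →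
        q = (b.toNat + 2 * toNat x) / toNat d ∧ r' = (b.toNat + 2 * toNat x) % toNat d := by
      intro q r' h1 h2
      rw [h1, Nat.mul_add_div hd, Nat.div_eq_of_lt h2, Nat.mul_add_mod, Nat.mod_eq_of_lt h2]
      simp
    have hmul : toNat d * (2 * (toNat x / toNat d)) = 2 * (toNat d * (toNat x / toNat d)) := by ring
    simp only [toNat_cons]
    refine Spec.ite (fun hc => ?_) (fun hc => ?_)
    · have hc' := hc
      rw [hge, he.2.1, decide_eq_true_iff] at hc'
      have h1 := he.2.2.1 hc'
      refine Spec.bind (d := 0) (resize_spec_of_lt (by omega)) fun z hz => Spec.pure ?_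
      have := hdiv (1 + 2 * (toNat x / toNat d)) (toNat z) (by rw [mul_add, hmul]; omega) (by omega)
      exact ⟨by simp [hc, hqr.1, this.1], hz.1, this.2⟩
    · have hc' := hc
      rw [hge, he.2.1, decide_eq_true_iff] at hc'
      refine Spec.bind (d := 0) (resize_spec_of_lt (by omega)) fun z hz => Spec.pure ?_
      have := hdiv (2 * (toNat x / toNat d)) (toNat z) (by rw [hmul]; omega) (by omega)
      rw [Bool.not_eq_true] at hc
      exact ⟨by simp [hc, hqr.1, this.1], hz.1, this.2⟩

/-- With `a = Q - d * v₀` the error before the step, the exact Newton iterate times `d` is `Q - a ^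
2 / Q`: the error is squared. Including the rounding `ρ` gives the identity `key`, and `a ^ 2 < d *
Q` places the new value at the floor of `Q / d` or one above it. -/
theorem newton_core {d Q v₀ u ρ a : ℤ} (hd : 0 < d) (hQ : 0 < Q) (ea : d * v₀ = Q - a)
    (eρ : v₀ * v₀ * d = Q * u + ρ) (hρ0 : 0 ≤ ρ) (hρ : ρ < Q) (ha : a * a < d * Q) :
    Q < d * (2 * v₀ - u + 1) ∧ d * (2 * v₀ - u) < Q + d := by
  have key : d * Q * (2 * v₀ - u) = Q * Q - a * a + d * ρ := by
    have : d * (v₀ * v₀ * d) = (Q - a) * (Q - a) := by rw [← ea]; ring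
    rw [eρ] at this
    linear_combination 2 * Q * ea - this
  constructor
  · have : Q * Q < Q * (d * (2 * v₀ - u + 1)) := by
      have h1 := mul_nonneg hd.le hρ0
      calc Q * Q < Q * Q - a * a + d * ρ + d * Q := by linarith
        _ = _ := by rw [← key]; ring
    exact lt_of_mul_lt_mul_left this hQ.le
  · have : Q * (d * (2 * v₀ - u)) < Q * (Q + d) := by
      have h1 := mul_lt_mul_of_pos_left hρ hd
      have h2 := mul_self_nonneg a
      calc Q * (d * (2 * v₀ - u)) = Q * Q - a * a + d * ρ := by rw [← key]; ring
        _ < Q * Q + d * Q := by linarith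
        _ = _ := by ring
    exact lt_of_mul_lt_mul_left this hQ.le

/-- The analysis of one step of the Newton iteration for the reciprocal. -/
theorem newton_step {k h d : ℕ} (hk : h ≤ k) (hh : k + 5 ≤ 2 * h) (hd : 2 ^ k ≤ 2 * d)
    (hd' : d < 2 ^ k) {v₀ u : ℕ} (hv : v₀ = 2 ^ (k - h) * (2 ^ (2 * h) / (d / 2 ^ (k - h))))
    (hu : u = v₀ * v₀ * d / 2 ^ (2 * k)) :
    2 ^ (2 * k) / d + u ≤ 2 * v₀ ∧ 2 * v₀ ≤ 2 ^ (2 * k) / d + u + 1 ∧ u < 2 ^ (k + 3) ∧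
      2 ^ (2 * k) / d ≤ 2 ^ (k + 1) := by
  set E := 2 ^ (k - h) with hE
  set dh := d / E with hdh
  set vh := 2 ^ (2 * h) / dh with hvh
  set Q := 2 ^ (2 * k) with hQ
  have hE0 : 0 < E := by positivity
  have hQ0 : 0 < Q := by positivity
  have hd0 : 0 < d := by have : 0 < 2 ^ k := by positivity
                         omega
  have hkE : 2 ^ k = E * 2 ^ h := by rw [hE, ← pow_add]; congr 1; omega
  have h2h : 2 ^ h = 2 * 2 ^ (h - 1) := by rw [← pow_succ']; congr 1; omega
  have hdh1 : 2 ^ (h - 1) ≤ dh := by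
    rw [hdh, Nat.le_div_iff_mul_le hE0]
    have : 2 ^ k = 2 * (2 ^ (h - 1) * E) := by rw [hkE, h2h]; ring
    omega
  have hdh0 : 0 < dh := lt_of_lt_of_le (by positivity) hdh1
  have hvh1 : vh ≤ 2 ^ (h + 1) := by
    calc vh ≤ 2 ^ (2 * h) / 2 ^ (h - 1) := Nat.div_le_div_left hdh1 (by positivity)
      _ = 2 ^ (h + 1) := by
        rw [Nat.pow_div (by omega) (by norm_num)]; congr 1; omega
  have hQE : Q = 2 ^ (2 * h) * (E * E) := by
    rw [hQ, hE, ← pow_add, ← pow_add]; congr 1; omega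
  have hQk : Q = 2 ^ k * 2 ^ k := by rw [hQ, ← pow_add]; congr 1; omega
  obtain ⟨f, hf⟩ : ∃ f, f = d % E := ⟨_, rfl⟩
  obtain ⟨g, hg⟩ : ∃ g, g = 2 ^ (2 * h) % dh := ⟨_, rfl⟩
  obtain ⟨ρ, hρ⟩ : ∃ ρ, ρ = v₀ * v₀ * d % Q := ⟨_, rfl⟩
  have ef : d = E * dh + f := by rw [hf, hdh, Nat.div_add_mod]
  have eg : 2 ^ (2 * h) = dh * vh + g := by rw [hg, hvh, Nat.div_add_mod]
  have eρ : v₀ * v₀ * d = Q * u + ρ := by rw [hρ, hu, Nat.div_add_mod]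
  have lf : f < E := hf ▸ Nat.mod_lt _ hE0
  have lg : g < dh := hg ▸ Nat.mod_lt _ hdh0
  have lρ : ρ < Q := hρ ▸ Nat.mod_lt _ hQ0
  have hEvh : E * vh ≤ 4 * d := by
    calc E * vh ≤ E * 2 ^ (h + 1) := by gcongr
      _ = 2 * 2 ^ k := by rw [hkE]; ring
      _ ≤ 4 * d := by omega
  have hEd : E * dh ≤ d := by omega
  -- the error `a = Q - d * v₀`
  set a : ℤ := E * E * g - f * E * vh with ha
  have ea : (d : ℤ) * v₀ = Q - a := by
    rw [hv, hQE, ha, eg, ef]; push_cast; ring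
  have h1 : E * E * g ≤ 4 * d * E := by
    calc E * E * g ≤ E * E * dh := by gcongr
      _ = E * (E * dh) := by ring
      _ ≤ E * d := by gcongr
      _ ≤ 4 * (E * d) := by omega
      _ = _ := by ring
  have h2 : f * E * vh ≤ 4 * d * E := by
    calc f * E * vh = f * (E * vh) := by ring
      _ ≤ E * (4 * d) := by gcongr
      _ = _ := by ring
  -- The factor 16 is the square of the 4 in `|a| ≤ 4 * d * E`. The hypothesis `k + 5 ≤ 2 * h`
  -- enters as `E * E ≤ 2 ^ (k - 5)`; it is the reason for the guard bits in `h = k / 2 + 3`.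
  have hEE : 16 * (d * (E * E)) < Q := by
    have h1 : E * E ≤ 2 ^ (k - 5) := by
      rw [hE, ← pow_add]; exact Nat.pow_le_pow_right (by norm_num) (by omega)
    have h5 : 2 ^ k = 32 * 2 ^ (k - 5) := by
      rw [show (32 : ℕ) = 2 ^ 5 by norm_num, ← pow_add]; congr 1; omega
    calc 16 * (d * (E * E)) ≤ 16 * (d * 2 ^ (k - 5)) := by gcongr
      _ ≤ 32 * (d * 2 ^ (k - 5)) := by omega
      _ = d * 2 ^ k := by rw [h5]; ring
      _ < 2 ^ k * 2 ^ k := by gcongr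
      _ = Q := hQk.symm
  have a3 : a * a < d * Q := by
    have h1z : (E : ℤ) * E * g ≤ 4 * d * E := by exact_mod_cast h1
    have h2z : (f : ℤ) * E * vh ≤ 4 * d * E := by exact_mod_cast h2
    have h3 : a * a ≤ (4 * d * E) * (4 * d * E) := by
      refine mul_self_le_mul_self_of_le_of_neg_le ?_ ?_ <;> rw [ha]
      · have : (0 : ℤ) ≤ f * E * vh := by positivity
        linarith
      · have : (0 : ℤ) ≤ E * E * g := by positivity
        linarith
    have h4 : d * (16 * (d * (E * E))) < d * Q := Nat.mul_lt_mul_of_pos_left hEE hd0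
    calc a * a ≤ (4 * d * E) * (4 * d * E) := h3
      _ = ((d * (16 * (d * (E * E))) : ℕ) : ℤ) := by push_cast; ring
      _ < ((d * Q : ℕ) : ℤ) := by exact_mod_cast h4
      _ = d * Q := by push_cast; ring
  have hdz : (0 : ℤ) < d := by exact_mod_cast hd0
  clear_value a Q
  obtain ⟨low, up⟩ := newton_core (ρ := ρ) (u := u) (v₀ := v₀) hdz (by exact_mod_cast hQ0) ea (by exact_mod_cast eρ)
    (by positivity) (by exact_mod_cast lρ) a3
  have hV1 : d * (Q / d) ≤ Q := Nat.mul_div_le Q d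
  have hV2 : Q < d * (Q / d + 1) := by
    have := Nat.lt_mul_div_succ Q hd0
    simpa using this
  have hV1z : (d : ℤ) * ((Q / d : ℕ) : ℤ) ≤ Q := by exact_mod_cast hV1
  have hV2z : (Q : ℤ) < d * (((Q / d : ℕ) : ℤ) + 1) := by exact_mod_cast hV2
  -- Both estimates are compared with `d * (Q / d) ≤ Q < d * (Q / d + 1)` and divided by `d`. The
  -- iterate is the true floor or one too large, which the final comparison in `recipAux` corrects.
  have r1 : ((Q / d : ℕ) : ℤ) < 2 * v₀ - u + 1 :=
    lt_of_mul_lt_mul_left (hV1z.trans_lt low) hdz.le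
  have r2 : (2 * v₀ - u : ℤ) - 1 < ((Q / d : ℕ) : ℤ) + 1 := by
    refine lt_of_mul_lt_mul_left (a := (d : ℤ)) ?_ hdz.le
    calc (d : ℤ) * (2 * v₀ - u - 1) = d * (2 * v₀ - u) - d := by ring
      _ < Q := by linarith
      _ < _ := hV2z
  have hV : Q / d ≤ 2 ^ (k + 1) := by
    apply Nat.div_le_of_le_mul
    calc Q = 2 ^ k * 2 ^ k := hQk
      _ ≤ (2 * d) * 2 ^ k := by gcongr
      _ = d * 2 ^ (k + 1) := by ring
  refine ⟨by omega, by omega, ?_, hV⟩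
  have hv1 : v₀ ≤ 2 * 2 ^ k := by
    rw [hv, hkE]
    calc E * vh ≤ E * 2 ^ (h + 1) := by gcongr
      _ = _ := by ring
  rw [hu, Nat.div_lt_iff_lt_mul hQ0, hQk]
  calc v₀ * v₀ * d ≤ (2 * 2 ^ k) * (2 * 2 ^ k) * d := by gcongr
    _ < (2 * 2 ^ k) * (2 * 2 ^ k) * 2 ^ k := by gcongr
    _ ≤ (2 * 2 ^ k) * (2 * 2 ^ k) * 2 ^ k * 2 := by omega
    _ = 2 ^ (k + 3) * (2 ^ k * 2 ^ k) := by ring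

theorem recip_longDiv_spec {lam : ℕ} (hlam : 7 ≤ lam) {d : Bits} (hd : NoLead d)
    (hk : d.length ≤ 8) :
    Spec (do
      let num ← shiftUp (2 * d.length) [true]
      let qr ← longDiv d num
      resize (d.length + 2) qr.1)
      (fun v => v.length = d.length + 2 ∧ toNat v = 2 ^ (2 * d.length) / toNat d)
      (108 * (lam * d.length)) := by
  have hk1 := hd.length_pos
  have hV : 2 ^ (2 * d.length) / toNat d < 2 ^ (d.length + 2) := by
    rw [Nat.div_lt_iff_lt_mul hd.pos]
    calc 2 ^ (2 * d.length) < 2 ^ (d.length + 1) * 2 ^ d.length := by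
          rw [← pow_add]; exact Nat.pow_lt_pow_right (by norm_num) (by omega)
      _ ≤ 2 ^ (d.length + 1) * (2 * toNat d) := Nat.mul_le_mul_left _ hd
      _ = _ := by ring
  have hcost : 7 * d.length ≤ lam * d.length := Nat.mul_le_mul_right _ hlam
  refine Spec.le (Spec.bind (shiftUp_spec (2 * d.length) [true]) fun num hnum =>
    Spec.bind ((longDiv_spec hd.pos num).le (d := 17 * (8 * d.length + 8) + d.length) ?_)
      fun qr hqr => (resize_spec_of_lt (w := d.length + 2) ?_).imp fun v hv => ⟨hv.1, ?_⟩) ?_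
  · rw [hnum.1]
    gcongr
    simp only [List.length_singleton]
    omega
  · rw [hqr.1, hnum.2]; simpa using hV
  · rw [hv.2, hqr.1, hnum.2]; simp
  · simp only [List.length_singleton]
    omega

/-- The recursive call has length at most `8 k / 9` and uses `96 * lam * k` out of `108 * lam * k`.
The remaining `12 * lam * k` pays for the multiplications and the linear work, since `lam ≥ 7` and
`k ≥ 9`. -/
theorem recip_cost_le {lam k h : ℕ} (hlam : 7 ≤ lam) (hk : 9 ≤ k) (hh : 9 * h ≤ 8 * k) :
    h + (108 * (lam * h) + (k + 2 + (lam * (k + 2) + (lam * (2 * k + 4) +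
      (2 * k + 8 + (k + 3 + (k + 3 + (6 * (k + 3) + (k + 2 + (lam * (k + 2) + (2 * k + 1 +
      (2 * k + 4 + (6 * (2 * k + 4) + (1 + (k + 2 + 6 * (k + 2)))))))))))))))) ≤
      108 * (lam * k) := by
  have e2 : lam * (9 * h) ≤ lam * (8 * k) := Nat.mul_le_mul_left _ hh
  have e3 : 7 * k ≤ lam * k := Nat.mul_le_mul_right _ hlam
  have e4 : lam * 9 ≤ lam * k := Nat.mul_le_mul_left _ hk
  calc _ = h + 108 * (lam * h) + 35 * k + 4 * (lam * k) + 8 * lam + 80 := by ring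
    _ ≤ 108 * (lam * k) := by nlinarith

/-- The Newton iteration, after the reciprocal `vh` of the leading `h` bits has been found. -/
theorem recip_newton_spec {lam L : ℕ} (hM : MulBound lam L) {k h : ℕ} {d vh : Bits}
    (hk : d.length = k) (hd : NoLead d) (hL : 2 * k + 4 ≤ L) (hle : h ≤ k) (hh : k + 5 ≤ 2 * h)
    (hvl : vh.length = h + 2) (hvh : toNat vh = 2 ^ (2 * h) / (toNat d / 2 ^ (k - h))) :
    Spec (do
      let v₀ ← shiftUp (k - h) vh
      let sq ← intMul v₀ v₀
      let p ← intMul sq d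
      let u ← shiftDown (2 * k) p
      let u' ← resize (k + 3) u
      let dbl ← shiftUp 1 v₀
      let v ← subBits dbl u'
      let v' ← resize (k + 2) v.1
      let dv ← intMul d v'
      let num ← shiftUp (2 * k) [true]
      let num' ← resize dv.length num
      let fits ← subBits num' dv
      let ok ← testB fits.2
      if ok then pure v'
      else do
        let one ← resize (k + 2) [true]
        let v'' ← subBits v' one
        pure v''.1)
      (fun v => v.length = k + 2 ∧ toNat v = 2 ^ (2 * k) / toNat d)
      (k + 2 + (lam * (k + 2) + (lam * (2 * k + 4) +
      (2 * k + 8 + (k + 3 + (k + 3 + (6 * (k + 3) + (k + 2 + (lam * (k + 2) + (2 * k + 1 +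
      (2 * k + 4 + (6 * (2 * k + 4) + (1 + (k + 2 + 6 * (k + 2))))))))))))))) := by
  have hdpos := hd.pos
  have hdlt := toNat_lt d
  have hdn : 2 ^ d.length ≤ 2 * toNat d := hd
  rw [hk] at hdlt hdn
  clear hd
  refine Spec.bind (P := fun v₀ => v₀.length = k + 2 ∧ toNat v₀ = 2 ^ (k - h) * toNat vh)
    ((shiftUp_spec (k - h) vh).mono (fun z hz => ⟨by omega, hz.2⟩) (by omega)) fun v₀ hv₀ =>
    Spec.bind (hM.intMul_spec (x := v₀) (y := v₀) (n := k + 2)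
      (by rw [max_self]; exact hv₀.1) (by omega)) fun sq hsq =>
    Spec.bind (hM.intMul_spec (x := sq) (y := d) (n := 2 * k + 4)
      (by rw [hsq.1, hk]; exact max_eq_left (by omega)) hL) fun p hp =>
    Spec.bind ((shiftDown_spec (2 * k) p).le (d := 2 * k + 8) (by rw [hp.1]; omega)) fun u hu =>
    Spec.bind (resize_spec (k + 3) u) fun u' hu' =>
    Spec.bind (P := fun z => z.length = k + 3 ∧ toNat z = 2 * toNat v₀)
      ((shiftUp_spec 1 v₀).mono (fun z hz => ⟨by rw [hz.1, hv₀.1]; ring, by simpa using hz.2⟩)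
      (by rw [hv₀.1]; omega)) fun dbl hdbl => ?_
  have huv : toNat u = toNat v₀ * toNat v₀ * toNat d / 2 ^ (2 * k) := by
    rw [hu.2, hp.2, hsq.2]
  obtain ⟨n1, n2, n3, n4⟩ := newton_step hle hh hdn hdlt (hv₀.2.trans (by rw [hvh])) huv
  have hu'v : toNat u' = toNat u := by rw [hu'.2, Nat.mod_eq_of_lt n3]
  rcases hu' with ⟨hu', -⟩
  clear hu hp hsq huv hv₀ hvh n3 hvl
  have hk2 : 2 ^ (k + 2) = 2 * 2 ^ (k + 1) := by ring
  have hk1 : 2 ≤ 2 ^ (k + 1) := by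
    calc 2 = 2 ^ 1 := rfl
      _ ≤ _ := Nat.pow_le_pow_right (by norm_num) (by omega)
  generalize hV : 2 ^ (2 * k) / toNat d = V at *
  refine Spec.bind (subBits_spec hdbl.1 hu') fun v hv => Spec.bind (P := fun v' =>
    v'.length = k + 2 ∧ V ≤ toNat v' ∧ toNat v' ≤ V + 1) ((resize_spec (k + 2) v.1).imp
      fun v' hv' => ?_) fun v' hv' => ?_
  · have hvv := hv.2.2.1 (by omega)
    rw [hvv, Nat.mod_eq_of_lt (by omega)] at hv'
    exact ⟨hv'.1, by omega, by omega⟩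
  clear hv n1 n2 hdbl hu' hu'v
  refine Spec.bind (hM.intMul_spec (x := d) (y := v') (n := k + 2)
      (by rw [hk, hv'.1]; exact max_eq_right (by omega)) (by omega)) fun dv hdv =>
    Spec.bind ((shiftUp_spec (2 * k) [true]).le (d := 2 * k + 1) (by simp)) fun num hnum =>
    Spec.bind ((resize_spec dv.length num).le (d := 2 * k + 4) (by omega)) fun num' hnum' =>
    Spec.bind (subBits_spec (w := 2 * k + 4) (x := num') (y := dv) (by omega) (by omega))
      fun fits hfits => Spec.bind (Spec.testB fits.2) fun ok hok => ?_
  have hnumv : toNat num' = 2 ^ (2 * k) := by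
    rw [hnum'.2, hnum.2, hdv.1]
    simp only [toNat_cons, Bool.toNat_true, toNat_nil, mul_zero, add_zero, mul_one]
    exact Nat.mod_eq_of_lt (Nat.pow_lt_pow_right (by norm_num) (by omega))
  have hfit : ok = decide (toNat d * toNat v' ≤ 2 ^ (2 * k)) := by
    rw [hok, hfits.2.1, hnumv, hdv.2]
  have hle_iff : toNat d * toNat v' ≤ 2 ^ (2 * k) ↔ toNat v' ≤ V := by
    rw [← hV, Nat.le_div_iff_mul_le hdpos, mul_comm]
  refine Spec.ite (fun hc => ?_) (fun hc => ?_)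
  · rw [hfit, decide_eq_true_iff, hle_iff] at hc
    exact (Spec.pure ⟨hv'.1, le_antisymm hc hv'.2.1⟩).le (by omega)
  · rw [hfit, decide_eq_true_iff, hle_iff] at hc
    refine Spec.le (Spec.bind (resize_spec_of_lt (w := k + 2) (x := [true]) (by
      rw [show toNat [true] = 1 from rfl]; omega)) fun one hone =>
      Spec.bind (subBits_spec hv'.1 hone.1) fun v'' hv'' => Spec.pure ?_) le_rfl
    have h1 : toNat one = 1 := hone.2
    have h2 := hv''.2.2.1 (by omega)
    exact ⟨hv''.1, by omega⟩

/-- The leading `h` bits of a word without leading zeros again have none, so the induction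
hypothesis applies to them; for `k ≥ 9` they are fewer than `k`. -/
theorem recipAux_spec {lam L : ℕ} (hM : MulBound lam L) :
    ∀ {depth : ℕ} {d : Bits}, d.length ≤ depth → NoLead d → 2 * d.length + 4 ≤ L →
      Spec (recipAux depth d)
        (fun v => v.length = d.length + 2 ∧ toNat v = 2 ^ (2 * d.length) / toNat d)
        (108 * (lam * d.length)) := by
  intro depth
  induction depth with
  | zero => intro d h hd hL; exact absurd hd.length_pos (by omega)
  | succ depth ih =>
    intro d hdepth hd hL
    rw [recipAux]
    refine Spec.ite (fun h => recip_longDiv_spec hM.1 hd h) (fun h => ?_)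
    have hdn : 2 ^ d.length ≤ 2 * toNat d := hd
    obtain ⟨k, hk⟩ : ∃ k, d.length = k := ⟨_, rfl⟩
    obtain ⟨h', hh⟩ : ∃ h', k / 2 + 3 = h' := ⟨_, rfl⟩
    simp only [hk, hh] at hdn hdepth hL h ⊢
    have hle : h' ≤ k := by omega
    refine Spec.le (Spec.bind (P := fun dh => dh.length = h' ∧ NoLead dh ∧
      toNat dh = toNat d / 2 ^ (k - h')) (c := h')
      ((shiftDown_spec (k - h') d).mono (fun dh hdh => ?_) (by omega)) fun dh hdh => ?_)
      (recip_cost_le hM.1 (by omega) (by omega))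
    · have h3 : dh.length = h' := by omega
      refine ⟨h3, ?_, hdh.2⟩
      rw [NoLead, h3, hdh.2]
      have e1 : 2 ^ k = 2 ^ (h' - 1) * 2 ^ (k - h') * 2 := by
        rw [← pow_add, ← pow_succ]; congr 1; omega
      have e2 : 2 ^ h' = 2 * 2 ^ (h' - 1) := by rw [← pow_succ', Nat.sub_add_cancel (by omega)]
      have e3 : 2 ^ (h' - 1) ≤ toNat d / 2 ^ (k - h') := by
        rw [Nat.le_div_iff_mul_le (by positivity)]; omega
      omega
    · refine Spec.bind ((ih (d := dh) (by omega) hdh.2.1 (by omega)).le (by rw [hdh.1]))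
        fun vh hvh => ?_
      rw [hdh.1, hdh.2.2] at hvh
      exact recip_newton_spec hM hk hd hL hle (by omega) hvh.1 hvh.2

theorem recip_spec {lam L : ℕ} (hM : MulBound lam L) {d : Bits} (hd : NoLead d)
    (hL : 2 * d.length + 4 ≤ L) :
    Spec (recip d) (fun v => v.length = d.length + 2 ∧ toNat v = 2 ^ (2 * d.length) / toNat d)
      (108 * (lam * d.length)) :=
  recipAux_spec hM le_rfl hd hL

/-- The quotient by `d` estimated by means of the reciprocal is too small by at most one. -/
theorem quotient_estimate {k d a : ℕ} (hd : 0 < d) (ha : a < 2 ^ (2 * k)) :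
    a * (2 ^ (2 * k) / d) / 2 ^ (2 * k) * d ≤ a ∧
      a < a * (2 ^ (2 * k) / d) / 2 ^ (2 * k) * d + 2 * d := by
  set Q := 2 ^ (2 * k)
  have hQ : 0 < Q := by positivity
  set v := Q / d
  set q := a * v / Q
  have h1 : v * d ≤ Q := Nat.div_mul_le_self Q d
  have h2 : Q < v * d + d := Nat.lt_div_mul_add hd
  have h3 : q * Q ≤ a * v := Nat.div_mul_le_self _ _
  have h4 : a * v < q * Q + Q := Nat.lt_div_mul_add hQ
  constructor
  · refine Nat.le_of_mul_le_mul_right (c := Q) ?_ hQ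
    calc q * d * Q = q * Q * d := by ring
      _ ≤ a * v * d := by gcongr
      _ = a * (v * d) := by ring
      _ ≤ a * Q := by gcongr
  · refine Nat.lt_of_mul_lt_mul_right (a := Q) ?_
    calc a * Q ≤ a * (v * d + d) := by gcongr
      _ = a * v * d + a * d := by ring
      _ ≤ (q * Q + Q) * d + a * d := by gcongr
      _ < (q * Q + Q) * d + Q * d := by gcongr
      _ = _ := by ring

/-- As `a < 2 ^ k * d`, the estimated quotient fits into `k` bits. By `quotient_estimate` what
remains is below `2 * d`, so `k + 1` bits and one conditional subtraction suffice. -/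
theorem modStep_spec {lam L : ℕ} (hM : MulBound lam L) {d v r c : Bits} (hd : NoLead d)
    (hL : 2 * d.length + 4 ≤ L)
    (hv : v.length = d.length + 2 ∧ toNat v = 2 ^ (2 * d.length) / toNat d)
    (hr : IsRes d.length (toNat d) r) (hcl : c.length = d.length) :
    Spec (modStep d v r c) (fun z => IsRes d.length (toNat d) z ∧
      toNat z = (toNat c + 2 ^ d.length * toNat r) % toNat d) (11 * (lam * d.length)) := by
  have hdpos := hd.pos
  have hdlt := toNat_lt d
  have hk1 := hd.length_pos
  have hd' : toNat (d ++ [false]) = toNat d := by simp [toNat_append]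
  rw [modStep]
  set k := d.length with hk
  have hcost : 2 * k + (lam * (2 * k + 2) + (2 * k + 4 + (k + (lam * k + (6 * (2 * k) +
      (k + 1 + (6 * (k + 1) + (1 + k)))))))) ≤ 11 * (lam * k) := by
    have h7 := hM.1
    have e3 : 7 * k ≤ lam * k := Nat.mul_le_mul_right _ h7
    have e4 : lam * 1 ≤ lam * k := Nat.mul_le_mul_left _ (by omega)
    have e7 : lam * (2 * k + 2) = 2 * (lam * k) + 2 * lam := by ring
    rw [e7]
    omega
  refine Spec.le (Spec.bind ((copyBits_spec (c ++ r)).le (d := 2 * k)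
    (by have := hr.1; simp; omega)) fun a ha =>
    Spec.bind (P := fun av => 2 * k ≤ av.length ∧ av.length ≤ 4 * k + 4 ∧
      toNat av = toNat a * toNat v) (c := lam * (2 * k + 2)) ?_ fun av hav =>
    Spec.bind ((shiftDown_spec (2 * k) av).le (d := 2 * k + 4) (by omega)) fun q hq =>
    Spec.bind (resize_spec k q) fun q' hq' =>
    Spec.bind (hM.intMul_spec (x := q') (y := d) (n := k) (by omega) (by omega)) fun qd hqd =>
    Spec.bind (subBits_spec (w := 2 * k) (x := a) (y := qd) ?_ hqd.1) fun e he =>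
    Spec.bind (resize_spec (k + 1) e.1) fun e' he' =>
    Spec.bind (subBits_spec (w := k + 1) (x := e') (y := d ++ [false]) he'.1 (by simp; omega))
      fun e'' he'' => Spec.bind (Spec.testB e''.2) fun ge hge =>
      Spec.ite (fun hc => ?_) (fun hc => ?_)) hcost
  · have hal : a.length = 2 * k := by rw [ha]; have := hr.1; simp; omega
    refine ((intMul_spec a v).le (hM.2 _ (by omega))).mono (fun z hz => ?_) ?_
    · exact ⟨by omega, by omega, hz.2⟩
    · gcongr
      omega
  · rw [ha]; have := hr.1; simp; omega
  all_goals
    have hav' : toNat a = toNat c + 2 ^ k * toNat r := by rw [ha, toNat_append, hcl]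
    have halt : toNat a < 2 ^ k * toNat d := by
      have h1 := toNat_lt c
      rw [hcl] at h1
      have h2 := hr.2
      calc toNat a < 2 ^ k + 2 ^ k * toNat r := by omega
        _ = 2 ^ k * (toNat r + 1) := by ring
        _ ≤ _ := by gcongr; omega
    have halt' : toNat a < 2 ^ (2 * k) := by
      calc toNat a < 2 ^ k * toNat d := halt
        _ ≤ 2 ^ k * 2 ^ k := by gcongr
        _ = _ := by rw [← pow_add]; congr 1; omega
    obtain ⟨q1, q2⟩ := quotient_estimate hdpos halt'
    have hqv : toNat q = toNat a * (2 ^ (2 * k) / toNat d) / 2 ^ (2 * k) := by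
      rw [hq.2, hav.2.2, hv.2]
    rw [← hqv] at q1 q2
    have hqlt : toNat q < 2 ^ k := by
      refine Nat.lt_of_mul_lt_mul_right (a := toNat d) (q1.trans_lt halt)
    have hqdv : toNat qd = toNat q * toNat d := by
      rw [hqd.2, hq'.2, Nat.mod_eq_of_lt hqlt]
    have hev := he.2.2.1 (by rw [hqdv]; exact q1)
    have he'v : toNat e' = toNat a - toNat q * toNat d := by
      rw [he'.2, hev, hqdv, Nat.mod_eq_of_lt]
      rw [pow_succ]; omega
    have hmod : toNat a % toNat d = toNat e' % toNat d := by
      have : toNat a = toNat e' + toNat q * toNat d := by omega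
      rw [this, Nat.add_mul_mod_self_right]
    rw [hd'] at he''
    rw [← hav', hmod]
    rw [hge, he''.2.1, decide_eq_true_iff] at hc
  · have h1 := he''.2.2.1 hc
    refine (resize_spec_of_lt (by omega)).imp fun z hz => ⟨⟨hz.1, by omega⟩, ?_⟩
    rw [Nat.mod_eq_sub_mod hc, Nat.mod_eq_of_lt (by omega)]; omega
  · refine (resize_spec_of_lt (by omega)).imp fun z hz => ⟨⟨hz.1, by omega⟩, ?_⟩
    rw [Nat.mod_eq_of_lt (by omega)]; omega

theorem modPieces_spec {lam L : ℕ} (hM : MulBound lam L) {d v : Bits} (hd : NoLead d)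
    (hL : 2 * d.length + 4 ≤ L)
    (hv : v.length = d.length + 2 ∧ toNat v = 2 ^ (2 * d.length) / toNat d) {cs : List Bits} :
    (∀ c ∈ cs, c.length = d.length) →
    Spec (modPieces d v cs) (fun z => IsRes d.length (toNat d) z ∧
      toNat z = (pv toNat cs).eval (2 ^ d.length) % toNat d)
      (cs.length * (11 * (lam * d.length)) + d.length) := by
  induction cs with
  | nil =>
    intro _
    refine (resize_spec d.length []).mono (fun z hz => ?_) (by simp)
    have : toNat z = 0 := by simpa using hz.2
    exact ⟨⟨hz.1, by rw [this]; exact hd.pos⟩, by simp [this]⟩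
  | cons c cs ih =>
    intro hcs
    refine Spec.le (Spec.bind (ih fun c hc => hcs c (by simp [hc])) fun r hr =>
      (modStep_spec hM hd hL hv hr.1 (hcs c (by simp))).imp fun z hz => ⟨hz.1, ?_⟩)
      (by rw [List.length_cons, add_mul cs.length, one_mul]; omega)
    rw [hz.2, hr.2, pv_cons, eval_add, eval_C, eval_mul, eval_X]
    exact ((Nat.mod_modEq _ _).mul_left _).add_left _

/-- This is Horner's rule in base `2 ^ k` with `k` the length of `d`. One reciprocal is computed,
and each of the `a.length / k + 1` pieces costs `O(lam * k)`, so the cost is linear in both lengths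
even when `a` is much longer than `d`. -/
theorem modBits_spec {lam L : ℕ} (hM : MulBound lam L) {a d : Bits} (hd : NoLead d)
    (hL : 2 * d.length + 4 ≤ L) :
    Spec (modBits a d) (fun z => IsRes d.length (toNat d) z ∧ toNat z = toNat a % toNat d)
      (130 * (lam * (a.length + d.length))) := by
  have hk1 := hd.length_pos
  set count := a.length / d.length + 1 with hcount
  have hc1 : count * d.length ≤ a.length + d.length := by
    rw [hcount, add_mul, one_mul]; have := Nat.div_mul_le_self a.length d.length; omega
  have hc2 : a.length < count * d.length := by
    rw [hcount, add_mul, one_mul]; exact Nat.lt_div_mul_add hk1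
  refine Spec.le (Spec.bind (recip_spec hM hd hL) fun v hv =>
    Spec.bind (chop_spec le_rfl count a) fun cs hcs =>
    ((modPieces_spec hM hd hL hv fun c hc => (hcs.2.1 c hc).1).le
      (d := count * (11 * (lam * d.length)) + d.length) (by rw [hcs.1])).imp fun z hz =>
      ⟨hz.1, ?_⟩) ?_
  · rw [hz.2, hcs.2.2, Nat.mod_eq_of_lt (a := toNat a)]
    exact (toNat_lt a).trans_le (Nat.pow_le_pow_right (by norm_num) hc2.le)
  · have h7 := hM.1
    have e1 : 1 * (a.length + d.length) ≤ lam * (a.length + d.length) :=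
      Nat.mul_le_mul_right _ (by omega)
    have e2 : lam * (count * d.length) ≤ lam * (a.length + d.length) := Nat.mul_le_mul_left _ hc1
    have e3 : count * (11 * (lam * d.length)) = 11 * (lam * (count * d.length)) := by ring
    have e4 : lam * d.length ≤ lam * (a.length + d.length) := Nat.mul_le_mul_left _ (by omega)
    rw [e3]
    omega

/-! ## Arithmetic modulo a prime -/

theorem mulMod_spec {lam L : ℕ} (hM : MulBound lam L) {p x y : Bits} (hp : NoLead p)
    (hL : 2 * p.length + 4 ≤ L) (hx : x.length = p.length) (hy : y.length = p.length) :
    Spec (mulMod p x y) (fun z => IsRes p.length (toNat p) z ∧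
      toNat z = toNat x * toNat y % toNat p) (391 * (lam * p.length)) := by
  refine Spec.le (Spec.bind (hM.intMul_spec (x := x) (y := y) (n := p.length) (by omega) (by omega))
    fun z hz => ((modBits_spec hM hp hL).le (d := 130 * (lam * (2 * p.length + p.length)))
      (by rw [hz.1])).imp fun r hr => ⟨hr.1, by rw [hr.2, hz.2]⟩) (le_of_eq (by ring))

theorem primeField_implements {lam L : ℕ} (hM : MulBound lam L) {p : Bits} (hp : NoLead p)
    (hodd : toNat p % 2 = 1) (hL : 2 * p.length + 4 ≤ L) :
    Implements (primeField p) (IsRes p.length (toNat p)) (fun x => (toNat x : ZMod (toNat p)))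
      (12 * p.length + 7) (391 * (lam * p.length)) :=
  modRing_implements rfl hodd fun _ _ hx hy => mulMod_spec hM hp hL hx.1 hy.1

theorem powMod_spec {lam L : ℕ} (hM : MulBound lam L) {p a : Bits} (hp : NoLead p)
    (hL : 2 * p.length + 4 ≤ L) (hp1 : 1 < toNat p) (ha : a.length = p.length) (e : Bits) :
    Spec (powMod p a e) (fun z => IsRes p.length (toNat p) z ∧
      toNat z = toNat a ^ toNat e % toNat p) (e.length * (783 * (lam * p.length)) + p.length) := by
  have hplt := toNat_lt p
  induction e with
  | nil =>
    refine (resize_spec_of_lt (w := p.length) (x := [true])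
      (by rw [show toNat [true] = 1 from rfl]; omega)).mono
      (fun z hz => ?_) (by simp)
    have : toNat z = 1 := by simpa using hz.2
    exact ⟨⟨hz.1, by omega⟩, by simp [this, Nat.mod_eq_of_lt hp1]⟩
  | cons b e ih =>
    have h1 : 1 ≤ lam * p.length := Nat.mul_pos (by have := hM.1; omega) hp.length_pos
    refine Spec.le (Spec.bind ih fun h hh => Spec.bind (mulMod_spec hM hp hL hh.1.1 hh.1.1)
      fun h₂ hh₂ => Spec.bind (Spec.testB b) fun t ht =>
      Spec.ite (c := 391 * (lam * p.length)) (fun hc => ?_) (fun hc => ?_))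
      (by rw [List.length_cons, add_mul e.length, one_mul]; omega)
    · subst ht
      refine (mulMod_spec hM hp hL hh₂.1.1 ha).imp fun z hz => ⟨hz.1, ?_⟩
      rw [hz.2, hh₂.2, hh.2, hc, toNat_cons, Bool.toNat_true, add_comm, pow_succ, pow_mul',
        sq]
      exact ((Nat.mod_modEq _ _).trans ((Nat.mod_modEq _ _).mul (Nat.mod_modEq _ _))).mul_right _
    · subst ht
      rw [Bool.not_eq_true] at hc
      refine (Spec.pure ⟨hh₂.1, ?_⟩).le (by omega)
      rw [hh₂.2, hh.2, hc, toNat_cons, Bool.toNat_false, zero_add, pow_mul', sq]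
      exact (Nat.mod_modEq _ _).mul (Nat.mod_modEq _ _)

/-- This is Fermat's little theorem. The quadratic cost is harmless, as one inverse is needed per
prime and the primes have logarithmic length. -/
theorem invMod_spec {lam L : ℕ} (hM : MulBound lam L) {p a : Bits} (hp : NoLead p)
    (hL : 2 * p.length + 4 ≤ L) (hprime : (toNat p).Prime) (hodd : toNat p % 2 = 1)
    (ha : a.length = p.length) (hap : ¬ toNat p ∣ toNat a) :
    Spec (invMod p a) (fun z => IsRes p.length (toNat p) z ∧
      toNat z * toNat a % toNat p = 1) (800 * (lam * (p.length * p.length))) := by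
  have hp2 : 2 < toNat p := by have := hprime.two_le; omega
  have hplt := toNat_lt p
  have hk1 := hp.length_pos
  refine Spec.le (Spec.bind (resize_spec_of_lt (w := p.length) (x := [false, true])
    (by simp; omega)) fun two htwo => Spec.bind (subBits_spec (w := p.length) rfl htwo.1) fun e he =>
    ((powMod_spec hM hp hL (by omega) ha e.1).le (d := p.length * (783 * (lam * p.length)) + p.length)
      (by rw [he.1])).imp fun z hz => ⟨hz.1, ?_⟩) ?_
  · have h2 : toNat two = 2 := by rw [htwo.2]; rfl
    have h3 := he.2.2.1 (by omega)
    rw [hz.2, h3, h2, Nat.mod_mul_mod, ← pow_succ, show toNat p - 2 + 1 = toNat p - 1 by omega]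
    have h4 := Nat.ModEq.pow_totient ((Nat.coprime_comm).1 ((hprime.coprime_iff_not_dvd).2 hap))
    rw [Nat.totient_prime hprime] at h4
    rw [h4, Nat.mod_eq_of_lt (by omega)]
  · have h7 := hM.1
    have e1 : 1 * p.length ≤ (lam * p.length) * p.length :=
      Nat.mul_le_mul_right _ (Nat.mul_pos (by omega) hk1)
    have e2 : p.length * (783 * (lam * p.length)) = 783 * (lam * p.length * p.length) := by ring
    rw [e2, ← mul_assoc lam]
    omega

/-! ## Auxiliary facts on lists -/

theorem forall₂_imp_mem {α β : Type*} {R S : α → β → Prop} {l : List α} {r : List β}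
    (h : List.Forall₂ R l r) (hRS : ∀ a ∈ l, ∀ b, R a b → S a b) : List.Forall₂ S l r := by
  induction h with
  | nil => exact .nil
  | cons hab _ ih => exact .cons (hRS _ (by simp) _ hab) (ih fun a ha => hRS a (by simp [ha]))

theorem forall₂_zip {α β γ : Type*} {R : α → β → Prop} {S : α → γ → Prop} {l : List α}
    {r : List β} {t : List γ} (h : List.Forall₂ R l r) (h' : List.Forall₂ S l t) :
    List.Forall₂ (fun x c => R x.1 x.2 ∧ S x.1 c) (l.zip r) t := by
  induction h generalizing t with
  | nil => cases h'; exact .nil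
  | cons hab _ ih => cases h' with | cons h1 h2 => exact .cons ⟨hab, h1⟩ (ih h2)

theorem Spec.zipB_forall₂ {α β γ : Type} {f : α → β → BitM γ} {R : α → β → Prop}
    {Q : α → γ → Prop} {c : α → ℕ} {l : List α} {r : List β} (h : List.Forall₂ R l r)
    (hf : ∀ a ∈ l, ∀ b, R a b → Spec (f a b) (Q a) (c a)) :
    Spec (BitAlg.zipB f l r) (fun t => List.Forall₂ Q l t) (l.map c).sum := by
  induction h with
  | nil => rw [BitAlg.zipB.eq_def]; exact Spec.pure .nil
  | cons hab _ ih =>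
    refine Spec.le (Spec.bind (hf _ (by simp) _ hab) fun d hd =>
      Spec.bind (ih fun a ha => hf a (by simp [ha])) fun t ht =>
        Spec.pure (List.Forall₂.cons hd ht)) (by simp)

/-- The total number of bits of a list of words. -/
def totalLen (ps : List Bits) : ℕ := (ps.map List.length).sum

theorem totalLen_append (ps qs : List Bits) :
    totalLen (ps ++ qs) = totalLen ps + totalLen qs := by simp [totalLen]

theorem length_le_totalLen {p : Bits} {ps : List Bits} (h : p ∈ ps) : p.length ≤ totalLen ps :=
  List.single_le_sum (by simp) _ (List.mem_map_of_mem h)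

theorem sum_map_mul_length (k : ℕ) (ps : List Bits) :
    (ps.map fun p => k * p.length).sum = k * totalLen ps := by
  rw [totalLen, ← List.sum_map_mul_left]

/-! ## Product trees -/

/-- `T` is a product tree, of depth at most `d`, with the leaves `ps`. -/
inductive TreeOf : ProdTree → ℕ → List Bits → Prop
  | leaf (p : Bits) (d : ℕ) (hp : NoLead p) : TreeOf (.leaf p) d [p]
  | node {P : Bits} {l r : ProdTree} {d : ℕ} {ps qs : List Bits} (hl : TreeOf l d ps)
      (hr : TreeOf r d qs) (hP : NoLead P) (hv : toNat P = toNat l.value * toNat r.value) :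
      TreeOf (.node P l r) (d + 1) (ps ++ qs)

namespace TreeOf

theorem noLead_value {T : ProdTree} {d : ℕ} {ps : List Bits} (h : TreeOf T d ps) :
    NoLead T.value := by
  cases h <;> assumption

theorem leaves_eq {T : ProdTree} {d : ℕ} {ps : List Bits} (h : TreeOf T d ps) :
    T.leaves = ps.length := by
  induction h with
  | leaf => rfl
  | node _ _ _ _ h1 h2 => simp [ProdTree.leaves, h1, h2]

theorem toNat_value {T : ProdTree} {d : ℕ} {ps : List Bits} (h : TreeOf T d ps) :
    toNat T.value = (ps.map toNat).prod := by
  induction h with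
  | leaf => simp [ProdTree.value]
  | node _ _ _ hv h1 h2 =>
    rw [List.map_append, List.prod_append, ← h1, ← h2, ← hv]
    rfl

theorem dvd_value {T : ProdTree} {d : ℕ} {ps : List Bits} (h : TreeOf T d ps) {p : Bits}
    (hp : p ∈ ps) : toNat p ∣ toNat T.value := by
  rw [h.toNat_value]
  exact List.dvd_prod (List.mem_map_of_mem hp)

/-- Each product is below `2` to the sum of the lengths and has no leading zeros after `trim`.
Without trimming, the length would be governed by twice the longer factor. -/
theorem length_value_le {T : ProdTree} {d : ℕ} {ps : List Bits} (h : TreeOf T d ps) :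
    T.value.length ≤ totalLen ps := by
  induction h with
  | leaf => simp [ProdTree.value, totalLen]
  | @node P l r d ps qs _ _ hP hv h1 h2 =>
    rw [totalLen_append]
    simp only [ProdTree.value]
    have h3 : toNat P < 2 ^ (l.value.length + r.value.length) := by
      rw [hv, pow_add]
      exact Nat.mul_lt_mul'' (toNat_lt _) (toNat_lt _)
    have h4 : 2 ^ P.length < 2 ^ (l.value.length + r.value.length + 1) := by
      rw [pow_succ]
      have : 2 ^ P.length ≤ 2 * toNat P := hP
      omega
    have := (Nat.pow_lt_pow_iff_right (by norm_num : 1 < 2)).1 h4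
    omega

theorem totalLen_pos {T : ProdTree} {d : ℕ} {ps : List Bits} (h : TreeOf T d ps) :
    0 < totalLen ps := h.noLead_value.length_pos.trans_le h.length_value_le

end TreeOf

theorem prodTree_spec {lam L : ℕ} (hM : MulBound lam L) :
    ∀ {fuel d : ℕ} {ps : List Bits}, ps ≠ [] → (∀ p ∈ ps, NoLead p) → ps.length ≤ fuel →
      ps.length ≤ 2 ^ d → totalLen ps ≤ L →
      Spec (prodTree fuel ps) (fun T => TreeOf T d ps) (d * (2 * (lam * totalLen ps))) := by
  intro fuel
  induction fuel with
  | zero =>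
    intro d ps h0 _ h
    exact absurd (List.length_eq_zero_iff.1 (Nat.le_zero.1 h)) h0
  | succ fuel ih =>
    intro d ps h0 hps hfuel hd hL
    rw [prodTree]
    refine Spec.ite (fun h => ?_) (fun h => ?_)
    · match ps, h0, h with
      | [p], _, _ => exact (Spec.pure (P := fun T => TreeOf T d [p])
        (TreeOf.leaf p d (hps p (by simp)))).le (Nat.zero_le _)
    · cases d with
      | zero => exact absurd hd (by simpa using h)
      | succ d =>
        rw [pow_succ] at hd
        obtain ⟨a, ha⟩ : ∃ a, a = ps.take (ps.length / 2) := ⟨_, rfl⟩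
        obtain ⟨b, hb⟩ : ∃ b, b = ps.drop (ps.length / 2) := ⟨_, rfl⟩
        have hab : a ++ b = ps := by rw [ha, hb, List.take_append_drop]
        have hal : a.length = ps.length / 2 := by rw [ha, List.length_take]; omega
        have hbl : b.length = ps.length - ps.length / 2 := by rw [hb, List.length_drop]
        rw [← ha, ← hb]
        have hS := totalLen_append a b
        rw [hab] at hS
        have hpa : ∀ p ∈ a, NoLead p := fun p hp => hps p (by rw [← hab]; simp [hp])
        have hpb : ∀ p ∈ b, NoLead p := fun p hp => hps p (by rw [← hab]; simp [hp])
        have ha0 : a ≠ [] := by rintro rfl; simp at hal; omega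
        have hb0 : b ≠ [] := by rintro rfl; simp at hbl; omega
        refine Spec.le (Spec.bind (ih ha0 hpa (by omega) (d := d) (by omega) (by omega)) fun l hl =>
          Spec.bind (ih hb0 hpb (by omega) (d := d) (by omega) (by omega)) fun r hr =>
          Spec.bind (P := fun P => toNat P = toNat l.value * toNat r.value ∧
            P.length ≤ 2 * totalLen ps) (c := lam * totalLen ps) ?_ fun P hP =>
          Spec.bind ((trim_spec_of_pos ?_).le hP.2) fun P' hP' => Spec.pure ?_) ?_
        · have h1 := hl.length_value_le
          have h2 := hr.length_value_le
          refine (hM.intMul_spec (n := max l.value.length r.value.length) rfl (by omega)).mono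
            (fun z hz => ⟨hz.2, ?_⟩) ?_
          · omega
          · gcongr; omega
        · rw [hP.1]
          exact Nat.mul_pos hl.noLead_value.pos hr.noLead_value.pos
        · rw [← hab]
          exact .node hl hr hP'.2 (hP'.1.trans hP.1)
        · have h2 : 2 * totalLen ps ≤ lam * totalLen ps :=
            Nat.mul_le_mul_right _ (by have := hM.1; omega)
          calc _ = d * (2 * (lam * (totalLen a + totalLen b))) + lam * totalLen ps +
                2 * totalLen ps := by ring
            _ ≤ d * (2 * (lam * totalLen ps)) + lam * totalLen ps + lam * totalLen ps := by
                rw [← hS]; gcongr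
            _ = _ := by ring

/-- A node reduces its input modulo a product of at most `totalLen ps` bits and hands the result to
two subtrees. Each level thus adds at most three times the total length, which is the coefficient of
`d`. -/
theorem remTree_spec {lam L : ℕ} (hM : MulBound lam L) {T : ProdTree} {d : ℕ} {ps : List Bits}
    (hT : TreeOf T d ps) : ∀ x : Bits, 2 * totalLen ps + 4 ≤ L →
      Spec (remTree T x) (fun rs => List.Forall₂ (fun p r => IsRes p.length (toNat p) r ∧
        toNat r = toNat x % toNat p) ps rs)
        (130 * (lam * (x.length + (3 * d + 1) * totalLen ps))) := by
  induction hT with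
  | leaf p d hp =>
    intro x hL
    have hl : totalLen [p] = p.length := by simp [totalLen]
    rw [hl] at hL ⊢
    refine Spec.le (Spec.bind (modBits_spec hM hp hL) fun y hy => Spec.pure ?_) (d := _) ?_
    · exact .cons hy .nil
    · rw [add_zero]
      gcongr
      exact Nat.le_mul_of_pos_left _ (by omega)
  | @node P l r d ps qs hl hr hP hv ih1 ih2 =>
    intro x hL
    have hk := (TreeOf.node hl hr hP hv).length_value_le
    simp only [ProdTree.value] at hk
    have hS := totalLen_append ps qs
    refine Spec.le (Spec.bind (modBits_spec hM hP (by omega)) fun y hy =>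
      Spec.bind ((ih1 y (by omega)).le (d := 130 * (lam * (totalLen (ps ++ qs) +
        (3 * d + 1) * totalLen ps))) (by rw [hy.1.1]; gcongr)) fun a ha =>
      Spec.bind ((ih2 y (by omega)).le (d := 130 * (lam * (totalLen (ps ++ qs) +
        (3 * d + 1) * totalLen qs))) (by rw [hy.1.1]; gcongr)) fun b hb => Spec.pure ?_) ?_
    · have key : ∀ p, toNat p ∣ toNat P → toNat y % toNat p = toNat x % toNat p := by
        intro p hp
        rw [hy.2, Nat.mod_mod_of_dvd _ hp]
      refine List.rel_append (forall₂_imp_mem ha fun p hp z hz => ⟨hz.1, ?_⟩)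
        (forall₂_imp_mem hb fun p hp z hz => ⟨hz.1, ?_⟩)
      · rw [hz.2, key p (by rw [hv]; exact (hr.dvd_value hp).mul_left _)]
      · rw [hz.2, key p (by rw [hv]; exact (hl.dvd_value hp).mul_right _)]
    · calc _ ≤ 130 * (lam * (x.length + totalLen (ps ++ qs))) + (130 * (lam * (totalLen (ps ++ qs) +
            (3 * d + 1) * totalLen ps)) + (130 * (lam * (totalLen (ps ++ qs) +
            (3 * d + 1) * totalLen qs)) + 0)) := by gcongr
        _ = _ := by rw [hS]; ring

/-- At a node with values `Λ` on the left and `Ρ` on the right the result is `a * Ρ + b * Λ`. Modulo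
a prime `p` of the left half `Λ` vanishes and `P / p = (Λ / p) * Ρ`; the other half is symmetric. -/
theorem combine_spec {lam L : ℕ} (hM : MulBound lam L) {T : ProdTree} {d : ℕ} {ps : List Bits}
    (hT : TreeOf T d ps) : ∀ {cs : List Bits}, totalLen ps ≤ L →
      List.Forall₂ (fun p c => toNat c < toNat p) ps cs →
      Spec (combine T cs) (fun z => IsRes T.value.length (toNat T.value) z ∧
        List.Forall₂ (fun p c => toNat z ≡ toNat c * (toNat T.value / toNat p) [MOD toNat p]) ps cs)
        (d * (5 * (lam * totalLen ps)) + totalLen ps) := by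
  induction hT with
  | leaf p d hp =>
    intro cs hL hcs
    obtain ⟨c, t, hc, ht, rfl⟩ := List.forall₂_cons_left_iff.1 hcs
    cases ht
    have hl : totalLen [p] = p.length := by simp [totalLen]
    rw [hl, combine]
    refine (resize_spec_of_lt (w := p.length) (x := c) (hc.trans (toNat_lt p))).mono
      (fun z hz => ?_) (by omega)
    refine ⟨⟨hz.1, by rw [hz.2]; exact hc⟩, .cons ?_ .nil⟩
    rw [hz.2, ProdTree.value, Nat.div_self hp.pos, mul_one]
  | @node P l r d ps qs hl hr hP hv ih1 ih2 =>
    intro cs hL hcs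
    have hk := (TreeOf.node hl hr hP hv).length_value_le
    simp only [ProdTree.value] at hk
    have hS := totalLen_append ps qs
    have hlL := hl.length_value_le
    have hrL := hr.length_value_le
    have hc1 := List.forall₂_take l.leaves hcs
    have hc2 := List.forall₂_drop l.leaves hcs
    rw [List.take_left' hl.leaves_eq.symm] at hc1
    rw [List.drop_left' hl.leaves_eq.symm] at hc2
    have hPlt := toNat_lt P
    refine Spec.le (Spec.bind (ih1 (by omega) hc1) fun a ha =>
      Spec.bind (ih2 (by omega) hc2) fun b hb =>
      Spec.bind ((hM.intMul_spec (x := a) (y := r.value) rfl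
        (by rw [ha.1.1]; omega)).le (d := lam * totalLen (ps ++ qs))
          (by rw [ha.1.1]; gcongr; omega)) fun u hu =>
      Spec.bind ((hM.intMul_spec (x := b) (y := l.value) rfl
        (by rw [hb.1.1]; omega)).le (d := lam * totalLen (ps ++ qs))
          (by rw [hb.1.1]; gcongr; omega)) fun v hv =>
      Spec.bind ((resize_spec P.length u).le (d := totalLen (ps ++ qs)) hk) fun u' hu' =>
      Spec.bind ((resize_spec P.length v).le (d := totalLen (ps ++ qs)) hk) fun v' hv' => ?_)
      (c := d * (5 * (lam * totalLen ps)) + totalLen ps + (d * (5 * (lam * totalLen qs)) +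
        totalLen qs + (lam * totalLen (ps ++ qs) + (lam * totalLen (ps ++ qs) +
        (totalLen (ps ++ qs) + (totalLen (ps ++ qs) + (12 * totalLen (ps ++ qs) + 7))))))) ?_
    · have hult : toNat a * toNat r.value < toNat P := by
        rw [‹toNat P = _›]
        exact Nat.mul_lt_mul_of_pos_right ha.1.2 hr.noLead_value.pos
      have hvlt : toNat b * toNat l.value < toNat P := by
        rw [‹toNat P = _›, mul_comm (toNat l.value)]
        exact Nat.mul_lt_mul_of_pos_right hb.1.2 hl.noLead_value.pos
      have hu'v : toNat u' = toNat a * toNat r.value := by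
        rw [hu'.2, hu.2, Nat.mod_eq_of_lt (hult.trans hPlt)]
      have hv'v : toNat v' = toNat b * toNat l.value := by
        rw [hv'.2, hv.2, Nat.mod_eq_of_lt (hvlt.trans hPlt)]
      refine (addMod_spec rfl hu'.1 hv'.1 (by omega)).mono (fun z hz => ⟨hz.1, ?_⟩) (by omega)
      have hzP : toNat z ≡ toNat a * toNat r.value + toNat b * toNat l.value [MOD toNat P] := by
        rw [hz.2, hu'v, hv'v]; exact Nat.mod_modEq _ _
      have hcs' : cs = cs.take l.leaves ++ cs.drop l.leaves := (List.take_append_drop _ _).symm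
      rw [hcs']
      refine List.rel_append (forall₂_imp_mem ha.2 fun p hp c hc => ?_)
        (forall₂_imp_mem hb.2 fun p hp c hc => ?_)
      · have hpl := hl.dvd_value hp
        have hpP : toNat p ∣ toNat P := by rw [‹toNat P = _›]; exact hpl.mul_right _
        simp only [ProdTree.value]
        rw [‹toNat P = _›, Nat.mul_div_right_comm hpl, ← mul_assoc]
        calc toNat z ≡ toNat a * toNat r.value + toNat b * toNat l.value [MOD toNat p] :=
              hzP.of_dvd hpP
          _ ≡ toNat a * toNat r.value + 0 [MOD toNat p] :=
              Nat.ModEq.add_left _ ((Nat.modEq_zero_iff_dvd).2 (hpl.mul_left _))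
          _ ≡ _ [MOD toNat p] := by rw [add_zero]; exact hc.mul_right _
      · have hpl := hr.dvd_value hp
        have hpP : toNat p ∣ toNat P := by rw [‹toNat P = _›]; exact hpl.mul_left _
        simp only [ProdTree.value]
        rw [‹toNat P = _›, mul_comm (toNat l.value), Nat.mul_div_right_comm hpl, ← mul_assoc]
        calc toNat z ≡ toNat a * toNat r.value + toNat b * toNat l.value [MOD toNat p] :=
              hzP.of_dvd hpP
          _ ≡ 0 + toNat b * toNat l.value [MOD toNat p] :=
              Nat.ModEq.add_right _ ((Nat.modEq_zero_iff_dvd).2 (hpl.mul_left _))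
          _ ≡ _ [MOD toNat p] := by rw [zero_add]; exact hc.mul_right _
    · have hpos := (TreeOf.node hl hr hP ‹_›).totalLen_pos
      -- Besides two multiplications a node costs `2 S + 12 S + 7 ≤ 21 S` for `S` the total length,
      -- which is at most `3 * lam * S` because `7 ≤ lam`; hence the 5 in the bound.
      have h7 : 7 * totalLen (ps ++ qs) ≤ lam * totalLen (ps ++ qs) :=
        Nat.mul_le_mul_right _ hM.1
      have h8 : d * (5 * (lam * totalLen ps)) + d * (5 * (lam * totalLen qs)) =
          d * (5 * (lam * totalLen (ps ++ qs))) := by rw [hS]; ring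
      have h9 : (d + 1) * (5 * (lam * totalLen (ps ++ qs))) =
          d * (5 * (lam * totalLen (ps ++ qs))) + 5 * (lam * totalLen (ps ++ qs)) := by ring
      rw [h9, ← h8]
      omega

/-! ## Chinese remaindering -/

theorem forall₂_exists_right {α β : Type*} {R : α → β → Prop} {l : List α} {r : List β}
    (h : List.Forall₂ R l r) {a : α} (ha : a ∈ l) : ∃ b ∈ r, R a b := by
  induction h with
  | nil => simp at ha
  | cons hab _ ih =>
    rcases List.mem_cons.1 ha with rfl | ha
    · exact ⟨_, by simp, hab⟩
    · obtain ⟨b, hb, hR⟩ := ih ha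
      exact ⟨b, by simp [hb], hR⟩

theorem forall₂_and {α β : Type*} {R S : α → β → Prop} {l : List α} {r : List β}
    (h : List.Forall₂ R l r) (h' : List.Forall₂ S l r) :
    List.Forall₂ (fun a b => R a b ∧ S a b) l r := by
  induction h with
  | nil => exact .nil
  | cons hab _ ih => cases h' with | cons h1 h2 => exact .cons ⟨hab, h1⟩ (ih h2)

/-- The words are distinct odd primes without leading zeros. -/
structure GoodPrimes (ps : List Bits) : Prop where
  noLead : ∀ p ∈ ps, NoLead p
  prime : ∀ p ∈ ps, (toNat p).Prime
  odd : ∀ p ∈ ps, toNat p % 2 = 1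
  nodup : (ps.map toNat).Nodup

theorem not_dvd_prod_div {l : List ℕ} (hl : ∀ p ∈ l, p.Prime) (hnd : l.Nodup) {p : ℕ}
    (hp : p ∈ l) : ¬ p ∣ l.prod / p := by
  have hpp := hl p hp
  rw [← List.prod_erase hp, Nat.mul_div_cancel_left _ hpp.pos, hpp.prime.dvd_prod_iff]
  rintro ⟨q, hq, hpq⟩
  have hq' := List.mem_of_mem_erase hq
  rw [(Nat.prime_dvd_prime_iff_eq hpp (hl q hq')).1 hpq] at hq
  have := hnd.mem_erase_iff.1 hq
  exact this.1 rfl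

/-- Combining ones gives the sum of all `P / q`, whose residue at `p` is `P / p`, since `p` divides
the other summands. One remainder tree thus finds all these residues, and they are invertible
because the primes are distinct. -/
theorem crtInverses_spec {lam L : ℕ} (hM : MulBound lam L) {T : ProdTree} {d W : ℕ}
    {ps : List Bits} (hT : TreeOf T d ps) (hps : GoodPrimes ps) (hL : 2 * totalLen ps + 4 ≤ L)
    (hW : ∀ p ∈ ps, p.length ≤ W) :
    Spec (crtInverses T ps) (fun is => List.Forall₂ (fun p i => IsRes p.length (toNat p) i ∧
      toNat i * (toNat T.value / toNat p) % toNat p = 1) ps is)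
      (1000 * (lam * (totalLen ps * (d + 1 + W)))) := by
  have h7 := hM.1
  have hPl := hT.length_value_le
  refine Spec.le (Spec.bind (P := fun os => List.Forall₂ (fun p o => toNat o < toNat p) ps os ∧
      ∀ o ∈ os, toNat o = 1) (c := totalLen ps) ?_ fun os hos =>
    Spec.bind (combine_spec hM hT (by omega) hos.1) fun D hD =>
    Spec.bind ((remTree_spec hM hT D hL).le (d := 130 * (lam * (totalLen ps + (3 * d + 1) *
      totalLen ps))) (by rw [hD.1.1]; gcongr)) fun rs hrs =>
    Spec.zipB_forall₂ (c := fun p => 800 * (lam * (p.length * p.length))) hrs fun p hp r hr => ?_) ?_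
  · refine (Spec.mapB (c := fun p => p.length) (P := fun p o => toNat o = 1 ∧ toNat o < toNat p)
      (l := ps) fun p hp => ?_).imp
      fun os hos => ⟨hos.imp fun _ _ h => h.2, fun o ho => ?_⟩
    · have h2 := (hps.prime p hp).two_le
      have h3 := toNat_lt p
      refine (resize_spec_of_lt (w := p.length) (x := [true])
        (by rw [show toNat [true] = 1 from rfl]; omega)).imp fun z hz => ?_
      have : toNat z = 1 := hz.2
      exact ⟨this, by omega⟩
    · obtain ⟨p, _, h⟩ := forall₂_exists_right hos.flip ho
      exact h.1
  · have hz : toNat D ≡ toNat T.value / toNat p [MOD toNat p] := by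
      obtain ⟨o, ho, h⟩ := forall₂_exists_right hD.2 hp
      rwa [hos.2 o ho, one_mul] at h
    have hr2 : toNat r ≡ toNat T.value / toNat p [MOD toNat p] := by
      rw [hr.2]; exact (Nat.mod_modEq _ _).trans hz
    have hnd : ¬ toNat p ∣ toNat T.value / toNat p := by
      rw [hT.toNat_value]
      refine not_dvd_prod_div (fun q hq => ?_) hps.nodup (List.mem_map_of_mem hp)
      obtain ⟨q', hq', rfl⟩ := List.mem_map.1 hq
      exact hps.prime q' hq'
    refine (invMod_spec hM (hps.noLead p hp) (by have := length_le_totalLen hp; omega)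
      (hps.prime p hp) (hps.odd p hp) hr.1.1 ?_).imp fun i hi => ⟨hi.1, ?_⟩
    · rwa [(hr2.dvd_iff dvd_rfl)]
    · rw [← hi.2]
      exact (hr2.symm.mul_left _)
  · have e1 : (ps.map fun p => 800 * (lam * (p.length * p.length))).sum ≤
        800 * (lam * W) * totalLen ps := by
      rw [← sum_map_mul_length]
      refine List.sum_le_sum fun p hp => ?_
      calc 800 * (lam * (p.length * p.length)) ≤ 800 * (lam * (W * p.length)) := by
            gcongr; exact hW p hp
        _ = _ := by ring
    have e2 : totalLen ps ≤ lam * totalLen ps := Nat.le_mul_of_pos_left _ (by omega)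
    calc _ ≤ lam * totalLen ps + (d * (5 * (lam * totalLen ps)) + lam * totalLen ps +
          (130 * (lam * (totalLen ps + (3 * d + 1) * totalLen ps)) +
          800 * (lam * W) * totalLen ps)) := by gcongr
      _ = lam * totalLen ps * (262 + 395 * d + 800 * W) := by ring
      _ ≤ lam * totalLen ps * (1000 * (d + 1 + W)) := by gcongr; omega
      _ = _ := by ring

/-- The combined value is congruent to `x` modulo each prime, hence modulo their product, and both
numbers are below it. -/
theorem crt_spec {lam L : ℕ} (hM : MulBound lam L) {T : ProdTree} {d : ℕ}
    {ps is rs : List Bits} (hT : TreeOf T d ps) (hps : GoodPrimes ps)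
    (hL : 2 * totalLen ps + 4 ≤ L)
    (his : List.Forall₂ (fun p i => IsRes p.length (toNat p) i ∧
      toNat i * (toNat T.value / toNat p) % toNat p = 1) ps is) {x : ℕ} (hx : x < toNat T.value)
    (hrs : List.Forall₂ (fun p r => IsRes p.length (toNat p) r ∧ toNat r = x % toNat p) ps rs) :
    Spec (crt T ps is rs) (fun z => z.length = T.value.length ∧ toNat z = x)
      (400 * (lam * (totalLen ps * (d + 1)))) := by
  have h7 := hM.1
  have hlen := his.length_eq
  have hfst : (ps.zip is).map Prod.fst = ps := List.map_fst_zip (by omega)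
  have hsum : ((ps.zip is).map fun q => 391 * lam * q.1.length).sum = 391 * lam * totalLen ps := by
    rw [← sum_map_mul_length]
    conv_rhs => rw [← hfst]
    rw [List.map_map]
    rfl
  refine Spec.le (Spec.bind (P := fun cs => List.Forall₂ (fun p c => toNat c < toNat p ∧
      toNat c * (toNat T.value / toNat p) ≡ x [MOD toNat p]) ps cs) (c := 391 * lam * totalLen ps)
      ?_ fun cs hcs => (combine_spec hM hT (by omega) (hcs.imp fun _ _ h => h.1)).imp
      fun z hz => ⟨hz.1.1, ?_⟩) ?_
  · rw [← hsum]
    refine (Spec.zipB_forall₂ (Q := fun (q : Bits × Bits) c => toNat c < toNat q.1 ∧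
      toNat c * (toNat T.value / toNat q.1) ≡ x [MOD toNat q.1]) (forall₂_zip his hrs)
      fun q hq r hr => ?_).imp fun cs hcs => ?_
    · have hp : q.1 ∈ ps := (List.of_mem_zip hq).1
      refine (mulMod_spec hM (hps.noLead _ hp) (by have := length_le_totalLen hp; omega)
        hr.1.1.1 hr.2.1.1).mono (fun z hz => ⟨hz.1.2, ?_⟩) (le_of_eq (by ring))
      have h1 : toNat q.2 * (toNat T.value / toNat q.1) ≡ 1 [MOD toNat q.1] := by
        have h2 := (hps.prime _ hp).one_lt
        rw [Nat.ModEq, hr.1.2, Nat.mod_eq_of_lt h2]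
      rw [hz.2, hr.2.2]
      calc toNat q.2 * (x % toNat q.1) % toNat q.1 * (toNat T.value / toNat q.1)
          ≡ toNat q.2 * x * (toNat T.value / toNat q.1) [MOD toNat q.1] :=
            ((Nat.mod_modEq _ _).trans ((Nat.mod_modEq _ _).mul_left _)).mul_right _
        _ = toNat q.2 * (toNat T.value / toNat q.1) * x := by ring
        _ ≡ 1 * x [MOD toNat q.1] := h1.mul_right _
        _ = x := one_mul _
    · conv => arg 2; rw [← hfst]
      rw [List.forall₂_map_left_iff]
      exact hcs
  · have hco : (ps.map toNat).Pairwise Nat.Coprime := by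
      have := hps.nodup
      rw [List.Nodup, List.pairwise_map] at this
      rw [List.pairwise_map]
      refine this.imp_of_mem fun ha hb hab => ?_
      exact (Nat.coprime_primes (hps.prime _ ha) (hps.prime _ hb)).2 hab
    have hmod : toNat z ≡ x [MOD (ps.map toNat).prod] := by
      rw [Nat.modEq_list_prod_iff hco]
      intro i
      have hi := List.get_mem (ps.map toNat) i
      obtain ⟨p, hp, hpi⟩ := List.mem_map.1 hi
      rw [← hpi]
      obtain ⟨c, -, hc⟩ := forall₂_exists_right (forall₂_and hz.2 hcs) hp
      exact hc.1.trans hc.2.2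
    rw [← hT.toNat_value] at hmod
    have := hmod
    rwa [Nat.ModEq, Nat.mod_eq_of_lt hz.1.2, Nat.mod_eq_of_lt hx] at this
  · have e2 : totalLen ps ≤ lam * totalLen ps := Nat.le_mul_of_pos_left _ (by omega)
    calc _ ≤ 391 * lam * totalLen ps + (d * (5 * (lam * totalLen ps)) + lam * totalLen ps) := by
          gcongr
      _ = lam * totalLen ps * (392 + 5 * d) := by ring
      _ ≤ lam * totalLen ps * (400 * (d + 1)) := by gcongr; omega
      _ = _ := by ring

/-! ## The stages of the multiplication -/

theorem toNat_flatten {s : ℕ} {l : Poly} (h : ∀ c ∈ l, c.length = s) :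
    toNat l.flatten = (pv toNat l).eval (2 ^ s) := by
  induction l with
  | nil => simp
  | cons c l ih =>
    rw [List.flatten_cons, toNat_append, ih fun c hc => h c (by simp [hc]), h c (by simp)]
    simp

theorem length_flatten {s : ℕ} {l : Poly} (h : ∀ c ∈ l, c.length = s) :
    l.flatten.length = l.length * s := by
  induction l with
  | nil => simp
  | cons c l ih =>
    rw [List.flatten_cons, List.length_append, ih fun c hc => h c (by simp [hc]), h c (by simp),
      List.length_cons]
    ring

/-- The bivariate `Q` is the link of the Kronecker substitution: outer variable at `X ^ B` it is the
original polynomial, inner variable at `2 ^ s` it is the bundled one. -/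
theorem bundle_spec {B s : ℕ} : ∀ {count : ℕ} {f : Poly},
    OkV (fun c : Bits => c.length = s) (count * B) f →
    Spec (bundle B count f) (fun F => OkV (fun c : Bits => c.length = B * s) count F ∧
      ∃ Q : ℕ[X][X], Q.map (evalRingHom (2 ^ s)) = pv toNat F ∧ Q.eval (X ^ B) = pv toNat f ∧
        ∀ i j, B ≤ j → (Q.coeff i).coeff j = 0) (count * (B * s))
  | 0, f, hf => by
    have := OkV.eq_nil (by simpa using hf)
    subst this
    exact Spec.le (Spec.pure ⟨OkV.nil, 0, by simp, by simp, by simp⟩) (by simp)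
  | count + 1, f, hf => by
    rw [Nat.succ_mul] at hf
    have h1 := hf.take (m := B) (by omega)
    have h2 := hf.drop B
    rw [show count * B + B - B = count * B by omega] at h2
    refine Spec.le (Spec.bind ((copyBits_spec (f.take B).flatten).le (d := B * s)
      (by rw [length_flatten h1.2, h1.1])) fun c hc => Spec.bind (bundle_spec h2) fun F hF =>
        Spec.pure ?_) (by rw [Nat.succ_mul]; omega)
    subst hc
    obtain ⟨hF, Q, hQ1, hQ2, hQ3⟩ := hF
    refine ⟨hF.cons (by rw [length_flatten h1.2, h1.1]), C (pv toNat (f.take B)) + X * Q, ?_, ?_, ?_⟩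
    · simp [hQ1, toNat_flatten h1.2]
    · conv_rhs => rw [← List.take_append_drop B f]
      rw [pv_append, h1.1]
      simp [hQ2]
    · intro i j hj
      cases i with
      | zero =>
        simp only [coeff_add, coeff_C_zero, mul_coeff_zero, coeff_X_zero, zero_mul, add_zero]
        rw [pv_coeff, List.getElem?_eq_none (by rw [h1.1]; exact hj)]; rfl
      | succ i => simpa [coeff_C] using hQ3 i j hj

theorem forall₂_eq_map {α β : Type*} {g : α → β} {l : List α} {r : List β}
    (h : List.Forall₂ (fun a b => b = g a) l r) : r = l.map g := by
  induction h with
  | nil => rfl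
  | cons hab _ ih => simp [hab, ih]

/-- The columns of a matrix that is given by its rows. -/
def cols (n : ℕ) (rows : List (List Bits)) : List (List Bits) :=
  (List.range n).map fun i => rows.map fun row => row.getD i []

theorem columns_spec (n : ℕ) (rows : List (List Bits)) :
    Spec (columns n rows) (fun t => t = cols n rows)
      ((List.range n).map fun i => (rows.map fun row => (row.getD i []).length).sum).sum :=
  (Spec.mapB fun _ _ => (Spec.mapB fun row _ => copyBits_spec (row.getD _ [])).imp
    fun _ h => forall₂_eq_map h).imp fun _ h => forall₂_eq_map h

/-- Transposition: a relation known row by row, along a common list of labels, is read off column by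
column. -/
theorem forall₂_cols {α β : Type} {R : α → β → Bits → Prop} {F : List α} {ps : List β}
    {rows : List (List Bits)} (h : List.Forall₂ (fun x row => List.Forall₂ (R x) ps row) F rows) :
    List.Forall₂ (fun p col => List.Forall₂ (fun x e => R x p e) F col) ps (cols ps.length rows) := by
  rw [List.forall₂_iff_get]
  refine ⟨by simp [cols], fun i h1 h2 => ?_⟩
  rw [List.forall₂_iff_get] at h ⊢
  refine ⟨by simpa [cols] using h.1, fun j h3 h4 => ?_⟩
  have h5 : j < rows.length := by rw [← h.1]; exact h3
  have h6 := h.2 j h3 h5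
  rw [List.forall₂_iff_get] at h6
  have h7 : i < (rows.get ⟨j, h5⟩).length := by rw [← h6.1]; exact h1
  have h8 := h6.2 i h1 h7
  have h9 : i < rows[j].length := h7
  simpa [cols, List.getElem?_eq_getElem h9] using h8

theorem map_getD_range (ps : List Bits) :
    (List.range ps.length).map (fun i => ps.getD i []) = ps := by
  refine List.ext_getElem (by simp) fun i h1 h2 => ?_
  simp [List.getElem?_eq_getElem h2]

theorem getD_length_eq {ps row : List Bits} (h : List.Forall₂ (fun p r => r.length = p.length) ps row)
    (i : ℕ) : (row.getD i []).length = (ps.getD i []).length := by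
  induction h generalizing i with
  | nil => rfl
  | cons hab _ ih => cases i <;> simp_all

/-- The residues of the words of `F` modulo all the primes. -/
theorem reduceAll_spec {lam L : ℕ} (hM : MulBound lam L) {T : ProdTree} {d l n : ℕ}
    {ps : List Bits} (hT : TreeOf T d ps) (hL : 2 * totalLen ps + 4 ≤ L) {F : Poly}
    (hF : OkV (fun c : Bits => c.length = l) n F) :
    Spec (reduceAll T ps.length F) (fun Fs => List.Forall₂ (fun p col =>
      OkV (IsRes p.length (toNat p)) n col ∧
        pv (fun x => (toNat x : ZMod (toNat p))) col = pv (fun x => (toNat x : ZMod (toNat p))) F) ps Fs)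
      (n * (130 * (lam * (l + (3 * d + 1) * totalLen ps)) + totalLen ps)) := by
  refine Spec.le (Spec.bind ((Spec.mapB_const (l := F) (c := 130 * (lam * (l + (3 * d + 1) *
    totalLen ps))) fun x hx => (remTree_spec hM hT x hL).le (by rw [hF.2 x hx])))
    fun rows hrows => ((columns_spec ps.length rows).le (d := n * totalLen ps) ?_).imp
      fun t ht => ?_) (by rw [hF.1]; exact le_of_eq (by ring))
  · have hlen : rows.length = n := by rw [← hrows.length_eq, hF.1]
    have h1 : ∀ row ∈ rows, ∀ i, (row.getD i []).length = (ps.getD i []).length := by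
      intro row hrow i
      obtain ⟨x, _, hx⟩ := forall₂_exists_right hrows.flip hrow
      exact getD_length_eq (hx.imp fun _ _ h => h.1.1) i
    have h2 : ∀ i, (rows.map fun row => (row.getD i []).length).sum = n * (ps.getD i []).length := by
      intro i
      rw [List.map_congr_left fun row hrow => h1 row hrow i, List.map_const', List.sum_replicate,
        hlen, smul_eq_mul]
    simp only [h2]
    rw [List.sum_map_mul_left]
    refine Nat.mul_le_mul_left _ (le_of_eq ?_)
    conv_rhs => rw [totalLen, ← map_getD_range ps, List.map_map]
    rfl
  · subst ht
    refine (forall₂_cols (R := fun (x : Bits) (p r : Bits) => IsRes p.length (toNat p) r ∧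
      toNat r = toNat x % toNat p) hrows).imp fun p col h => ⟨⟨?_, ?_⟩, ?_⟩
    · rw [← h.length_eq, hF.1]
    · intro e he
      obtain ⟨x, _, hx⟩ := forall₂_exists_right h.flip he
      exact hx.1
    · clear hF hrows
      induction h with
      | nil => rfl
      | cons hab _ ih => simp [ih, hab.2]

theorem mulAll_spec {lam L n : ℕ} (hM : MulBound lam L) (hn : 0 < n) {F G : Poly} {ps : List Bits}
    (hps : ∀ p ∈ ps, NoLead p ∧ toNat p % 2 = 1 ∧ 2 * p.length + 4 ≤ L) :
    ∀ {Fs Gs : List Poly},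
    List.Forall₂ (fun p col => OkV (IsRes p.length (toNat p)) n col ∧
        pv (fun x => (toNat x : ZMod (toNat p))) col =
          pv (fun x => (toNat x : ZMod (toNat p))) F) ps Fs →
    List.Forall₂ (fun p col => OkV (IsRes p.length (toNat p)) n col ∧
        pv (fun x => (toNat x : ZMod (toNat p))) col =
          pv (fun x => (toNat x : ZMod (toNat p))) G) ps Gs →
    Spec (mulAll n ps Fs Gs) (fun Hs => List.Forall₂ (fun p h =>
      OkV (IsRes p.length (toNat p)) (2 * n - 1) h ∧ pv (fun x => (toNat x : ZMod (toNat p))) h =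
        pv (fun x => (toNat x : ZMod (toNat p))) F * pv (fun x => (toNat x : ZMod (toNat p))) G) ps Hs)
      (8 * n * Nat.clog 2 (2 * n) *
        (1564 * lam + 19 * (21 * Nat.size (Nat.clog 2 (2 * n)) + 18)) * totalLen ps) := by
  induction ps with
  | nil =>
    intro Fs Gs hF hG
    rw [mulAll.eq_def]
    exact (Spec.pure .nil).le (by simp)
  | cons p ps ih =>
    intro Fs Gs hF hG
    obtain ⟨f, Fs, hf, hF', rfl⟩ := List.forall₂_cons_left_iff.1 hF
    obtain ⟨g, Gs, hg, hG', rfl⟩ := List.forall₂_cons_left_iff.1 hG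
    obtain ⟨h1, h2, h3⟩ := hps p (by simp)
    refine Spec.le (Spec.bind ((primeField_implements hM h1 h2 h3).polyMul_spec hn hf.1 hg.1)
      fun h hh => Spec.bind (ih (fun q hq => hps q (by simp [hq])) hF' hG') fun r hr =>
      Spec.pure (.cons ⟨hh.1, by rw [hh.2, hf.2, hg.2]⟩ hr)) ?_
    have hp1 := h1.length_pos
    have hS : totalLen (p :: ps) = p.length + totalLen ps := by simp [totalLen]
    rw [hS, add_zero, mul_add (8 * n * Nat.clog 2 (2 * n) * (1564 * lam + 19 *
      (21 * Nat.size (Nat.clog 2 (2 * n)) + 18))) p.length (totalLen ps)]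
    refine Nat.add_le_add_right ?_ _
    calc 8 * n * Nat.clog 2 (2 * n) * (4 * (391 * (lam * p.length)) +
          (12 * p.length + 7) * (21 * Nat.size (Nat.clog 2 (2 * n)) + 18))
        ≤ 8 * n * Nat.clog 2 (2 * n) * (4 * (391 * (lam * p.length)) +
          (19 * p.length) * (21 * Nat.size (Nat.clog 2 (2 * n)) + 18)) := by gcongr; omega
      _ = _ := by ring

theorem reconstruct_spec {lam L : ℕ} (hM : MulBound lam L) {T : ProdTree} {d W n : ℕ}
    {ps : List Bits} (hT : TreeOf T d ps) (hps : GoodPrimes ps) (hL : 2 * totalLen ps + 4 ≤ L)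
    (hW : ∀ p ∈ ps, p.length ≤ W) {P : ℕ[X]} (hP : ∀ i, P.coeff i < toNat T.value) {Hs : List Poly}
    (hHs : List.Forall₂ (fun p h => OkV (IsRes p.length (toNat p)) (2 * n - 1) h ∧
      pv (fun x => (toNat x : ZMod (toNat p))) h = P.map (Nat.castRingHom _)) ps Hs) :
    Spec (reconstruct T ps n Hs) (fun H => List.Forall₂ (fun m z => toNat z = P.coeff m)
      (List.range (2 * n - 1)) H)
      (1000 * (lam * (totalLen ps * (d + 1 + W))) + ((2 * n - 1) * totalLen ps +
        (2 * n - 1) * (400 * (lam * (totalLen ps * (d + 1)))))) := by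
  -- Each word is the reduced representative of a coefficient of `P`, so equality in `ZMod` is
  -- equality of remainders.
  have hHs' : List.Forall₂ (fun p h => List.Forall₂ (fun m e => IsRes p.length (toNat p) e ∧
      toNat e = P.coeff m % toNat p) (List.range (2 * n - 1)) h) ps Hs := by
    refine hHs.imp fun p h hh => ?_
    rw [List.forall₂_iff_get]
    refine ⟨by simp [hh.1.1], fun i h1 h2 => ?_⟩
    have h3 := hh.1.2 _ (List.get_mem h ⟨i, h2⟩)
    refine ⟨h3, ?_⟩
    have h4 := congrArg (fun q => coeff q i) hh.2
    simp only [pv_coeff, coeff_map, List.getElem?_eq_getElem h2, Option.elim,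
      Nat.coe_castRingHom, ZMod.natCast_eq_natCast_iff'] at h4
    have h5 : (List.range (2 * n - 1)).get ⟨i, h1⟩ = i := by simp
    rw [h5, ← h4, Nat.mod_eq_of_lt]
    · rfl
    · exact h3.2
  have hcols := forall₂_cols (R := fun (p : Bits) (m : ℕ) (e : Bits) => IsRes p.length (toNat p) e ∧
      toNat e = P.coeff m % toNat p) hHs'
  rw [List.length_range] at hcols
  refine Spec.bind (crtInverses_spec hM hT hps hL hW) fun is his => Spec.bind
    ((columns_spec (2 * n - 1) Hs).le ?_) fun rows hrows => ?_
  · have h1 : ∀ i ∈ List.range (2 * n - 1),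
        (Hs.map fun row => (row.getD i []).length).sum ≤ totalLen ps := by
      intro i hi
      rw [List.mem_range] at hi
      have h2 : ∀ {ps' : List Bits} {Hs' : List Poly}, List.Forall₂ (fun p h =>
          OkV (IsRes p.length (toNat p)) (2 * n - 1) h) ps' Hs' →
          (Hs'.map fun row => (row.getD i []).length).sum = totalLen ps' := by
        intro ps' Hs' h
        induction h with
        | nil => rfl
        | @cons p row _ _ hab _ ih =>
          have h3 : i < row.length := by rw [hab.1]; exact hi
          have h4 := (hab.2 _ (List.getElem_mem h3)).1
          have h5 : row.getD i [] = row[i] := List.getD_eq_getElem _ _ h3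
          simp only [List.map_cons, List.sum_cons, ih, totalLen]
          rw [h5, h4]
      exact (h2 (hHs.imp fun _ _ h => h.1)).le
    calc _ ≤ ((List.range (2 * n - 1)).map fun _ => totalLen ps).sum := List.sum_le_sum h1
      _ = _ := by simp
  · subst hrows
    have hmap : ∀ {ms : List ℕ} {rows : List (List Bits)}, List.Forall₂ (fun m row =>
        List.Forall₂ (fun p e => IsRes p.length (toNat p) e ∧ toNat e = P.coeff m % toNat p)
          ps row) ms rows →
        Spec (mapB (crt T ps is) rows) (fun H => List.Forall₂ (fun m z => toNat z = P.coeff m) ms H)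
          (ms.length * (400 * (lam * (totalLen ps * (d + 1))))) := by
      intro ms rows h
      induction h with
      | nil => exact (Spec.pure .nil).le (by simp)
      | @cons m row ms rows hab _ ih =>
        refine Spec.le (Spec.bind (crt_spec hM hT hps hL his (hP m) hab) fun z hz =>
          Spec.bind ih fun r hr => Spec.pure (.cons hz.2 hr))
          (by rw [List.length_cons, add_mul ms.length, one_mul]; omega)
    simpa using hmap hcols

/-! ## Extraction of the coefficients -/

theorem eval_eq_divX (q : ℕ[X]) (b : ℕ) : q.eval b = q.coeff 0 + b * q.divX.eval b := by
  conv_lhs => rw [← X_mul_divX_add q]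
  simp [add_comm]

/-- Uniqueness of digits in base `b`: the lowest one is the value modulo `b`, and `divX` passes to
the remaining ones. -/
theorem coeff_eq_of_eval_eq {b : ℕ} : ∀ (n : ℕ) {p q : ℕ[X]}, (∀ i, p.coeff i < b) →
    (∀ i, q.coeff i < b) → p.eval b = q.eval b → p.coeff n = q.coeff n := by
  have h0 : ∀ {p q : ℕ[X]}, (∀ i, p.coeff i < b) → (∀ i, q.coeff i < b) → p.eval b = q.eval b →
      p.coeff 0 = q.coeff 0 := by
    intro p q hp hq h
    rw [eval_eq_divX p, eval_eq_divX q] at h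
    have := congrArg (· % b) h
    simpa [Nat.add_mul_mod_self_left, Nat.mod_eq_of_lt (hp 0), Nat.mod_eq_of_lt (hq 0)] using this
  intro n
  induction n with
  | zero => exact h0
  | succ n ih =>
    intro p q hp hq h
    have h1 := h0 hp hq h
    rw [eval_eq_divX p, eval_eq_divX q, h1] at h
    have h2 : p.divX.eval b = q.divX.eval b :=
      Nat.eq_of_mul_eq_mul_left (Nat.zero_lt_of_lt (hp 0)) (Nat.add_left_cancel h)
    have := ih (p := p.divX) (q := q.divX) (fun i => by simpa [coeff_divX] using hp (i + 1))
      (fun i => by simpa [coeff_divX] using hq (i + 1)) h2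
    simpa [coeff_divX] using this

theorem eq_of_eval_eq {b : ℕ} {p q : ℕ[X]} (hp : ∀ i, p.coeff i < b) (hq : ∀ i, q.coeff i < b)
    (h : p.eval b = q.eval b) : p = q :=
  Polynomial.ext fun n => coeff_eq_of_eval_eq n hp hq h

theorem eval_lt_pow {b : ℕ} : ∀ {n : ℕ} {q : ℕ[X]}, (∀ i, q.coeff i < b) →
    (∀ i, n ≤ i → q.coeff i = 0) → q.eval b < b ^ n := by
  intro n
  induction n with
  | zero =>
    intro q _ h
    have : q = 0 := Polynomial.ext fun i => by simpa using h i (Nat.zero_le i)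
    simp [this]
  | succ n ih =>
    intro q hq h
    have h1 := ih (q := q.divX) (fun i => by simpa [coeff_divX] using hq (i + 1))
      (fun i hi => by simpa [coeff_divX] using h (i + 1) (by omega))
    rw [eval_eq_divX]
    calc q.coeff 0 + b * q.divX.eval b < b + b * q.divX.eval b := Nat.add_lt_add_right (hq 0) _
      _ = b * (q.divX.eval b + 1) := by ring
      _ ≤ b * b ^ n := Nat.mul_le_mul_left _ h1
      _ = b ^ (n + 1) := by ring

theorem addDigits_spec {s : ℕ} : ∀ {n : ℕ} {a b : Poly},
    OkV (fun c : Bits => c.length = s) n a → OkV (fun c : Bits => c.length = s) n b →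
    (∀ i, (pv toNat a + pv toNat b).coeff i < 2 ^ s) →
    Spec (zipB (fun x y => do
      let t ← addBits x y
      resize s t) a b) (fun r => OkV (fun c : Bits => c.length = s) n r ∧
        pv toNat r = pv toNat a + pv toNat b) (n * (6 * s))
  | 0, a, b, ha, hb, _ => by
    rw [ha.eq_nil, hb.eq_nil, zipB.eq_def]
    exact Spec.le (Spec.pure ⟨OkV.nil, by simp⟩) (by simp)
  | n + 1, a, b, ha, hb, h => by
    obtain ⟨x, a, rfl, hx, ha⟩ := okV_succ ha
    obtain ⟨y, b, rfl, hy, hb⟩ := okV_succ hb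
    have h0 := h 0
    simp only [pv_cons, coeff_add, coeff_C_zero, mul_coeff_zero, coeff_X_zero, zero_mul,
      add_zero] at h0
    have h1 : ∀ i, (pv toNat a + pv toNat b).coeff i < 2 ^ s := fun i => by
      simpa [coeff_C_succ, coeff_X_mul] using h (i + 1)
    rw [zipB.eq_def]
    refine Spec.le (Spec.bind (P := fun z => z.length = s ∧ toNat z = toNat x + toNat y)
      (Spec.bind (addBits_spec hx hy) fun t ht =>
      (resize_spec_of_lt (w := s) (by rw [ht.2]; exact h0)).imp fun z hz =>
        ⟨hz.1, hz.2.trans ht.2⟩) fun z hz =>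
      Spec.bind (addDigits_spec ha hb h1) fun r hr =>
      Spec.pure ⟨OkV.cons hz.1 hr.1, ?_⟩) (by ring_nf; omega)
    rw [pv_cons, pv_cons, pv_cons, hr.2, hz.2, C_add]
    ring

/-- The invariant is that `prev` holds the upper digits of the preceding coefficient. All quantities
are nonnegative, so every digit sum is bounded by a coefficient of the final polynomial, and cutting
it to `s` bits loses nothing. The zero word appended to the `B - 1` upper digits restores the length
`B`. -/
theorem extractAux_spec {B s : ℕ} (hB : 0 < B) : ∀ {qs : List ℕ[X]} {Hs prev : Poly},
    List.Forall₂ (fun q H => toNat H = q.eval (2 ^ s) ∧ (∀ i, q.coeff i < 2 ^ s) ∧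
      ∀ i, 2 * B - 1 ≤ i → q.coeff i = 0) qs Hs →
    OkV (fun c : Bits => c.length = s) B prev →
    (∀ i, (pv toNat prev + (pv id qs).eval (X ^ B)).coeff i < 2 ^ s) →
    Spec (extractAux B s prev Hs) (fun r => OkV (fun c : Bits => c.length = s)
      ((qs.length + 1) * B) r ∧ pv toNat r = pv toNat prev + (pv id qs).eval (X ^ B))
      (qs.length * (9 * (B * s)))
  | [], Hs, prev, hH, hprev, _ => by
    cases hH
    rw [extractAux.eq_def]
    exact Spec.le (Spec.pure ⟨by simpa using hprev, by simp⟩) (by simp)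
  | q :: qs, Hs, prev, hH, hprev, hlt => by
    obtain ⟨H, Hs, ⟨hH1, hH2, hH3⟩, hH', rfl⟩ := List.forall₂_cons_left_iff.1 hH
    rw [extractAux]
    refine Spec.le (Spec.bind (chop_spec le_rfl (2 * B - 1) H) fun D hD => ?_)
      (c := (2 * B - 1) * s + (B * (6 * s) + (s + qs.length * (9 * (B * s))))) ?_
    · obtain ⟨hD1, hD2, hD3⟩ := hD
      have hDok : OkV (fun c : Bits => c.length = s) (2 * B - 1) D :=
        ⟨hD1, fun c hc => (hD2 c hc).1⟩
      have hDq : pv toNat D = q := by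
        refine eq_of_eval_eq (b := 2 ^ s) (fun i => ?_) hH2 ?_
        · rw [pv_coeff]
          rcases h : D[i]? with _ | c
          · simp
          · exact (hD2 c (List.mem_of_getElem? h)).2
        · rw [hD3, hH1]
          refine Nat.mod_eq_of_lt ?_
          rw [mul_comm, pow_mul]
          exact eval_lt_pow hH2 hH3
      have htake := hDok.take (m := B) (by omega)
      have hdrop := hDok.drop B
      have hsplit : q = pv toNat (D.take B) + X ^ B * pv toNat (D.drop B) := by
        rw [← hDq]
        conv_lhs => rw [← List.take_append_drop B D, pv_append, htake.1]
      have htot : pv toNat prev + (pv id (q :: qs)).eval (X ^ B) =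
          (pv toNat (D.take B) + pv toNat prev) +
            X ^ B * (pv toNat (D.drop B) + (pv id qs).eval (X ^ B)) := by
        simp only [pv_cons, eval_add, eval_C, eval_mul, eval_X, id]
        conv_lhs => rw [hsplit]
        ring
      rw [htot] at hlt ⊢
      refine Spec.bind (addDigits_spec htake hprev fun i => lt_of_le_of_lt ?_ (hlt i))
        fun cur hcur => Spec.bind (resize_spec s []) fun z hz => ?_
      · rw [coeff_add (pv toNat (D.take B) + pv toNat prev)]
        exact Nat.le_add_right _ _
      have hz0 : pv toNat (D.drop B ++ [z]) = pv toNat (D.drop B) := by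
        rw [pv_append]
        have : toNat z = 0 := by simpa using hz.2
        simp [this]
      have hnew : OkV (fun c : Bits => c.length = s) B (D.drop B ++ [z]) := by
        have := hdrop.append (OkV.cons (ok := fun c : Bits => c.length = s) hz.1 OkV.nil)
        rwa [show 2 * B - 1 - B + (0 + 1) = B by omega] at this
      refine Spec.le (Spec.bind (extractAux_spec hB hH' hnew fun i => ?_) fun r hr =>
        Spec.pure ⟨?_, ?_⟩) (add_zero _).le
      · rw [hz0]
        refine lt_of_le_of_lt ?_ (hlt (i + B))
        rw [coeff_add (pv toNat (D.take B) + pv toNat prev), coeff_X_pow_mul]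
        exact Nat.le_add_left _ _
      · have := hcur.1.append hr.1
        rwa [show B + (qs.length + 1) * B = ((q :: qs).length + 1) * B by
          rw [List.length_cons]; ring] at this
      · rw [pv_append, hcur.1.1, hcur.2, hr.2, hz0]
    · have h1 : (2 * B - 1) * s + s = 2 * (B * s) := by
        rw [← Nat.succ_mul, show Nat.succ (2 * B - 1) = 2 * B by omega, mul_assoc]
      rw [List.length_cons, add_mul qs.length]
      have : B * (6 * s) = 6 * (B * s) := by ring
      omega

theorem extract_spec {B s : ℕ} (hB : 0 < B) {qs : List ℕ[X]} {Hs : Poly}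
    (hH : List.Forall₂ (fun q H => toNat H = q.eval (2 ^ s) ∧ (∀ i, q.coeff i < 2 ^ s) ∧
      ∀ i, 2 * B - 1 ≤ i → q.coeff i = 0) qs Hs)
    (hlt : ∀ i, ((pv id qs).eval (X ^ B)).coeff i < 2 ^ s) :
    Spec (extract B s Hs) (fun r => OkV (fun c : Bits => c.length = s) ((qs.length + 1) * B) r ∧
      pv toNat r = (pv id qs).eval (X ^ B)) ((qs.length + 1) * (9 * (B * s))) := by
  have hz : ∀ l : List ℕ, Spec (mapB (fun _ => resize s []) l)
      (fun r => OkV (fun c : Bits => c.length = s) l.length r ∧ pv toNat r = 0)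
      (l.length * s) := by
    intro l
    induction l with
    | nil => exact (Spec.pure ⟨OkV.nil, by simp⟩).le (by simp)
    | cons i l ih =>
      refine Spec.le (Spec.bind (resize_spec s []) fun z hz => Spec.bind ih fun r hr =>
        Spec.pure ⟨OkV.cons hz.1 hr.1, ?_⟩) (by rw [List.length_cons, Nat.succ_mul]; omega)
      have : toNat z = 0 := by simpa using hz.2
      simp [this, hr.2]
  have h := hz (List.range B)
  rw [List.length_range] at h
  refine Spec.le (Spec.bind h fun z hz => (extractAux_spec hB hH hz.1 (by simpa [hz.2] using hlt)).imp
    fun r hr => ⟨hr.1, by simpa [hz.2] using hr.2⟩) ?_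
  rw [add_mul qs.length]
  omega

/-! ### Assembly of the five stages -/

/-- There is no cancellation over `ℕ`: the left side is part of one of the summands whose total is
the right side. Hence the bound on the coefficients of `f * g` bounds all digits of the bundled
product. -/
theorem coeff_coeff_le (Q : ℕ[X][X]) (B m j : ℕ) :
    (Q.coeff m).coeff j ≤ (Q.eval (X ^ B)).coeff (m * B + j) := by
  rcases le_or_gt m Q.natDegree with h | h
  · rw [eval_eq_sum_range, finsetSum_coeff]
    refine le_trans (le_of_eq ?_) (Finset.single_le_sum
      (f := fun i => (Q.coeff i * (X ^ B) ^ i).coeff (m * B + j)) (fun i _ => Nat.zero_le _)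
      (Finset.mem_range.2 (Nat.lt_succ_of_le h)))
    rw [← pow_mul, mul_comm B m, add_comm, coeff_mul_X_pow]
  · rw [coeff_eq_zero_of_natDegree_lt h]
    simp

theorem pv_map_range_coeff {A : Type*} [Semiring A] {P : A[X]} {n : ℕ}
    (h : ∀ i, n ≤ i → P.coeff i = 0) : pv id ((List.range n).map P.coeff) = P := by
  refine Polynomial.ext fun i => ?_
  rw [pv_coeff]
  rcases lt_or_ge i n with hi | hi
  · simp [hi]
  · simp [hi, h i hi]

/-- Two cost factors are kept apart: `lam` for words as long as the product of the primes, in the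
tree stages, and `lam'` for words as long as a single prime, in stage 3. Using `lam` in stage 3 as
well would spoil the second term of the bound. -/
theorem multiply_spec {N₀ B s d W lam L lam' L' : ℕ} (hB : 0 < B) (hN : 0 < N₀)
    {ps : List Bits} (hps : GoodPrimes ps)
    (hprod : 2 ^ ((2 * B - 1) * s) < (ps.map toNat).prod) (hd : ps.length ≤ 2 ^ d)
    (hW : ∀ p ∈ ps, p.length ≤ W) (hM : MulBound lam L) (hL : 2 * totalLen ps + 4 ≤ L)
    (hM' : MulBound lam' L') (hL' : 2 * W + 4 ≤ L') (hBs : B * s ≤ totalLen ps) {f g : Poly}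
    (hf : OkV (fun c : Bits => c.length = s) (N₀ * B) f)
    (hg : OkV (fun c : Bits => c.length = s) (N₀ * B) g)
    (hfg : ∀ i, (pv toNat f * pv toNat g).coeff i < 2 ^ s) :
    Spec (multiply (N₀ * B) B s ps f g) (fun r =>
      OkV (fun c : Bits => c.length = s) (2 * (N₀ * B)) r ∧ pv toNat r = pv toNat f * pv toNat g)
      (13000 * (N₀ * totalLen ps * (lam * (d + 1 + W)) + N₀ * totalLen ps *
        (Nat.clog 2 (2 * N₀) * (lam' + Nat.size (Nat.clog 2 (2 * N₀)) + 1)))) := by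
  have hne : ps ≠ [] := by
    rintro rfl
    simp at hprod
  rw [multiply, Nat.mul_div_cancel _ hB]
  refine Spec.le (Spec.bind (bundle_spec hf) fun F hF => Spec.bind (bundle_spec hg) fun G hG =>
    Spec.bind (prodTree_spec hM hne hps.noLead le_rfl hd (by omega)) fun T hT =>
    Spec.bind (reduceAll_spec hM hT hL hF.1) fun Fs hFs =>
    Spec.bind (reduceAll_spec hM hT hL hG.1) fun Gs hGs =>
    Spec.bind (mulAll_spec hM' hN (fun p hp => ⟨hps.noLead p hp, hps.odd p hp,
      by have := hW p hp; omega⟩) hFs hGs) fun Hs hHs =>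
    Spec.bind (P := fun H => ∃ qs : List ℕ[X], qs.length = 2 * N₀ - 1 ∧
      List.Forall₂ (fun q H => toNat H = q.eval (2 ^ s) ∧ (∀ i, q.coeff i < 2 ^ s) ∧
        ∀ i, 2 * B - 1 ≤ i → q.coeff i = 0) qs H ∧
      (pv id qs).eval (X ^ B) = pv toNat f * pv toNat g)
      (c := 1000 * (lam * (totalLen ps * (d + 1 + W))) + ((2 * N₀ - 1) * totalLen ps +
        (2 * N₀ - 1) * (400 * (lam * (totalLen ps * (d + 1))))))
      (d := 2 * N₀ * (9 * (B * s))) ?_ fun H hH => ?_) ?_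
  · obtain ⟨hF1, QF, hQF1, hQF2, hQF3⟩ := hF
    obtain ⟨hG1, QG, hQG1, hQG2, hQG3⟩ := hG
    have hQ : (QF * QG).eval (X ^ B) = pv toNat f * pv toNat g := by
      rw [eval_mul, hQF2, hQG2]
    have hev : ∀ m, ((QF * QG).coeff m).eval (2 ^ s) = (pv toNat F * pv toNat G).coeff m := by
      intro m
      rw [← hQF1, ← hQG1, ← Polynomial.map_mul, coeff_map, coe_evalRingHom]
    have hlt : ∀ m j, ((QF * QG).coeff m).coeff j < 2 ^ s := fun m j =>
      (coeff_coeff_le (QF * QG) B m j).trans_lt (by rw [hQ]; exact hfg _)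
    have hdeg : ∀ m j, 2 * B - 1 ≤ j → ((QF * QG).coeff m).coeff j = 0 := by
      intro m j hj
      rw [coeff_mul, finsetSum_coeff]
      exact Finset.sum_eq_zero fun x _ => coeff_mul_eq_zero (hQF3 _) (hQG3 _) (by omega)
    have hcF : ∀ {F : Poly}, F.length = N₀ → ∀ i, N₀ ≤ i → (pv toNat F).coeff i = 0 := by
      intro F hF i hi
      rw [pv_coeff, List.getElem?_eq_none (by omega)]
      rfl
    have hdeg' : ∀ m, 2 * N₀ - 1 ≤ m → (QF * QG).coeff m = 0 := by
      intro m hm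
      refine eq_of_eval_eq (hlt m) (by simp) ?_
      rw [hev, coeff_mul_eq_zero (hcF hF1.1) (hcF hG1.1) (by omega), eval_zero]
    -- A coefficient of the bundled product has `2 * B - 1` digits below `2 ^ s`, so it is less than
    -- the product of the primes.
    have hsmall : ∀ i, (pv toNat F * pv toNat G).coeff i < toNat T.value := by
      intro i
      rw [hT.toNat_value, ← hev]
      refine lt_trans ?_ hprod
      rw [mul_comm, pow_mul]
      exact eval_lt_pow (hlt i) (hdeg i)
    refine (reconstruct_spec hM hT hps hL hW hsmall (hHs.imp fun p h hh => ⟨hh.1, ?_⟩)).imp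
      fun H hH => ⟨(List.range (2 * N₀ - 1)).map (QF * QG).coeff, by simp, ?_, ?_⟩
    · rw [hh.2, Polynomial.map_mul, map_pv, map_pv]
      rfl
    · rw [List.forall₂_map_left_iff]
      exact hH.imp fun m z hz => ⟨by rw [hz, hev], hlt m, hdeg m⟩
    · rw [pv_map_range_coeff hdeg', hQ]
  · obtain ⟨qs, h1, h2, h3⟩ := hH
    have := extract_spec hB h2 (by rw [h3]; exact hfg)
    rw [h1, h3, Nat.sub_add_cancel (by omega), mul_assoc 2 N₀ B] at this
    exact this
  · set S := totalLen ps
    set k := Nat.clog 2 (2 * N₀)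
    have h7 := hM.1
    have h7' := hM'.1
    have e1 : N₀ * (B * s) ≤ N₀ * S * (lam * (d + 1 + W)) := by
      calc N₀ * (B * s) ≤ N₀ * S * 1 := by rw [mul_one]; gcongr
        _ ≤ _ := by gcongr; nlinarith
    have e2 : N₀ * S ≤ N₀ * S * (lam * (d + 1 + W)) :=
      Nat.le_mul_of_pos_right _ (by positivity)
    have e3 : d * (2 * (lam * S)) ≤ 2 * (N₀ * S * (lam * (d + 1 + W))) := by
      calc d * (2 * (lam * S)) = 2 * (1 * S * (lam * d)) := by ring
        _ ≤ _ := by gcongr <;> omega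
    have e4 : N₀ * (130 * (lam * (B * s + (3 * d + 1) * S)) + S) ≤
        391 * (N₀ * S * (lam * (d + 1 + W))) := by
      calc N₀ * (130 * (lam * (B * s + (3 * d + 1) * S)) + S)
          ≤ N₀ * (130 * (lam * (S + (3 * d + 1) * S)) + S) := by gcongr
        _ = 130 * (N₀ * S * (lam * (3 * d + 2))) + N₀ * S := by ring
        _ ≤ 130 * (N₀ * S * (lam * (3 * (d + 1 + W)))) + N₀ * S := by gcongr; omega
        _ = 390 * (N₀ * S * (lam * (d + 1 + W))) + N₀ * S := by ring
        _ ≤ _ := by omega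
    -- Here `12512 = 8 * 1564`; this is the largest coefficient, and 13000 leaves room for it. The
    -- tree stages and the linear passes together need far less.
    have e5 : 8 * N₀ * k * (1564 * lam' + 19 * (21 * Nat.size k + 18)) * S ≤
        12512 * (N₀ * S * (k * (lam' + Nat.size k + 1))) := by
      calc 8 * N₀ * k * (1564 * lam' + 19 * (21 * Nat.size k + 18)) * S
          ≤ 8 * N₀ * k * (1564 * (lam' + Nat.size k + 1)) * S := by gcongr; omega
        _ = _ := by ring
    have e6 : 1000 * (lam * (S * (d + 1 + W))) ≤ 1000 * (N₀ * S * (lam * (d + 1 + W))) := by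
      calc 1000 * (lam * (S * (d + 1 + W))) = 1000 * (1 * S * (lam * (d + 1 + W))) := by ring
        _ ≤ _ := by gcongr; omega
    have e7 : (2 * N₀ - 1) * S ≤ 2 * (N₀ * S) := by
      rw [← mul_assoc]; gcongr; omega
    have e8 : (2 * N₀ - 1) * (400 * (lam * (S * (d + 1)))) ≤
        800 * (N₀ * S * (lam * (d + 1 + W))) := by
      calc (2 * N₀ - 1) * (400 * (lam * (S * (d + 1))))
          ≤ (2 * N₀) * (400 * (lam * (S * (d + 1 + W)))) := Nat.mul_le_mul (by omega)
            (Nat.mul_le_mul_left _ (Nat.mul_le_mul_left _ (Nat.mul_le_mul_left _ (by omega))))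
        _ = _ := by ring
    have e9 : 2 * N₀ * (9 * (B * s)) = 18 * (N₀ * (B * s)) := by ring
    omega

/-! ## The asymptotic bound -/

theorem size_mul_le (a b : ℕ) : Nat.size (a * b) ≤ Nat.size a + Nat.size b := by
  rw [Nat.size_le, pow_add]
  exact Nat.mul_lt_mul'' (Nat.lt_size_self a) (Nat.lt_size_self b)

theorem size_le_log {x : ℕ} (hx : 2 ≤ x) : (Nat.size x : ℝ) ≤ 5 * Real.log x := by
  have h2 := Real.log_two_gt_d9
  obtain ⟨m, hm⟩ := Nat.exists_eq_add_one.2 (Nat.size_pos.2 (by omega : 0 < x))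
  have h1 : 2 ^ m ≤ x := Nat.lt_size.1 (by omega)
  have h3 : (m : ℝ) * Real.log 2 ≤ Real.log x := by
    rw [← Real.log_pow]
    exact Real.log_le_log (by positivity) (by exact_mod_cast h1)
  have h4 : Real.log 2 ≤ Real.log x := Real.log_le_log (by norm_num) (by exact_mod_cast hx)
  rw [hm]
  push_cast
  have h0 : (0 : ℝ) ≤ m := by positivity
  nlinarith

theorem clog_le_log {n : ℕ} (hn : 2 ≤ n) : (Nat.clog 2 (2 * n) : ℝ) ≤ 5 * Real.log n := by
  have h2 := Real.log_two_gt_d9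
  have h5 : Nat.clog 2 (2 * n) = Nat.clog 2 n + 1 := by
    rw [Nat.clog_of_two_le (by norm_num) (by omega)]
    congr 2
    omega
  have h6 : 0 < Nat.clog 2 n := Nat.clog_pos (by norm_num) hn
  obtain ⟨m, hm⟩ := Nat.exists_eq_add_one.2 h6
  have h1 : 2 ^ m < n := by
    have := Nat.pow_pred_clog_lt_self (b := 2) (by norm_num) (x := n) (by omega)
    rwa [hm] at this
  have h3 : (m : ℝ) * Real.log 2 ≤ Real.log n := by
    rw [← Real.log_pow]
    exact Real.log_le_log (by positivity) (by exact_mod_cast h1.le)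
  have h4 : Real.log 2 ≤ Real.log n := Real.log_le_log (by norm_num) (by exact_mod_cast hn)
  rw [h5, hm]
  push_cast
  have h0 : (0 : ℝ) ≤ m := by positivity
  nlinarith

/-- The size and `Nat.clog` of the left side are at least 1, while a logarithm vanishes when `x = 1`
or `n = 1`. The hypothesis `2 ≤ n * x` excludes that both happen; the term equal to 1 is absorbed by
the other one, which costs the factor 2. -/
theorem size_rpow_add_clog_rpow_le {ε : ℝ} (hε : 0 < ε) {x n : ℕ} (hx : 0 < x) (hn : 0 < n)
    (hxn : 2 ≤ n * x) :
    (Nat.size x : ℝ) ^ (2 + ε) + (Nat.clog 2 (2 * n) : ℝ) ^ (1 + ε) ≤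
      2 * 5 ^ (2 + ε) * (Real.log x ^ (2 + ε) + Real.log n ^ (1 + ε)) := by
  have hlx : 0 ≤ Real.log x := Real.log_natCast_nonneg x
  have hln : 0 ≤ Real.log n := Real.log_natCast_nonneg n
  have hk : 1 ≤ Nat.clog 2 (2 * n) := Nat.clog_pos (by norm_num) (by omega)
  have hl : 1 ≤ Nat.size x := Nat.size_pos.2 hx
  have hk1 : (1 : ℝ) ≤ (Nat.clog 2 (2 * n) : ℝ) ^ (1 + ε) :=
    Real.one_le_rpow (by exact_mod_cast hk) (by linarith)
  have hl1 : (1 : ℝ) ≤ (Nat.size x : ℝ) ^ (2 + ε) :=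
    Real.one_le_rpow (by exact_mod_cast hl) (by linarith)
  have h5 : (5 : ℝ) ^ (1 + ε) ≤ 5 ^ (2 + ε) := Real.rpow_le_rpow_of_exponent_le (by norm_num) (by linarith)
  have hX : 2 ≤ x → (Nat.size x : ℝ) ^ (2 + ε) ≤ 5 ^ (2 + ε) * Real.log x ^ (2 + ε) := fun h => by
    rw [← Real.mul_rpow (by norm_num) hlx]
    exact Real.rpow_le_rpow (by positivity) (size_le_log h) (by linarith)
  have hK : 2 ≤ n → (Nat.clog 2 (2 * n) : ℝ) ^ (1 + ε) ≤ 5 ^ (2 + ε) * Real.log n ^ (1 + ε) :=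
      fun h => by
    refine le_trans ?_ (mul_le_mul_of_nonneg_right h5 (by positivity))
    rw [← Real.mul_rpow (by norm_num) hln]
    exact Real.rpow_le_rpow (by positivity) (clog_le_log h) (by linarith)
  have h1 : 0 ≤ (5 : ℝ) ^ (2 + ε) * Real.log x ^ (2 + ε) := by positivity
  have h2 : 0 ≤ (5 : ℝ) ^ (2 + ε) * Real.log n ^ (1 + ε) := by positivity
  rcases Nat.lt_or_ge x 2 with hx2 | hx2
  · obtain rfl : x = 1 := by omega
    have := hK (by omega)
    have : (Nat.size 1 : ℝ) ^ (2 + ε) = 1 := by simp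
    linarith
  · have := hX hx2
    rcases Nat.lt_or_ge n 2 with hn2 | hn2
    · obtain rfl : n = 1 := by omega
      have : (Nat.clog 2 (2 * 1) : ℝ) ^ (1 + ε) = 1 := by
        rw [show Nat.clog 2 (2 * 1) = 1 by decide]
        simp
      linarith
    · have := hK hn2
      linarith

/-- Replace both factors by the larger of `a` and `b`. This splits the mixed term that arises when
stage 3 multiplies integers of `O(log (B s))` bits. -/
theorem mul_rpow_le_rpow_add_rpow {ε a b : ℝ} (hε : 0 ≤ ε) (ha : 0 < a) (hb : 0 < b) :
    a * b ^ ε ≤ a ^ (1 + ε) + b ^ (1 + ε) := by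
  rw [Real.rpow_add ha, Real.rpow_add hb, Real.rpow_one, Real.rpow_one]
  rcases le_total a b with h | h
  · have : a * b ^ ε ≤ b * b ^ ε := by gcongr
    have : 0 ≤ a * a ^ ε := by positivity
    linarith
  · have : a * b ^ ε ≤ a * a ^ ε := by gcongr
    have : 0 ≤ b * b ^ ε := by positivity
    linarith

/-- `C` depends only on `ε` and `K`, and the two factors depend on `x` but not on `n`. With `ℓ =
size x`, `lam` is `O(ℓ ^ (1 + ε))` and the tree depth contributes one more `ℓ`; `lam'` is `O(ℓ ^
ε)`, and `mul_rpow_le_rpow_add_rpow` treats its product with `k`. -/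
theorem exists_stage_bound {ε : ℝ} (hε : 0 < ε) (K : ℕ) :
    ∃ C : ℝ, 0 ≤ C ∧ ∀ x : ℕ, 0 < x → ∃ lam lam' : ℕ, MulBound lam (2 * (K * x) + 4) ∧
      MulBound lam' (2 * (K * Nat.size x) + 4) ∧ ∀ d n : ℕ, d ≤ Nat.size (K * x) → 0 < n →
        ((lam * (d + 1 + K * Nat.size x) : ℕ) : ℝ) +
          ((Nat.clog 2 (2 * n) * (lam' + Nat.size (Nat.clog 2 (2 * n)) + 1) : ℕ) : ℝ) ≤
          C * ((Nat.size x : ℝ) ^ (2 + ε) + (Nat.clog 2 (2 * n) : ℝ) ^ (1 + ε)) := by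
  obtain ⟨D, hD1, hD⟩ := exists_mulBound hε
  -- For words of prime size the crude exponent 2 suffices: the square of an iterated logarithm is
  -- at most a constant times `ℓ ^ ε`, since `size ℓ ≤ E' * ℓ ^ (ε / 2)`.
  obtain ⟨D', hD1', hD'⟩ := exists_mulBound one_pos
  obtain ⟨E, hE1, hE⟩ := exists_size_le_rpow hε
  obtain ⟨E', hE1', hE'⟩ := exists_size_le_rpow (half_pos hε)
  set a : ℕ := Nat.size (2 * K + 4) + 1 with ha
  set b : ℕ := Nat.size K + K + 2 with hb
  have hsz : ∀ y : ℕ, 0 < y → Nat.size (2 * (K * y) + 4) ≤ a * Nat.size y := fun y hy => by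
    have h1 : 2 * (K * y) + 4 ≤ (2 * K + 4) * y := by nlinarith
    have h2 : 1 ≤ Nat.size y := Nat.size_pos.2 hy
    calc _ ≤ Nat.size ((2 * K + 4) * y) := Nat.size_le_size h1
      _ ≤ Nat.size (2 * K + 4) + Nat.size y := size_mul_le _ _
      _ ≤ Nat.size (2 * K + 4) * Nat.size y + Nat.size y := by
        gcongr; exact Nat.le_mul_of_pos_right _ h2
      _ = _ := by rw [ha]; ring
  refine ⟨D * a ^ (1 + ε) * b + D' * (a * E') ^ (2 : ℝ) + E + 1, by positivity, fun x hx => ?_⟩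
  obtain ⟨lam, hlam, hlam2⟩ := hD (2 * (K * x) + 4) (by omega)
  obtain ⟨lam', hlam', hlam2'⟩ := hD' (2 * (K * Nat.size x) + 4) (by omega)
  refine ⟨lam, lam', hlam, hlam', fun d n hd hn => ?_⟩
  set k := Nat.clog 2 (2 * n)
  set ℓ := Nat.size x
  have hk : 1 ≤ k := Nat.clog_pos (by norm_num) (by omega)
  have hl : 1 ≤ ℓ := Nat.size_pos.2 hx
  have hkR : (1 : ℝ) ≤ k := by exact_mod_cast hk
  have hlR : (1 : ℝ) ≤ ℓ := by exact_mod_cast hl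
  have h1 : ((lam * (d + 1 + K * ℓ) : ℕ) : ℝ) ≤ D * a ^ (1 + ε) * b * (ℓ : ℝ) ^ (2 + ε) := by
    have e1 : d + 1 + K * ℓ ≤ b * ℓ := by
      have := hd.trans (size_mul_le K x)
      have : Nat.size K ≤ Nat.size K * ℓ := Nat.le_mul_of_pos_right _ hl
      rw [hb, add_mul, add_mul]
      omega
    have e2 : (lam : ℝ) ≤ D * ((a : ℝ) ^ (1 + ε) * (ℓ : ℝ) ^ (1 + ε)) := by
      refine hlam2.trans ?_
      rw [← Real.mul_rpow (by positivity) (by positivity)]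
      gcongr
      exact_mod_cast hsz x hx
    calc ((lam * (d + 1 + K * ℓ) : ℕ) : ℝ) ≤ ((lam * (b * ℓ) : ℕ) : ℝ) := by gcongr
      _ = lam * (b * ℓ) := by push_cast; ring
      _ ≤ D * ((a : ℝ) ^ (1 + ε) * (ℓ : ℝ) ^ (1 + ε)) * (b * ℓ) := by gcongr
      _ = D * a ^ (1 + ε) * b * ((ℓ : ℝ) ^ (1 + ε) * ℓ) := by ring
      _ = _ := by
        rw [show (2 : ℝ) + ε = (1 + ε) + 1 by ring, Real.rpow_add_one (by positivity)]
  have h2 : (lam' : ℝ) ≤ D' * (a * E') ^ (2 : ℝ) * (ℓ : ℝ) ^ ε := by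
    refine hlam2'.trans ?_
    have e1 : (Nat.size (2 * (K * ℓ) + 4) : ℝ) ≤ a * E' * (ℓ : ℝ) ^ (ε / 2) := by
      calc (Nat.size (2 * (K * ℓ) + 4) : ℝ) ≤ a * Nat.size ℓ := by exact_mod_cast hsz ℓ hl
        _ ≤ a * (E' * (ℓ : ℝ) ^ (ε / 2)) := by gcongr; exact hE' ℓ hl
        _ = _ := by ring
    rw [show (ℓ : ℝ) ^ ε = ((ℓ : ℝ) ^ (ε / 2)) ^ (2 : ℝ) by
      rw [← Real.rpow_mul (by positivity)]; congr 1; ring, mul_assoc,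
      ← Real.mul_rpow (by positivity) (by positivity)]
    norm_num only [show (1 : ℝ) + 1 = 2 by norm_num]
    gcongr
  have h3 : (Nat.size k : ℝ) ≤ E * (k : ℝ) ^ ε := hE k hk
  have h4 : (k : ℝ) * (ℓ : ℝ) ^ ε ≤ (ℓ : ℝ) ^ (2 + ε) + (k : ℝ) ^ (1 + ε) := by
    have := mul_rpow_le_rpow_add_rpow hε.le (zero_lt_one.trans_le hkR) (zero_lt_one.trans_le hlR)
    have h5 : (ℓ : ℝ) ^ (1 + ε) ≤ (ℓ : ℝ) ^ (2 + ε) :=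
      Real.rpow_le_rpow_of_exponent_le hlR (by linarith)
    linarith
  have h6 : (k : ℝ) * (k : ℝ) ^ ε = (k : ℝ) ^ (1 + ε) := by
    rw [Real.rpow_add (by positivity), Real.rpow_one]
  have h7 : (k : ℝ) ≤ (k : ℝ) ^ (1 + ε) := by
    conv_lhs => rw [← Real.rpow_one (k : ℝ)]
    exact Real.rpow_le_rpow_of_exponent_le hkR (by linarith)
  have h8 : 0 ≤ (ℓ : ℝ) ^ (2 + ε) := by positivity
  have h9 : 0 ≤ (k : ℝ) ^ (1 + ε) := by positivity
  set M := D * (a : ℝ) ^ (1 + ε) * b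
  set M' := D' * ((a : ℝ) * E') ^ (2 : ℝ)
  have hM : 0 ≤ M := by positivity
  have hM' : 0 ≤ M' := by positivity
  push_cast at h1 ⊢
  calc _ ≤ M * (ℓ : ℝ) ^ (2 + ε) + k * (M' * (ℓ : ℝ) ^ ε + E * (k : ℝ) ^ ε + 1) := by gcongr
    _ = M * (ℓ : ℝ) ^ (2 + ε) + M' * (k * (ℓ : ℝ) ^ ε) + E * (k * (k : ℝ) ^ ε) + k := by ring
    _ ≤ M * (ℓ : ℝ) ^ (2 + ε) + M' * ((ℓ : ℝ) ^ (2 + ε) + (k : ℝ) ^ (1 + ε)) +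
        E * (k : ℝ) ^ (1 + ε) + (k : ℝ) ^ (1 + ε) := by rw [h6]; gcongr
    _ ≤ _ := by nlinarith [mul_nonneg hM h9, mul_nonneg (zero_le_one.trans hE1) h8]

/-! ### From admissible primes to the cost of the whole algorithm -/

theorem toNat_prod_le (ps : List Bits) : (ps.map toNat).prod ≤ 2 ^ totalLen ps := by
  induction ps with
  | nil => simp [totalLen]
  | cons p ps ih =>
    have : totalLen (p :: ps) = p.length + totalLen ps := by simp [totalLen]
    rw [this, pow_add, List.map_cons, List.prod_cons]
    exact Nat.mul_le_mul (toNat_lt p).le ih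

theorem totalLen_bits (ps : List ℕ) : totalLen (ps.map Nat.bits) = (ps.map Nat.size).sum := by
  simp [totalLen, List.map_map, Function.comp_def, length_bits]

theorem map_toNat_bits (ps : List ℕ) : (ps.map Nat.bits).map toNat = ps := by
  simp [List.map_map, Function.comp_def, toNat_bits]

theorem AdmissiblePrimes.goodPrimes {K B s : ℕ} {ps : List ℕ}
    (h : AdmissiblePrimes K B s ps) : GoodPrimes (ps.map Nat.bits) where
  noLead := by simpa using fun p hp => noLead_bits (h.prime p hp).ne_zero
  prime := by simpa [toNat_bits] using h.prime
  odd := by simpa [toNat_bits] using fun p hp => Nat.odd_iff.1 (h.odd p hp)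
  nodup := by rw [map_toNat_bits]; exact h.nodup

theorem toPoly_eq_map (a : Poly) : toPoly a = (pv toNat a).map (Nat.castRingHom ℤ) := by
  rw [toPoly_eq_pv, map_pv]
  rfl

theorem initAndMultiply_spec {N₀ B s K c : ℕ} {ps : List ℕ} {f g : ℤ[X]} {initF initG : BitM Poly}
    (hB : 0 < B) (hN : 0 < N₀) (hps : AdmissiblePrimes K B s ps)
    (hf : IsCoeffArray (N₀ * B) s f initF.val) (hfc : initF.cost ≤ c * (N₀ * B))
    (hg : IsCoeffArray (N₀ * B) s g initG.val) (hgc : initG.cost ≤ c * (N₀ * B))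
    (hfg : ∀ k, (f * g).coeff k < 2 ^ s) {lam lam' : ℕ} (hM : MulBound lam (2 * (K * (B * s)) + 4))
    (hM' : MulBound lam' (2 * (K * Nat.size (B * s)) + 4)) :
    Spec (initAndMultiply (N₀ * B) B s (ps.map Nat.bits) initF initG)
      (IsCoeffArray (2 * (N₀ * B)) s (f * g)) (2 * (c * (N₀ * B)) +
        13000 * (N₀ * (K * (B * s)) * (lam * (Nat.size (K * (B * s)) + 1 + K * Nat.size (B * s)) +
          Nat.clog 2 (2 * N₀) * (lam' + Nat.size (Nat.clog 2 (2 * N₀)) + 1)))) := by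
  obtain ⟨hf1, hf2, rfl⟩ := hf
  obtain ⟨hg1, hg2, rfl⟩ := hg
  have hS : totalLen (ps.map Nat.bits) ≤ K * (B * s) := by
    rw [totalLen_bits]
    exact hps.total_size
  -- The primes need at least `(2 B - 1) s ≥ B s` bits to have so large a product, so their total
  -- length is comparable with `B s`.
  have hBs : B * s ≤ totalLen (ps.map Nat.bits) := by
    have h1 := toNat_prod_le (ps.map Nat.bits)
    rw [map_toNat_bits] at h1
    have h2 := (Nat.pow_lt_pow_iff_right one_lt_two).1 (hps.lt_prod.trans_le h1)
    have h3 : B * s ≤ (2 * B - 1) * s := Nat.mul_le_mul_right _ (by omega)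
    omega
  -- Every prime has at least one bit, so the number of primes, and through it the tree depth, is
  -- controlled by the total length.
  have hlen : ps.length ≤ K * (B * s) := by
    refine le_trans ?_ hps.total_size
    calc ps.length = (ps.map Nat.size).length * 1 := by simp
      _ ≤ (ps.map Nat.size).sum := by
        rw [← smul_eq_mul]
        refine List.card_nsmul_le_sum _ _ fun x hx => ?_
        obtain ⟨p, hp, rfl⟩ := List.mem_map.1 hx
        exact Nat.size_pos.2 (hps.prime p hp).pos
  have hmul : toPoly initF.val * toPoly initG.val =
      (pv toNat initF.val * pv toNat initG.val).map (Nat.castRingHom ℤ) := by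
    rw [toPoly_eq_map, toPoly_eq_map, Polynomial.map_mul]
  rw [hmul] at hfg ⊢
  have hfg' : ∀ i, (pv toNat initF.val * pv toNat initG.val).coeff i < 2 ^ s := fun i => by
    have := hfg i
    rw [coeff_map, eq_natCast] at this
    exact_mod_cast this
  have hd : (ps.map Nat.bits).length ≤ 2 ^ Nat.size (K * (B * s)) := by
    rw [List.length_map]
    exact hlen.trans (Nat.lt_size_self _).le
  have hW : ∀ p ∈ ps.map Nat.bits, p.length ≤ K * Nat.size (B * s) := by
    intro p hp
    obtain ⟨q, hq, rfl⟩ := List.mem_map.1 hp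
    rw [length_bits]
    exact hps.word_size q hq
  have hspec := multiply_spec hB hN hps.goodPrimes (by rw [map_toNat_bits]; exact hps.lt_prod)
    hd hW hM (by omega) hM' le_rfl hBs ⟨hf1, hf2⟩ ⟨hg1, hg2⟩ hfg'
  replace hspec := hspec.imp (Q := IsCoeffArray (2 * (N₀ * B)) s _)
    fun r hr => ⟨hr.1.1, hr.1.2, by rw [toPoly_eq_map, hr.2]⟩
  generalize (pv toNat initF.val * pv toNat initG.val).map (Nat.castRingHom ℤ) = h at hspec ⊢
  refine Spec.le (Spec.bind (P := fun a => a = initF.val) ⟨rfl, hfc⟩ fun a ha =>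
    Spec.bind (P := fun b => b = initG.val) ⟨rfl, hgc⟩ fun b hb => ha ▸ hb ▸ hspec) ?_
  rw [← mul_add (N₀ * totalLen _)]
  have h1 : N₀ * totalLen (ps.map Nat.bits) ≤ N₀ * (K * (B * s)) := Nat.mul_le_mul_left _ hS
  have h2 := Nat.mul_le_mul_right (lam * (Nat.size (K * (B * s)) + 1 + K * Nat.size (B * s)) +
    Nat.clog 2 (2 * N₀) * (lam' + Nat.size (Nat.clog 2 (2 * N₀)) + 1)) h1
  omega

end BitAlg

open BitAlg in
theorem mainTheorem3 (ε : ℝ) (hε : 0 < ε) (c K : ℕ) :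
    ∃ A : ℝ, 0 < A ∧
      ∀ (N B s : ℕ) (ps : List ℕ) (f g : ℤ[X]) (initF initG : BitM Poly),
        0 < B → B ∣ N → 0 < s → 2 ≤ N * s →
        AdmissiblePrimes K B s ps →
        IsCoeffArray N s f initF.val → initF.cost ≤ c * N →
        IsCoeffArray N s g initG.val → initG.cost ≤ c * N →
        (∀ k, (f * g).coeff k < 2 ^ s) →
        IsCoeffArray (2 * N) s (f * g)
            (initAndMultiply N B s (ps.map Nat.bits) initF initG).val ∧
          ((initAndMultiply N B s (ps.map Nat.bits) initF initG).cost : ℝ) ≤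
            A * ((N : ℝ) * s * Real.log ((B : ℝ) * s) ^ (2 + ε) +
              (N : ℝ) * s * Real.log ((N : ℝ) / B) ^ (1 + ε)) := by
  obtain ⟨C, hC0, hC⟩ := exists_stage_bound hε K
  -- The summand 1 only makes the constant positive; the last factor converts sizes into logarithms.
  refine ⟨(2 * c + 13000 * K * C + 1) * (2 * 5 ^ (2 + ε)), by positivity, ?_⟩
  rintro N B s ps f g initF initG hB ⟨N₀, rfl⟩ hs hNs hps hf hfc hg hgc hfg
  rw [mul_comm B N₀] at *
  have hN : 0 < N₀ := Nat.pos_of_ne_zero (by rintro rfl; simp at hNs)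
  have hx : 0 < B * s := Nat.mul_pos hB hs
  obtain ⟨lam, lam', hM, hM', hcost⟩ := hC (B * s) hx
  have hspec := initAndMultiply_spec hB hN hps hf hfc hg hgc hfg hM hM'
  refine ⟨hspec.val, ?_⟩
  have h1 := hcost _ N₀ le_rfl hN
  have h2 := size_rpow_add_clog_rpow_le hε hx hN (by rwa [← mul_assoc])
  -- Together with `1 ≤ s` this lets the initialization cost `2 * c * N` be absorbed into the main
  -- term.
  have h3 : (1 : ℝ) ≤ (Nat.size (B * s) : ℝ) ^ (2 + ε) + (Nat.clog 2 (2 * N₀) : ℝ) ^ (1 + ε) := by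
    have : (1 : ℝ) ≤ (Nat.size (B * s) : ℝ) ^ (2 + ε) :=
      Real.one_le_rpow (by exact_mod_cast Nat.size_pos.2 hx) (by linarith)
    have : 0 ≤ (Nat.clog 2 (2 * N₀) : ℝ) ^ (1 + ε) := by positivity
    linarith
  have h4 : ((initAndMultiply (N₀ * B) B s (ps.map Nat.bits) initF initG).cost : ℝ) ≤ _ :=
    Nat.cast_le.2 hspec.cost
  have hdiv : ((N₀ * B : ℕ) : ℝ) / B = N₀ := by
    have : (B : ℝ) ≠ 0 := by positivity
    push_cast
    field_simp
  rw [hdiv, ← mul_add, show (B : ℝ) * s = ((B * s : ℕ) : ℝ) by push_cast; ring]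
  set Y := (Nat.size (B * s) : ℝ) ^ (2 + ε) + (Nat.clog 2 (2 * N₀) : ℝ) ^ (1 + ε)
  have hs1 : (1 : ℝ) ≤ s := by exact_mod_cast hs
  rw [← Nat.cast_add] at h1
  calc ((initAndMultiply (N₀ * B) B s (ps.map Nat.bits) initF initG).cost : ℝ)
      ≤ 2 * (c * ((N₀ * B : ℕ) : ℝ)) + 13000 * (N₀ * (K * ((B : ℝ) * s)) * (C * Y)) := by
        refine h4.trans ?_
        rw [Nat.cast_add, Nat.cast_mul 13000, Nat.cast_mul (N₀ * (K * (B * s)))]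
        push_cast at h1 ⊢
        gcongr
    _ ≤ 2 * (c * ((N₀ * B : ℕ) * s * Y)) + 13000 * (N₀ * (K * ((B : ℝ) * s)) * (C * Y)) := by
        gcongr
        rw [mul_assoc]
        exact le_mul_of_one_le_right (by positivity) (one_le_mul_of_one_le_of_one_le hs1 h3)
    _ = (2 * c + 13000 * K * C) * (((N₀ * B : ℕ) : ℝ) * s * Y) := by push_cast; ring
    _ ≤ (2 * c + 13000 * K * C + 1) * (((N₀ * B : ℕ) : ℝ) * s * Y) :=
        mul_le_mul_of_nonneg_right (by linarith) (by positivity)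
    _ ≤ (2 * c + 13000 * K * C + 1) * (((N₀ * B : ℕ) : ℝ) * s * (2 * 5 ^ (2 + ε) *
        (Real.log ((B * s : ℕ) : ℝ) ^ (2 + ε) + Real.log N₀ ^ (1 + ε)))) := by gcongr
    _ = _ := by ring
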